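/- Let $P=-i\,d/dx$ and let $Q$ be multiplication by $x$ in $L^2(\mathbb R)$, and let $F,G:\mathbb R\to\mathbb R$ be bounded measurable functions such that $C=i[F(P),G(Q)]\ge 0$ and $C\neq 0$. Then, after modification on Lebesgue null sets, $F$ and $G$ are continuous and either both increasing or both decreasing (here "increasing" means non-decreasing and "decreasing" means non-increasing). From now on $G$ denotes this continuous version. Suppose in addition that there is a bounded increasing function $f:\mathbb R\to\mathbb R$ with $i[f(P),G(Q)]\ge 0$, $\int df=1$ and $\int \xi^2\,df(\xi)<\infty$, where $df$ is the Lebesgue–Stieltjes measure of $f$. Let $$\sigma^2=\inf\Big\{\int \xi^2\,df(\xi)-\Big(\int\xi\,df(\xi)\Big)^2\Big\},\qquad \sigma\ge 0,$$ where the infimum is over all bounded increasing $f$ with $\int df=1$, $\int\xi^2\,df(\xi)<\infty$, $i[f(P),G(Q)]\ge 0$ and $i[f(P),G(Q)]\ne 0$, and put $\hat a=\sqrt3\,\sigma$. Then $G$ is $C^1$ with a Lipschitz derivative (so $G'$ is absolutely continuous), the limits $G(\pm\infty)=\lim_{x\to\pm\infty}G(x)$ exist and are finite, and: 1. $G'(x_0)e^{-2\hat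 a|x-x_0|}\le G'(x)\le G'(x_0)e^{2\hat a|x-x_0|}$ for all $x,x_0\in\mathbb R$; 2. for almost every $x$, $G''(x)$ exists and $|G''(x)|\le 2\hat a\,G'(x)$; 3. $G'(x)\le 2\hat a\,|G(+\infty)-G(x)|$ and $G'(x)\le 2\hat a\,|G(-\infty)-G(x)|$ for all $x\in\mathbb R$; 4. if $G$ is odd, then $G'(x)\ge G'(0)/\cosh^2(\hat a x)$ for all $x\in\mathbb R$. -/

import Mathlib

open MeasureTheory Filter Topology
open scoped ENNReal

noncomputable section

/-- The Hilbert space `L²(ℝ)` of complex-valued functions, with respect to Lebesgue measure. -/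
abbrev L2R : Type := Lp ℂ 2 (volume : Measure ℝ)

/-- `f : ℝ → ℝ` is a bounded (Lebesgue) measurable real function. -/
structure BddMeas (f : ℝ → ℝ) : Prop where
  aemeasurable : AEMeasurable f volume
  bounded : ∃ M : ℝ, ∀ x, |f x| ≤ M

theorem BddMeas.memLp {f : ℝ → ℝ} (hf : BddMeas f) :
    MemLp (fun x => (f x : ℂ)) ∞ (volume : Measure ℝ) := by
  obtain ⟨M, hM⟩ := hf.bounded
  refine memLp_top_of_bound
    (Complex.measurable_ofReal.comp_aemeasurable hf.aemeasurable).aestronglyMeasurable M ?_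
  exact Eventually.of_forall fun x => by simpa using hM x

theorem BddMeas.comp_mul_left {f : ℝ → ℝ} (hf : BddMeas f) {c : ℝ} (hc : c ≠ 0) :
    BddMeas (fun x => f (c * x)) := by
  obtain ⟨M, hM⟩ := hf.bounded
  refine ⟨hf.aemeasurable.comp_quasiMeasurePreserving ⟨measurable_const_mul c, ?_⟩,
    M, fun x => hM _⟩
  rw [Real.map_volume_mul_left hc]
  exact Measure.smul_absolutelyContinuous

/-- `f(Q)`: the operator of multiplication by the bounded measurable function `f` on `L²(ℝ)`. -/
def opQ {f : ℝ → ℝ} (hf : BddMeas f) : L2R →L[ℂ] L2R :=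
  (ContinuousLinearMap.mul ℂ ℂ).holderL volume ∞ 2 2 hf.memLp.toLp

theorem opQ_apply_ae {f : ℝ → ℝ} (hf : BddMeas f) (ψ : L2R) :
    (opQ hf ψ : ℝ → ℂ) =ᵐ[volume] fun x => (f x : ℂ) * ψ x := by
  have h := ContinuousLinearMap.coeFn_holder (r := 2) (ContinuousLinearMap.mul ℂ ℂ)
    hf.memLp.toLp ψ
  filter_upwards [h, hf.memLp.coeFn_toLp] with x hx hx'
  rw [← hx']
  exact hx

/-- The Fourier transform on `L²(ℝ)`, in the normalization `∫ e^{-2πixξ} ψ(x) dx`. -/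
def fourierL2 : L2R ≃ₗᵢ[ℂ] L2R := Lp.fourierTransformₗᵢ ℝ ℂ

/-- `f(P)` for `P = -i d/dx`: since `(Pψ)^(ξ) = 2πξ ψ^(ξ)` in the normalization of `fourierL2`,
this is the Fourier multiplier with symbol `ξ ↦ f(2πξ)`. -/
def opP {f : ℝ → ℝ} (hf : BddMeas f) : L2R →L[ℂ] L2R :=
  (fourierL2.symm.toContinuousLinearEquiv : L2R →L[ℂ] L2R) ∘L
    opQ (hf.comp_mul_left Real.two_pi_pos.ne') ∘L
      (fourierL2.toContinuousLinearEquiv : L2R →L[ℂ] L2R)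

/-- The operator `i[f(P), g(Q)]` on `L²(ℝ)`. -/
def iComm {f g : ℝ → ℝ} (hf : BddMeas f) (hg : BddMeas g) : L2R →L[ℂ] L2R :=
  Complex.I • (opP hf ∘L opQ hg - opQ hg ∘L opP hf)

/-- The Lebesgue-Stieltjes measure `df` of an increasing function `f`
(through the right-continuous version of `f`). -/
def dMeasure {f : ℝ → ℝ} (hf : Monotone f) : Measure ℝ := hf.stieltjesFunction.measure

/-- `f` is an increasing bounded function with `∫ df = 1`, `∫ ξ² df(ξ) < ∞`
and `i[f(P), G(Q)] ≥ 0`. -/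
def IsPartner {G : ℝ → ℝ} (hG : BddMeas G) (f : ℝ → ℝ) : Prop :=
  ∃ (hf : BddMeas f) (hm : Monotone f),
    (iComm hf hG).IsPositive ∧ dMeasure hm Set.univ = 1 ∧
      Integrable (fun ξ : ℝ => ξ ^ 2) (dMeasure hm)

/-- The set of all variances `∫ ξ² df(ξ) - (∫ ξ df(ξ))²` where `f` is increasing and bounded,
`∫ df = 1`, `∫ ξ² df(ξ) < ∞`, `i[f(P), G(Q)] ≥ 0` and `i[f(P), G(Q)] ≠ 0`. -/
def partnerVariances {G : ℝ → ℝ} (hG : BddMeas G) : Set ℝ :=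
  {v | ∃ (f : ℝ → ℝ) (hf : BddMeas f) (hm : Monotone f),
    (iComm hf hG).IsPositive ∧ iComm hf hG ≠ 0 ∧ dMeasure hm Set.univ = 1 ∧
      Integrable (fun ξ : ℝ => ξ ^ 2) (dMeasure hm) ∧
      v = (∫ ξ, ξ ^ 2 ∂(dMeasure hm)) - (∫ ξ, ξ ∂(dMeasure hm)) ^ 2}

/-- `σ`, where `σ²` is the infimum of the variances. -/
def sigma {G : ℝ → ℝ} (hG : BddMeas G) : ℝ := √(sInf (partnerVariances hG))

/-- `â = √3 σ`. -/
def aHat {G : ℝ → ℝ} (hG : BddMeas G) : ℝ := √3 * sigma hG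

end

open scoped SchwartzMap FourierTransform ComplexConjugate

/-! On Schwartz vectors the quadratic form of i[f(P), G(Q)] is ∫ G k, where the density k depends on
f and ψ, is integrable and has mean zero (`inner_iComm_toLp`, `integral_commDensity`). Since f(P)
commutes with translations, nonnegativity of the form passes from G to w * G for every integrable w
≥ 0, so smooth G can be used throughout.

Monotonicity. Convolve G with bumps of width n. The result is affine up to O(x²/n), so its form
equals D_n ⟨i[f(P), Q]⟩ + O(1/n). Nonnegativity fixes the sign of i[f(P), Q] = f'(P), unless D_n →
0; in that case narrow bumps are dominated by wide ones and the whole commutator vanishes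
(`exists_sign_integral_id_mul_commDensity`). Hence F is monotone up to a null set, and increasing
after a possible change of both signs.

Two points. For f increasing of total mass m, superposing spectral projections of P shows that
i[f(P), H(Q)] has the kernel (2π)⁻¹ φ(x-y) (H(x)-H(y))/(x-y), with φ the characteristic function of
df (`integral_mul_commDensity_eq_kernel`). A nonnegative kernel has nonnegative 2×2 minors, so
|φ(x-y)|² (H(x)-H(y))² ≤ m² (x-y)² H'(x) H'(y) (`two_point_inequality`). The diagonal gives H' ≥ 0.
Integrated over short distances the inequality forbids jumps of G; over long distances it forces φ →
0, and Wiener averaging then excludes atoms of df, so f is continuous.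

Differential inequality. If m = 1 and df has variance V, then |φ(t)|² ≥ 1 - V t². Letting y → x with
u = H' gives 3u'² ≤ 2uu'' + 4a²u², where a² = 3V (`three_mul_sq_deriv_le`). For v = u^(-1/2) this
reads v'' ≤ a² v. A positive v on the whole line with this property satisfies |v'| ≤ a v, and if it
is even, v(x) ≤ v(0) cosh(ax); in terms of u these are |u'| ≤ 2au and the cosh bound. The integrated
forms do not depend on the mollification, so they pass to G, and a minimizing sequence of variances
replaces a by â. The remaining claims follow from the exponential bound on G' alone. -/

theorem BddMeas.neg {f : ℝ → ℝ} (hf : BddMeas f) : BddMeas (fun x => -f x) := by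
  obtain ⟨M, hM⟩ := hf.bounded
  exact ⟨hf.aemeasurable.neg, M, fun x => by simpa using hM x⟩

/-! ### The quadratic form of the commutator -/

theorem inner_L2_eq (φ χ : L2R) : inner ℂ φ χ = ∫ x, conj (φ x) * χ x := by
  rw [L2.inner_def]
  refine integral_congr_ae (Eventually.of_forall fun x => ?_)
  simp [mul_comm]

theorem integrable_conj_mul_L2 (φ χ : L2R) : Integrable (fun x => conj (φ x) * χ x) := by
  refine (L2.integrable_inner (𝕜 := ℂ) φ χ).congr (Eventually.of_forall fun x => ?_)
  simp [mul_comm]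

theorem inner_opQ {g : ℝ → ℝ} (hg : BddMeas g) (φ χ : L2R) :
    inner ℂ φ (opQ hg χ) = ∫ x, (g x : ℂ) * (conj (φ x) * χ x) := by
  rw [inner_L2_eq]
  refine integral_congr_ae ?_
  filter_upwards [opQ_apply_ae hg χ] with x hx
  rw [hx]; ring

theorem opQ_inner {g : ℝ → ℝ} (hg : BddMeas g) (φ χ : L2R) :
    inner ℂ (opQ hg φ) χ = inner ℂ φ (opQ hg χ) := by
  rw [inner_opQ, inner_L2_eq]
  refine integral_congr_ae ?_
  filter_upwards [opQ_apply_ae hg φ] with x hx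
  rw [hx]; simp; ring

theorem inner_opP {f : ℝ → ℝ} (hf : BddMeas f) (φ χ : L2R) :
    inner ℂ φ (opP hf χ) =
      inner ℂ (fourierL2 φ) (opQ (hf.comp_mul_left Real.two_pi_pos.ne') (fourierL2 χ)) := by
  rw [← fourierL2.inner_map_map φ]
  simp [opP]

theorem opP_inner {f : ℝ → ℝ} (hf : BddMeas f) (φ χ : L2R) :
    inner ℂ (opP hf φ) χ = inner ℂ φ (opP hf χ) := by
  rw [inner_opP, ← opQ_inner, ← fourierL2.inner_map_map _ χ]
  simp [opP]

theorem inner_iComm_self {f g : ℝ → ℝ} (hf : BddMeas f) (hg : BddMeas g) (ψ : L2R) :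
    inner ℂ (iComm hf hg ψ) ψ = ((-2 * (inner ℂ (opP hf ψ) (opQ hg ψ)).im : ℝ) : ℂ) := by
  have h1 : inner ℂ (iComm hf hg ψ) ψ =
      -Complex.I * (inner ℂ (opQ hg ψ) (opP hf ψ) - inner ℂ (opP hf ψ) (opQ hg ψ)) := by
    simp only [iComm, smul_apply, sub_apply,
      ContinuousLinearMap.comp_apply, inner_smul_left, inner_sub_left, opP_inner, opQ_inner]
    simp
  rw [h1, ← inner_conj_symm (opQ hg ψ) (opP hf ψ)]
  generalize inner ℂ (opP hf ψ) (opQ hg ψ) = z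
  apply Complex.ext <;> simp; ring

/-- The density `k` with `⟨ψ, i[f(P), g(Q)] ψ⟩ = ∫ g k` for all `g`. -/
noncomputable def commDensity {f : ℝ → ℝ} (hf : BddMeas f) (ψ : 𝓢(ℝ, ℂ)) (x : ℝ) : ℝ :=
  -2 * (conj (opP hf (ψ.toLp 2) x) * ψ x).im

theorem integrable_conj_opP_mul {f : ℝ → ℝ} (hf : BddMeas f) (ψ χ : 𝓢(ℝ, ℂ)) :
    Integrable (fun x => conj (opP hf (ψ.toLp 2) x) * χ x) := by
  refine (integrable_conj_mul_L2 (opP hf (ψ.toLp 2)) (χ.toLp 2)).congr ?_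
  filter_upwards [χ.coeFn_toLp 2] with x hx
  rw [hx]

theorem integral_conj_opP_mul {f : ℝ → ℝ} (hf : BddMeas f) (ψ χ : 𝓢(ℝ, ℂ)) :
    ∫ x, conj (opP hf (ψ.toLp 2) x) * χ x =
      ∫ ξ, (f (2 * Real.pi * ξ) : ℂ) * (conj (𝓕 ψ ξ) * 𝓕 χ ξ) := by
  have h1 : ∫ x, conj (opP hf (ψ.toLp 2) x) * χ x =
      inner ℂ (opP hf (ψ.toLp 2)) (χ.toLp 2) := by
    rw [inner_L2_eq]
    refine integral_congr_ae ?_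
    filter_upwards [χ.coeFn_toLp 2] with x hx
    rw [hx]
  rw [h1, opP_inner, inner_opP, inner_opQ]
  have e : ∀ η : 𝓢(ℝ, ℂ), fourierL2 (η.toLp 2) = (𝓕 η).toLp 2 := SchwartzMap.toLp_fourier_eq
  rw [e, e]
  refine integral_congr_ae ?_
  filter_upwards [(𝓕 ψ).coeFn_toLp 2, (𝓕 χ).coeFn_toLp 2] with x hx hx'
  rw [hx, hx']

theorem mul_commDensity {f : ℝ → ℝ} (hf : BddMeas f) {ψ χ : 𝓢(ℝ, ℂ)} {h : ℝ → ℝ}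
    (hχ : ∀ x, χ x = h x * ψ x) (x : ℝ) :
    h x * commDensity hf ψ x = -2 * (conj (opP hf (ψ.toLp 2) x) * χ x).im := by
  rw [hχ, commDensity, mul_left_comm _ (h x : ℂ), Complex.im_ofReal_mul]; ring

theorem integrable_mul_commDensity {f : ℝ → ℝ} (hf : BddMeas f) {ψ χ : 𝓢(ℝ, ℂ)} {h : ℝ → ℝ}
    (hχ : ∀ x, χ x = h x * ψ x) : Integrable (fun x => h x * commDensity hf ψ x) := by
  simp_rw [mul_commDensity hf hχ]
  exact (integrable_conj_opP_mul hf ψ χ).im.const_mul _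

/-- Parseval. Only hψ has to be Schwartz, not h bounded; the unbounded choices h = x and h = x² give
the moments of the density. -/
theorem integral_mul_commDensity {f : ℝ → ℝ} (hf : BddMeas f) {ψ χ : 𝓢(ℝ, ℂ)} {h : ℝ → ℝ}
    (hχ : ∀ x, χ x = h x * ψ x) :
    ∫ x, h x * commDensity hf ψ x =
      -2 * (∫ ξ, (f (2 * Real.pi * ξ) : ℂ) * (conj (𝓕 ψ ξ) * 𝓕 χ ξ)).im := by
  simp_rw [mul_commDensity hf hχ]
  rw [integral_const_mul, ← integral_conj_opP_mul]
  congr 1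
  exact integral_im (𝕜 := ℂ) (integrable_conj_opP_mul hf ψ χ)

theorem integrable_commDensity {f : ℝ → ℝ} (hf : BddMeas f) (ψ : 𝓢(ℝ, ℂ)) :
    Integrable (commDensity hf ψ) := by
  simpa using integrable_mul_commDensity hf (ψ := ψ) (χ := ψ) (h := fun _ => 1) (by simp)

/-- Constants commute with f(P): on the Fourier side the integrand f |𝓕 ψ|² is real and has no
imaginary part. -/
theorem integral_commDensity {f : ℝ → ℝ} (hf : BddMeas f) (ψ : 𝓢(ℝ, ℂ)) :
    ∫ x, commDensity hf ψ x = 0 := by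
  have h := integral_mul_commDensity hf (ψ := ψ) (χ := ψ) (h := fun _ => 1) (by simp)
  simp only [one_mul] at h
  rw [h]
  have : ∀ ξ, (f (2 * Real.pi * ξ) : ℂ) * (conj (𝓕 ψ ξ) * 𝓕 ψ ξ) =
      ((f (2 * Real.pi * ξ) * ‖𝓕 ψ ξ‖ ^ 2 : ℝ) : ℂ) := fun ξ => by
    rw [mul_comm (conj _), Complex.mul_conj, Complex.normSq_eq_norm_sq]; push_cast; rfl
  simp_rw [this]
  rw [integral_complex_ofReal]; simp

theorem inner_iComm_toLp {f g : ℝ → ℝ} (hf : BddMeas f) (hg : BddMeas g) (ψ : 𝓢(ℝ, ℂ)) :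
    inner ℂ (iComm hf hg (ψ.toLp 2)) (ψ.toLp 2) =
      ((∫ x, g x * commDensity hf ψ x : ℝ) : ℂ) := by
  rw [inner_iComm_self, inner_opQ]
  congr 1
  have h1 : ∫ x, (g x : ℂ) * (conj (opP hf (ψ.toLp 2) x) * ψ.toLp 2 volume x) =
      ∫ x, (g x : ℂ) * (conj (opP hf (ψ.toLp 2) x) * ψ x) := by
    refine integral_congr_ae ?_
    filter_upwards [ψ.coeFn_toLp 2] with x hx
    rw [hx]
  have hi : Integrable (fun x => (g x : ℂ) * (conj (opP hf (ψ.toLp 2) x) * ψ x)) := by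
    obtain ⟨M, hM⟩ := hg.bounded
    refine (integrable_conj_opP_mul hf ψ ψ).bdd_mul (c := M)
      (Complex.measurable_ofReal.comp_aemeasurable hg.aemeasurable).aestronglyMeasurable
      (Eventually.of_forall fun x => by simpa using hM x)
  rw [h1]
  have h2 := integral_im (𝕜 := ℂ) hi
  have h3 : (∫ x, (g x : ℂ) * (conj (opP hf (ψ.toLp 2) x) * ψ x)).im =
      ∫ x, ((g x : ℂ) * (conj (opP hf (ψ.toLp 2) x) * ψ x)).im := h2.symm
  rw [h3, ← integral_const_mul]
  congr 1 with x
  rw [Complex.im_ofReal_mul, commDensity]; ring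

/-! ### Translation covariance of the density -/

theorem fourier_compSubConst (ψ : 𝓢(ℝ, ℂ)) (q ξ : ℝ) :
    𝓕 (ψ.compSubConstCLM ℂ q) ξ = (Real.fourierChar (-(q * ξ)) : ℂ) * 𝓕 ψ ξ := by
  rw [SchwartzMap.fourier_coe, SchwartzMap.fourier_coe, Real.fourier_real_eq, Real.fourier_real_eq,
    ← integral_const_mul,
    ← integral_sub_right_eq_self
      (fun v => (Real.fourierChar (-(q * ξ)) : ℂ) * Real.fourierChar (-(v * ξ)) • ψ v) q]
  congr 1 with v
  rw [SchwartzMap.compSubConstCLM_apply, Circle.smul_def, Circle.smul_def, smul_eq_mul,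
    smul_eq_mul, ← mul_assoc, ← Circle.coe_mul, ← AddChar.map_add_eq_mul]
  congr 4
  ring

theorem conj_ae_eq_translate {η η' : L2R} {q : ℝ}
    (h : ∀ φ : 𝓢(ℝ, ℂ), ∫ x, conj (η x) * φ (x - q) = ∫ x, conj (η' x) * φ x) :
    (fun x => conj (η x)) =ᵐ[volume] fun x => conj (η' (x - q)) := by
  have h1 : LocallyIntegrable (fun x => conj (η x)) volume :=
    (Lp.memLp η).star.locallyIntegrable (by norm_num)
  have h2 : LocallyIntegrable (fun x => conj (η' (x - q))) volume :=
    ((Lp.memLp η').comp_measurePreserving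
      (measurePreserving_sub_right volume q)).star.locallyIntegrable (by norm_num)
  refine ae_eq_of_integral_contDiff_smul_eq h1 h2 fun g hg hgs => ?_
  have hg' : ContDiff ℝ ((⊤ : ℕ∞) : WithTop ℕ∞) (fun x => (g (x + q) : ℂ)) :=
    Complex.ofRealCLM.contDiff.comp (hg.comp (contDiff_id.add contDiff_const))
  have hgs' : HasCompactSupport (fun x => (g (x + q) : ℂ)) :=
    (hgs.comp_homeomorph (Homeomorph.addRight q)).comp_left (g := fun x : ℝ => (x : ℂ)) (by simp)
  have e := h (hgs'.toSchwartzMap hg')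
  have e4 : ∫ x, g x • conj (η x) = ∫ x, conj (η x) * hgs'.toSchwartzMap hg' (x - q) := by
    congr 1 with x
    rw [HasCompactSupport.toSchwartzMap_toFun, sub_add_cancel, Complex.real_smul, mul_comm]
  have e5 : ∫ x, g x • conj (η' (x - q)) = ∫ x, conj (η' x) * hgs'.toSchwartzMap hg' x := by
    rw [← integral_sub_right_eq_self (fun x => conj (η' x) * hgs'.toSchwartzMap hg' x) q]
    congr 1 with x
    rw [HasCompactSupport.toSchwartzMap_toFun, sub_add_cancel, Complex.real_smul, mul_comm]
  rw [e4, e5, e]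

/-- A translation multiplies both Fourier transforms by the same unimodular character, which cancels
against its conjugate, so f(P) commutes with translations. -/
theorem commDensity_translate {f : ℝ → ℝ} (hf : BddMeas f) (ψ : 𝓢(ℝ, ℂ)) (q : ℝ) :
    commDensity hf (ψ.compSubConstCLM ℂ q) =ᵐ[volume] fun x => commDensity hf ψ (x - q) := by
  have hab := conj_ae_eq_translate (η := opP hf ((ψ.compSubConstCLM ℂ q).toLp 2))
    (η' := opP hf (ψ.toLp 2)) (q := q) fun φ => by
      have e1 := integral_conj_opP_mul hf (ψ.compSubConstCLM ℂ q) (φ.compSubConstCLM ℂ q)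
      simp only [SchwartzMap.compSubConstCLM_apply] at e1
      rw [e1, integral_conj_opP_mul hf ψ φ]
      congr 1 with ξ
      rw [fourier_compSubConst, fourier_compSubConst, map_mul]
      have h2 : conj (Real.fourierChar (-(q * ξ)) : ℂ) * (Real.fourierChar (-(q * ξ)) : ℂ) = 1 := by
        rw [← Complex.normSq_eq_conj_mul_self, Circle.normSq_coe]; simp
      linear_combination ((f (2 * Real.pi * ξ) : ℂ) * (conj (𝓕 ψ ξ) * 𝓕 φ ξ)) * h2
  filter_upwards [hab] with x hx
  rw [commDensity, commDensity, hx, SchwartzMap.compSubConstCLM_apply]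

/-! ### Mollification -/

theorem BddMeas.locallyIntegrable {f : ℝ → ℝ} (hf : BddMeas f) : LocallyIntegrable f volume := by
  obtain ⟨M, hM⟩ := hf.bounded
  exact (memLp_top_of_bound hf.aemeasurable.aestronglyMeasurable M
    (Eventually.of_forall hM)).locallyIntegrable le_top

/-- The convolution `w * G`. -/
noncomputable def mollify (w G : ℝ → ℝ) (x : ℝ) : ℝ := ∫ s, w s * G (x - s)

theorem integrable_mollify {w G : ℝ → ℝ} (hw : Integrable w) (hG : BddMeas G) (x : ℝ) :
    Integrable (fun s => w s * G (x - s)) := by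
  obtain ⟨M, hM⟩ := hG.bounded
  exact hw.mul_bdd (hG.aemeasurable.comp_quasiMeasurePreserving
    (Measure.measurePreserving_sub_left volume x).quasiMeasurePreserving).aestronglyMeasurable
    (Eventually.of_forall fun s => hM (x - s))

theorem abs_mollify_le {w G : ℝ → ℝ} (hw : Integrable w) {M : ℝ}
    (hM : ∀ x, |G x| ≤ M) (x : ℝ) : |mollify w G x| ≤ M * ∫ s, |w s| := by
  rw [mollify, ← Real.norm_eq_abs, ← integral_const_mul]
  refine norm_integral_le_of_norm_le (hw.abs.const_mul M) (Eventually.of_forall fun s => ?_)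
  rw [norm_mul, Real.norm_eq_abs, Real.norm_eq_abs, mul_comm]
  exact mul_le_mul_of_nonneg_right (hM _) (abs_nonneg _)

theorem hasDerivAt_mollify {w G : ℝ → ℝ} (hw : ContDiff ℝ 1 w) (hws : HasCompactSupport w)
    (hG : BddMeas G) (x : ℝ) : HasDerivAt (mollify w G) (mollify (deriv w) G x) x :=
  hws.hasDerivAt_convolution_left (ContinuousLinearMap.lsmul ℝ ℝ) hw hG.locallyIntegrable x

theorem contDiff_mollify {w G : ℝ → ℝ} {n : ℕ∞} (hw : ContDiff ℝ n w) (hws : HasCompactSupport w)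
    (hG : BddMeas G) : ContDiff ℝ n (mollify w G) :=
  hws.contDiff_convolution_left (ContinuousLinearMap.lsmul ℝ ℝ) hw hG.locallyIntegrable

theorem integral_mollify_mul {w G k : ℝ → ℝ} (hw : Integrable w) (hG : BddMeas G)
    (hk : Integrable k) :
    ∫ x, mollify w G x * k x = ∫ s, w s * ∫ x, G (x - s) * k x := by
  obtain ⟨M, hM⟩ := hG.bounded
  have hm : AEStronglyMeasurable (fun p : ℝ × ℝ => G (p.1 - p.2)) (volume.prod volume) :=
    (hG.aemeasurable.comp_quasiMeasurePreserving
      (quasiMeasurePreserving_sub volume volume)).aestronglyMeasurable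
  have hi : Integrable (fun p : ℝ × ℝ => G (p.1 - p.2) * (k p.1 * w p.2))
      (volume.prod volume) :=
    (hk.mul_prod hw).bdd_mul hm (Eventually.of_forall fun p => hM _)
  have h1 : ∀ x, mollify w G x * k x = ∫ s, G (x - s) * (k x * w s) := fun x => by
    rw [mollify, ← integral_mul_const]
    congr 1 with s; ring
  have h2 : ∀ s, w s * ∫ x, G (x - s) * k x = ∫ x, G (x - s) * (k x * w s) := fun s => by
    rw [← integral_const_mul]
    congr 1 with s; ring
  simp_rw [h1, h2]
  exact integral_integral_swap hi

/-- A standard approximate identity. -/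
noncomputable def stdBump (n : ℕ) : ContDiffBump (0 : ℝ) where
  rIn := 1 / (2 * (n + 1))
  rOut := 1 / (n + 1)
  rIn_pos := by positivity
  rIn_lt_rOut := by
    rw [div_lt_div_iff₀ (by positivity) (by positivity)]
    nlinarith [(Nat.cast_nonneg n : (0 : ℝ) ≤ n)]

/-- The normalized bump functions of `stdBump`. -/
noncomputable def moll (n : ℕ) : ℝ → ℝ := (stdBump n).normed volume

theorem moll_nonneg (n : ℕ) (x : ℝ) : 0 ≤ moll n x := (stdBump n).nonneg_normed x
theorem moll_neg (n : ℕ) (x : ℝ) : moll n (-x) = moll n x := (stdBump n).normed_neg x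
theorem contDiff_moll (n : ℕ) {m : ℕ∞} : ContDiff ℝ m (moll n) := (stdBump n).contDiff_normed
theorem hasCompactSupport_moll (n : ℕ) : HasCompactSupport (moll n) :=
  (stdBump n).hasCompactSupport_normed
theorem integrable_moll (n : ℕ) : Integrable (moll n) := (stdBump n).integrable_normed
theorem integral_moll (n : ℕ) : ∫ x, moll n x = 1 := (stdBump n).integral_normed

theorem moll_eq_zero (n : ℕ) {x : ℝ} (hx : 1 / ((n : ℝ) + 1) ≤ |x|) : moll n x = 0 := by
  by_contra h
  have : x ∈ Function.support (moll n) := h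
  rw [moll, ContDiffBump.support_normed_eq, Metric.mem_ball, dist_zero_right] at this
  exact absurd this (not_lt.2 hx)

theorem tendsto_one_div_succ : Tendsto (fun n : ℕ => 1 / ((n : ℝ) + 1)) atTop (𝓝 0) :=
  tendsto_one_div_add_atTop_nhds_zero_nat

theorem ae_tendsto_mollify {G : ℝ → ℝ} (hG : BddMeas G) :
    ∀ᵐ x, Tendsto (fun n => mollify (moll n) G x) atTop (𝓝 (G x)) := by
  refine ContDiffBump.ae_convolution_tendsto_right_of_locallyIntegrable (φ := stdBump)
    (K := 2) tendsto_one_div_succ (Eventually.of_forall fun n => ?_) hG.locallyIntegrable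
  simp only [stdBump]
  apply le_of_eq
  field_simp

theorem abs_mollify_moll_le {G : ℝ → ℝ} {M : ℝ} (hM : ∀ x, |G x| ≤ M) (n : ℕ) (x : ℝ) :
    |mollify (moll n) G x| ≤ M := by
  have := abs_mollify_le (integrable_moll n) hM x
  simpa [abs_of_nonneg (moll_nonneg n _), integral_moll] using this

theorem tendsto_integral_mollify_mul {G k : ℝ → ℝ} (hG : BddMeas G) (hk : Integrable k) :
    Tendsto (fun n => ∫ x, mollify (moll n) G x * k x) atTop (𝓝 (∫ x, G x * k x)) := by
  obtain ⟨M, hM⟩ := hG.bounded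
  refine tendsto_integral_of_dominated_convergence (fun x => M * |k x|) (fun n => ?_)
    (hk.abs.const_mul M) (fun n => Eventually.of_forall fun x => ?_) ?_
  · exact ((contDiff_mollify (n := 0) (contDiff_moll n) (hasCompactSupport_moll n)
      hG).continuous.aestronglyMeasurable).mul hk.aestronglyMeasurable
  · rw [norm_mul, Real.norm_eq_abs, Real.norm_eq_abs]
    exact mul_le_mul_of_nonneg_right (abs_mollify_moll_le hM n x) (abs_nonneg _)
  · filter_upwards [ae_tendsto_mollify hG] with x hx
    exact hx.mul_const _

/-! ### Positivity under translation and averaging -/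

theorem integral_mul_commDensity_nonneg {f g : ℝ → ℝ} {hf : BddMeas f} {hg : BddMeas g}
    (h : (iComm hf hg).IsPositive) (ψ : 𝓢(ℝ, ℂ)) : 0 ≤ ∫ x, g x * commDensity hf ψ x := by
  have h1 := h.re_inner_nonneg_left (ψ.toLp 2)
  rw [inner_iComm_toLp] at h1
  simpa using h1

theorem integral_shift_mul_commDensity_nonneg {f g : ℝ → ℝ} {hf : BddMeas f} {hg : BddMeas g}
    (h : (iComm hf hg).IsPositive) (ψ : 𝓢(ℝ, ℂ)) (s : ℝ) :
    0 ≤ ∫ x, g (x - s) * commDensity hf ψ x := by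
  have h1 := integral_mul_commDensity_nonneg h (ψ.compSubConstCLM ℂ (-s))
  have h2 : ∫ x, g x * commDensity hf (ψ.compSubConstCLM ℂ (-s)) x =
      ∫ x, g x * commDensity hf ψ (x + s) := by
    refine integral_congr_ae ?_
    filter_upwards [commDensity_translate hf ψ (-s)] with x hx
    rw [hx, sub_neg_eq_add]
  rw [h2, ← integral_sub_right_eq_self (fun x => g x * commDensity hf ψ (x + s)) s] at h1
  simpa using h1

theorem integral_mollify_mul_commDensity_nonneg {f g : ℝ → ℝ} {hf : BddMeas f} {hg : BddMeas g}
    (h : (iComm hf hg).IsPositive) {w : ℝ → ℝ} (hw : Integrable w) (hw0 : ∀ s, 0 ≤ w s)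
    (ψ : 𝓢(ℝ, ℂ)) : 0 ≤ ∫ x, mollify w g x * commDensity hf ψ x := by
  rw [integral_mollify_mul hw hg (integrable_commDensity hf ψ)]
  exact integral_nonneg fun s => mul_nonneg (hw0 s) (integral_shift_mul_commDensity_nonneg h ψ s)

/-- Schwartz functions are dense, and on a complex Hilbert space an operator whose quadratic form
vanishes is zero. -/
theorem iComm_eq_zero_of_integral {f g : ℝ → ℝ} {hf : BddMeas f} {hg : BddMeas g}
    (h : ∀ ψ : 𝓢(ℝ, ℂ), ∫ x, g x * commDensity hf ψ x = 0) : iComm hf hg = 0 := by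
  have h1 : ∀ ψ : L2R, inner ℂ (iComm hf hg ψ) ψ = 0 := by
    intro ψ
    refine DenseRange.induction_on (p := fun ψ : L2R => inner ℂ (iComm hf hg ψ) ψ = 0)
      (SchwartzMap.denseRange_toLpCLM (E := ℝ) (F := ℂ) (p := 2) ENNReal.ofNat_ne_top)
      ψ ?_ ?_
    · exact isClosed_eq (by fun_prop) continuous_const
    · intro φ
      have := inner_iComm_toLp hf hg φ
      rw [h φ] at this
      simpa using this
  have h2 := (inner_map_self_eq_zero (iComm hf hg : L2R →ₗ[ℂ] L2R)).1 h1
  ext1 ψ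
  exact LinearMap.congr_fun h2 ψ

/-! ### Wide averages and the sign of the first moment -/

/-- One step of a Taylor remainder estimate, by the mean value inequality on [-|t|, |t|]; iterating
it raises the order. -/
theorem abs_le_of_abs_deriv_le_pow {r r' : ℝ → ℝ} {K R : ℝ} {n : ℕ}
    (hr : ∀ t, HasDerivAt r (r' t) t) (h0 : r 0 = 0)
    (hK : ∀ t, |t| ≤ R → |r' t| ≤ K * |t| ^ n) {t : ℝ} (ht : |t| ≤ R) :
    |r t| ≤ K * |t| ^ (n + 1) := by
  by_cases ht0 : t = 0
  · subst ht0; simp [h0]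
  have hKn : 0 ≤ K := by
    have h1 := (abs_nonneg _).trans (hK t ht)
    have h2 : 0 < |t| ^ n := pow_pos (abs_pos.2 ht0) n
    exact nonneg_of_mul_nonneg_left h1 h2
  have h := (convex_Icc (-|t|) |t|).norm_image_sub_le_of_norm_hasDerivWithin_le
    (f := r) (f' := r') (C := K * |t| ^ n) (fun x _ => (hr x).hasDerivWithinAt)
    (fun x hx => by
      have hx' : |x| ≤ |t| := abs_le.2 hx
      exact (hK x (hx'.trans ht)).trans
        (mul_le_mul_of_nonneg_left (pow_le_pow_left₀ (abs_nonneg _) hx' n) hKn))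
    (x := 0) (y := t) ⟨by simp, abs_nonneg _⟩ ⟨neg_abs_le t, le_abs_self t⟩
  rw [h0, sub_zero, sub_zero, Real.norm_eq_abs, Real.norm_eq_abs] at h
  rw [pow_succ, ← mul_assoc]
  exact h

theorem exists_schwartz_mul_id (ψ : 𝓢(ℝ, ℂ)) : ∃ χ : 𝓢(ℝ, ℂ), ∀ x, χ x = (x : ℂ) * ψ x := by
  have hg : (fun x : ℝ => x).HasTemperateGrowth := by fun_prop
  refine ⟨SchwartzMap.smulLeftCLM ℂ (fun x : ℝ => x) ψ, fun x => ?_⟩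
  rw [SchwartzMap.smulLeftCLM_apply_apply hg]
  simp

theorem integrable_id_mul_commDensity {f : ℝ → ℝ} (hf : BddMeas f) (ψ : 𝓢(ℝ, ℂ)) :
    Integrable (fun x => x * commDensity hf ψ x) := by
  obtain ⟨χ, hχ⟩ := exists_schwartz_mul_id ψ
  exact integrable_mul_commDensity hf (h := fun x => x) hχ

theorem integrable_sq_mul_commDensity {f : ℝ → ℝ} (hf : BddMeas f) (ψ : 𝓢(ℝ, ℂ)) :
    Integrable (fun x => x ^ 2 * commDensity hf ψ x) := by
  obtain ⟨χ, hχ⟩ := exists_schwartz_mul_id ψ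
  obtain ⟨η, hη⟩ := exists_schwartz_mul_id χ
  exact integrable_mul_commDensity hf (h := fun x => x ^ 2) (χ := η) fun x => by
    rw [hη, hχ]; push_cast; ring

/-- A fixed cutoff function. -/
noncomputable def cutoff : ContDiffBump (0 : ℝ) where
  rIn := 1
  rOut := 2
  rIn_pos := one_pos
  rIn_lt_rOut := one_lt_two

/-- A wide average of a bounded function is nearly affine. Against a density of mean zero its
constant term disappears, its slope D n multiplies the first moment, and the quadratic remainder is
paid for by the second moment. The numbers D n and C do not depend on the density. -/
theorem abs_integral_wide_mollify_sub_le {G : ℝ → ℝ} (hG : BddMeas G) :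
    ∃ (D : ℕ → ℝ) (C : ℝ), ∀ k : ℝ → ℝ, Integrable k → ∫ x, k x = 0 →
      Integrable (fun x => x * k x) → Integrable (fun x => x ^ 2 * k x) → ∀ n : ℕ,
        |(∫ x, mollify (fun s => cutoff (1 / (n + 1) * s)) G x * k x) - D n * ∫ x, x * k x| ≤
          C * (∫ x, |x ^ 2 * k x|) * (1 / (n + 1)) := by
  obtain ⟨M, hM⟩ := hG.bounded
  set W : ℝ → ℝ := fun s => cutoff s with hW
  have hWc : ContDiff ℝ 2 W := cutoff.contDiff
  have hW' : ContDiff ℝ 1 (deriv W) := (contDiff_succ_iff_deriv (n := 1).1 hWc).2.2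
  have hW'' : Continuous (deriv (deriv W)) := hW'.continuous_deriv le_rfl
  have hWs : HasCompactSupport W := cutoff.hasCompactSupport
  set C := M * ∫ s, |deriv (deriv W) s|
  set w : ℕ → ℝ → ℝ := fun n s => W (1 / (n + 1) * s) with hw
  set H : ℕ → ℝ → ℝ := fun n => mollify (w n) G with hH
  have hdw : ∀ n, deriv (w n) = fun s => (1 / ((n : ℝ) + 1)) * deriv W (1 / (n + 1) * s) := by
    intro n; ext s
    exact deriv_comp_mul_left _ _ _
  have hddw : ∀ n, deriv (deriv (w n)) =
      fun s => (1 / ((n : ℝ) + 1)) * ((1 / ((n : ℝ) + 1)) * deriv (deriv W) (1 / (n + 1) * s)) := by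
    intro n; rw [hdw]; ext s
    rw [deriv_const_mul_field, deriv_comp_mul_left]; simp
  have hwc : ∀ n, ContDiff ℝ 2 (w n) := fun n => hWc.comp (contDiff_const.mul contDiff_id)
  have hw'c : ∀ n, ContDiff ℝ 1 (deriv (w n)) := fun n =>
    (contDiff_succ_iff_deriv (n := 1).1 (hwc n)).2.2
  have hws : ∀ n, HasCompactSupport (w n) := fun n =>
    hWs.comp_homeomorph (Homeomorph.mulLeft₀ (1 / ((n : ℝ) + 1)) (by positivity))
  have hd1 : ∀ n x, HasDerivAt (H n) (mollify (deriv (w n)) G x) x := fun n x =>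
    hasDerivAt_mollify ((hwc n).of_le (by norm_num)) (hws n) hG x
  have hd2 : ∀ n x, HasDerivAt (mollify (deriv (w n)) G)
      (mollify (deriv (deriv (w n))) G x) x := fun n x =>
    hasDerivAt_mollify (hw'c n) (hws n).deriv hG x
  -- Two derivatives of the rescaled bump give (n+1)⁻², and the change of variables in the L¹ norm
  -- gives back one factor n+1.
  have hb : ∀ n x, |mollify (deriv (deriv (w n))) G x| ≤ C * (1 / (n + 1)) := by
    intro n x
    have hi : Integrable (deriv (deriv (w n))) :=
      ((hw'c n).continuous_deriv le_rfl).integrable_of_hasCompactSupport (hws n).deriv.deriv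
    refine (abs_mollify_le hi hM x).trans (le_of_eq ?_)
    have : ∫ s, |deriv (deriv (w n)) s| = (1 / ((n : ℝ) + 1)) * ∫ s, |deriv (deriv W) s| := by
      rw [hddw]
      have hp : (0 : ℝ) < 1 / (n + 1) := by positivity
      simp_rw [abs_mul, abs_of_pos hp]
      rw [integral_const_mul, integral_const_mul,
        Measure.integral_comp_mul_left (fun y => |deriv (deriv W) y|), abs_inv, abs_of_pos hp,
        smul_eq_mul]
      field_simp
    rw [this]; ring
  refine ⟨fun n => mollify (deriv (w n)) G 0, C, fun k hk hk0 hk1 hk2 n => ?_⟩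
  set D := mollify (deriv (w n)) G 0
  have hT : ∀ x, |H n x - H n 0 - D * x| ≤ C * (1 / (n + 1)) * x ^ 2 := by
    intro x
    have e1 : ∀ t, |t| ≤ |x| → |mollify (deriv (w n)) G t - D| ≤ C * (1 / (n + 1)) * |t| ^ (0 + 1) :=
      fun t ht => abs_le_of_abs_deriv_le_pow (fun t => (hd2 n t).sub_const D) (by simp [D])
        (fun t _ => by simpa using hb n t) ht
    have e2 := abs_le_of_abs_deriv_le_pow (r := fun t => H n t - H n 0 - D * t)
      (fun t => ((hd1 n t).sub_const _).sub (by simpa using (hasDerivAt_id t).const_mul D))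
      (by simp) e1 le_rfl
    simpa using e2
  have hHk : Integrable (fun x => H n x * k x) := by
    have hwi : Integrable (w n) := (hwc n).continuous.integrable_of_hasCompactSupport (hws n)
    refine hk.bdd_mul (c := M * ∫ s, |w n s|) ?_
      (Eventually.of_forall fun x => abs_mollify_le hwi hM x)
    exact (contDiff_mollify (n := 0) ((hwc n).of_le (by simp)) (hws n)
      hG).continuous.aestronglyMeasurable
  have e3 : (∫ x, H n x * k x) - D * ∫ x, x * k x = ∫ x, (H n x - H n 0 - D * x) * k x := by
    have : ∀ x, (H n x - H n 0 - D * x) * k x = H n x * k x - H n 0 * k x - D * (x * k x) :=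
      fun x => by ring
    simp_rw [this]
    have hs1 : Integrable (fun x => H n x * k x - H n 0 * k x) := hHk.sub (hk.const_mul _)
    rw [integral_sub hs1 (hk1.const_mul _),
      integral_sub hHk (hk.const_mul _), integral_const_mul, integral_const_mul, hk0]
    ring
  change |(∫ x, H n x * k x) - D * ∫ x, x * k x| ≤ _
  rw [e3, ← Real.norm_eq_abs]
  have e4 : C * (∫ x, |x ^ 2 * k x|) * (1 / ((n : ℝ) + 1)) =
      ∫ x, C * (1 / ((n : ℝ) + 1)) * |x ^ 2 * k x| := by
    rw [integral_const_mul]; ring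
  rw [e4]
  refine norm_integral_le_of_norm_le (hk2.abs.const_mul _) (Eventually.of_forall fun x => ?_)
  rw [norm_mul, Real.norm_eq_abs, Real.norm_eq_abs, abs_mul, abs_of_nonneg (sq_nonneg x),
    ← mul_assoc]
  exact mul_le_mul_of_nonneg_right (hT x) (abs_nonneg _)

theorem integrable_mollify_mul {w G k : ℝ → ℝ} (hw : Continuous w) (hws : HasCompactSupport w)
    (hG : BddMeas G) (hk : Integrable k) : Integrable (fun x => mollify w G x * k x) := by
  obtain ⟨M, hM⟩ := hG.bounded
  refine hk.bdd_mul (c := M * ∫ s, |w s|) ?_ (Eventually.of_forall fun x =>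
    abs_mollify_le (hw.integrable_of_hasCompactSupport hws) hM x)
  exact (contDiff_mollify (n := 0) (contDiff_zero.2 hw) hws hG).continuous.aestronglyMeasurable

theorem integral_mollify_mul_commDensity_mono {f g : ℝ → ℝ} {hf : BddMeas f} {hg : BddMeas g}
    (h : (iComm hf hg).IsPositive) {v w : ℝ → ℝ} (hv : Continuous v) (hvs : HasCompactSupport v)
    (hw : Continuous w) (hws : HasCompactSupport w) (hvw : ∀ s, v s ≤ w s) (ψ : 𝓢(ℝ, ℂ)) :
    ∫ x, mollify v g x * commDensity hf ψ x ≤ ∫ x, mollify w g x * commDensity hf ψ x := by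
  have hvi := hv.integrable_of_hasCompactSupport hvs (μ := volume)
  have hwi := hw.integrable_of_hasCompactSupport hws (μ := volume)
  have h1 := integral_mollify_mul_commDensity_nonneg h (w := fun s => w s - v s) (hwi.sub hvi)
    (fun s => sub_nonneg.2 (hvw s)) ψ
  have h2 : ∀ x, mollify (fun s => w s - v s) g x * commDensity hf ψ x =
      mollify w g x * commDensity hf ψ x - mollify v g x * commDensity hf ψ x := fun x => by
    rw [← sub_mul, mollify, mollify, mollify, ← integral_sub (integrable_mollify hwi hg x)
      (integrable_mollify hvi hg x)]
    simp_rw [sub_mul]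
  simp_rw [h2] at h1
  rw [integral_sub (integrable_mollify_mul hw hws hg (integrable_commDensity hf ψ))
    (integrable_mollify_mul hv hvs hg (integrable_commDensity hf ψ))] at h1
  linarith

theorem mollify_const_mul (c : ℝ) (w G : ℝ → ℝ) (x : ℝ) :
    mollify (fun s => c * w s) G x = c * mollify w G x := by
  rw [mollify, mollify, ← integral_const_mul]
  simp_rw [mul_assoc]

/-- Nonnegativity of the wide averages says that D n times the first moment is at least -O(1/n),
with D n common to all ψ. If D n stays away from zero along a subsequence of constant sign, every
first moment has that sign. If D n → 0, the forms of all wide averages tend to zero and the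
commutator must vanish. -/
theorem exists_sign_integral_id_mul_commDensity {f g : ℝ → ℝ} {hf : BddMeas f} {hg : BddMeas g}
    (h : (iComm hf hg).IsPositive) (hne : iComm hf hg ≠ 0) :
    (∀ ψ : 𝓢(ℝ, ℂ), 0 ≤ ∫ x, x * commDensity hf ψ x) ∨
      (∀ ψ : 𝓢(ℝ, ℂ), ∫ x, x * commDensity hf ψ x ≤ 0) := by
  obtain ⟨D, C, hDC⟩ := abs_integral_wide_mollify_sub_le hg
  set w : ℕ → ℝ → ℝ := fun n s => cutoff (1 / (n + 1) * s) with hw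
  have hwc : ∀ n, Continuous (w n) := fun n => cutoff.continuous.comp (by fun_prop)
  have hws : ∀ n, HasCompactSupport (w n) := fun n =>
    cutoff.hasCompactSupport.comp_homeomorph (Homeomorph.mulLeft₀ (1 / ((n : ℝ) + 1)) (by positivity))
  have hw0 : ∀ n s, 0 ≤ w n s := fun n s => cutoff.nonneg
  have hest : ∀ ψ : 𝓢(ℝ, ℂ), ∀ n : ℕ,
      |(∫ x, mollify (w n) g x * commDensity hf ψ x) - D n * ∫ x, x * commDensity hf ψ x| ≤
        C * (∫ x, |x ^ 2 * commDensity hf ψ x|) * (1 / (n + 1)) := fun ψ n =>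
    hDC _ (integrable_commDensity hf ψ) (integral_commDensity hf ψ)
      (integrable_id_mul_commDensity hf ψ) (integrable_sq_mul_commDensity hf ψ) n
  have hpos : ∀ ψ n, 0 ≤ ∫ x, mollify (w n) g x * commDensity hf ψ x := fun ψ n =>
    integral_mollify_mul_commDensity_nonneg h
      ((hwc n).integrable_of_hasCompactSupport (hws n)) (hw0 n) ψ
  have herr : ∀ K : ℝ, Tendsto (fun n : ℕ => K * (1 / ((n : ℝ) + 1))) atTop (𝓝 0) := fun K => by
    simpa using tendsto_one_div_succ.const_mul K
  by_cases hD : Tendsto D atTop (𝓝 0)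
  · refine absurd (iComm_eq_zero_of_integral fun ψ => ?_) hne
    have hlim : Tendsto (fun n => ∫ x, mollify (w n) g x * commDensity hf ψ x) atTop (𝓝 0) := by
      refine squeeze_zero (hpos ψ) (fun n => ?_) (g := fun n =>
        D n * (∫ x, x * commDensity hf ψ x) +
          C * (∫ x, |x ^ 2 * commDensity hf ψ x|) * (1 / (n + 1))) ?_
      · have := (abs_le.1 (hest ψ n)).2
        linarith
      · have h1 := (hD.mul_const (∫ x, x * commDensity hf ψ x)).add
          (herr (C * (∫ x, |x ^ 2 * commDensity hf ψ x|)))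
        rwa [zero_mul, add_zero] at h1
    -- The wide bump equals 1 on [-1, 1], which contains the support of `moll j`. So `moll j` is at
    -- most B times the wide bump for every n, and monotonicity of the form in the weight squeezes
    -- the narrow average to zero.
    have hz : ∀ j, ∫ x, mollify (moll j) g x * commDensity hf ψ x = 0 := by
      intro j
      refine le_antisymm ?_ (integral_mollify_mul_commDensity_nonneg h (integrable_moll j)
        (moll_nonneg j) ψ)
      have hmc : Continuous (moll j) := (contDiff_moll j (m := 0)).continuous
      obtain ⟨B, hB⟩ := hmc.bounded_above_of_compact_support (hasCompactSupport_moll j)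
      have hB0 : 0 ≤ B := (norm_nonneg _).trans (hB 0)
      refine ge_of_tendsto' (by simpa using hlim.const_mul B) fun n => ?_
      have h3 := integral_mollify_mul_commDensity_mono h hmc (hasCompactSupport_moll j)
        (w := fun s => B * w n s) (continuous_const.mul (hwc n)) (hws n).mul_left (fun s => ?_) ψ
      · simp_rw [mollify_const_mul, mul_assoc] at h3
        rwa [integral_const_mul] at h3
      · by_cases hs : 1 / ((j : ℝ) + 1) ≤ |s|
        · rw [moll_eq_zero j hs]
          exact mul_nonneg hB0 (hw0 n s)
        · have h1 : w n s = 1 := by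
            apply cutoff.one_of_mem_closedBall
            rw [Metric.mem_closedBall, dist_zero_right, norm_mul, Real.norm_eq_abs, Real.norm_eq_abs,
              abs_of_pos (by positivity)]
            have e1 : 1 / ((j : ℝ) + 1) ≤ 1 := by
              rw [div_le_one (by positivity)]; linarith [(Nat.cast_nonneg j : (0 : ℝ) ≤ j)]
            have e2 : 1 / ((n : ℝ) + 1) ≤ 1 := by
              rw [div_le_one (by positivity)]; linarith [(Nat.cast_nonneg n : (0 : ℝ) ≤ n)]
            have e3 : |s| ≤ 1 := by linarith
            exact mul_le_one₀ e2 (abs_nonneg _) e3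
          rw [h1, mul_one]
          exact (le_abs_self _).trans (hB s)
    have h4 := tendsto_integral_mollify_mul hg (integrable_commDensity hf ψ)
    simp_rw [hz] at h4
    exact (tendsto_nhds_unique h4 tendsto_const_nhds)
  · have hlow : ∀ ψ : 𝓢(ℝ, ℂ), ∀ n : ℕ,
        -(C * (∫ x, |x ^ 2 * commDensity hf ψ x|) * (1 / (n + 1))) ≤
          D n * ∫ x, x * commDensity hf ψ x := fun ψ n => by
      have := (abs_le.1 (hest ψ n)).2
      linarith [hpos ψ n]
    rw [Metric.tendsto_atTop] at hD
    push Not at hD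
    obtain ⟨η, hη, hfr⟩ := hD
    have hfr' : ∃ᶠ n in atTop, η ≤ D n ∨ η ≤ -D n := by
      rw [frequently_atTop]
      intro N
      obtain ⟨n, hn, hn'⟩ := hfr N
      rw [Real.dist_eq, sub_zero] at hn'
      exact ⟨n, hn, le_abs.1 hn'⟩
    rcases frequently_or_distrib.1 hfr' with hc | hc
    · left
      intro ψ
      by_contra hlt
      push Not at hlt
      set m := ∫ x, x * commDensity hf ψ x
      have h5 := (herr (C * ∫ x, |x ^ 2 * commDensity hf ψ x|)).eventually
        (gt_mem_nhds (show 0 < -(η * m) by nlinarith))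
      obtain ⟨n, hn1, hn2⟩ := (hc.and_eventually h5).exists
      have h6 := hlow ψ n
      nlinarith [mul_le_mul_of_nonpos_right hn1 hlt.le]
    · right
      intro ψ
      by_contra hlt
      push Not at hlt
      set m := ∫ x, x * commDensity hf ψ x
      have h5 := (herr (C * ∫ x, |x ^ 2 * commDensity hf ψ x|)).eventually
        (gt_mem_nhds (show 0 < η * m by positivity))
      obtain ⟨n, hn1, hn2⟩ := (hc.and_eventually h5).exists
      have h6 := hlow ψ n
      nlinarith [mul_le_mul_of_nonneg_right hn1 hlt.le]

/-! ### Monotonicity of the momentum function -/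

theorem fourier_of_mul_id {ψ χ : 𝓢(ℝ, ℂ)} (hχ : ∀ x, χ x = (x : ℂ) * ψ x) (ξ : ℝ) :
    𝓕 χ ξ = Complex.I / (2 * Real.pi) * deriv (𝓕 ψ : 𝓢(ℝ, ℂ)) ξ := by
  have h1 : Integrable (fun x : ℝ => x • ψ x) := by
    refine χ.integrable.congr (Eventually.of_forall fun x => ?_)
    simp [hχ]
  have h2 : deriv (𝓕 ψ : 𝓢(ℝ, ℂ)) ξ = 𝓕 (fun x : ℝ => (-2 * Real.pi * Complex.I * x) • ψ x) ξ := by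
    rw [SchwartzMap.fourier_coe]
    exact congrFun (Real.deriv_fourier ψ.integrable h1) ξ
  have h3 : (fun x : ℝ => (-2 * Real.pi * Complex.I * x) • ψ x) =
      (-2 * Real.pi * Complex.I : ℂ) • (χ : ℝ → ℂ) := by
    ext x
    rw [Pi.smul_apply, hχ, smul_eq_mul, smul_eq_mul, mul_assoc]
  rw [h2, h3, SchwartzMap.fourier_coe, Real.fourier_real_eq, Real.fourier_real_eq]
  have h4 : ∀ v : ℝ, Real.fourierChar (-(v * ξ)) • ((-2 * Real.pi * Complex.I : ℂ) • (χ : ℝ → ℂ)) v =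
      (-2 * Real.pi * Complex.I) * (Real.fourierChar (-(v * ξ)) • χ v) := fun v => by
    rw [Pi.smul_apply, smul_eq_mul, Circle.smul_def, Circle.smul_def, smul_eq_mul, smul_eq_mul]
    ring
  simp_rw [h4]
  rw [integral_const_mul, ← mul_assoc]
  have hpi : (Real.pi : ℂ) ≠ 0 := by exact_mod_cast Real.pi_ne_zero
  have : Complex.I / (2 * Real.pi) * (-2 * Real.pi * Complex.I) = 1 := by
    field_simp
    simp
  rw [this, one_mul]

/-- This is i[f(P), Q] = f'(P) in weak form, tested on the vector whose Fourier transform is the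
real bump g: the integrand f g g' is half of f (g²)'. -/
theorem exists_integral_id_mul_commDensity_eq {f : ℝ → ℝ} (hf : BddMeas f) {g : ℝ → ℝ}
    (hg : ContDiff ℝ ((⊤ : ℕ∞) : WithTop ℕ∞) g) (hgs : HasCompactSupport g) :
    ∃ ψ : 𝓢(ℝ, ℂ), ∫ x, x * commDensity hf ψ x =
      -(1 / Real.pi) * ∫ ξ, f (2 * Real.pi * ξ) * (g ξ * deriv g ξ) := by
  have hg' : ContDiff ℝ ((⊤ : ℕ∞) : WithTop ℕ∞) (fun x => (g x : ℂ)) :=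
    Complex.ofRealCLM.contDiff.comp hg
  have hgs' : HasCompactSupport (fun x => (g x : ℂ)) :=
    hgs.comp_left (g := fun x : ℝ => (x : ℂ)) (by simp)
  set χ : 𝓢(ℝ, ℂ) := hgs'.toSchwartzMap hg' with hχ
  have hχx : ∀ x, χ x = (g x : ℂ) := fun x => rfl
  obtain ⟨η, hη⟩ := exists_schwartz_mul_id (𝓕⁻ χ)
  refine ⟨𝓕⁻ χ, ?_⟩
  rw [integral_mul_commDensity hf (h := fun x => x) hη]
  have hd : ∀ ξ, deriv χ ξ = ((deriv g ξ : ℝ) : ℂ) := fun ξ =>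
    ((hg.differentiable (by simp) ξ).hasDerivAt.ofReal_comp).deriv
  have h1 : ∀ ξ, (f (2 * Real.pi * ξ) : ℂ) * (conj (𝓕 (𝓕⁻ χ) ξ) * 𝓕 η ξ) =
      Complex.I * (((1 / (2 * Real.pi)) * (f (2 * Real.pi * ξ) * (g ξ * deriv g ξ)) : ℝ) : ℂ) := by
    intro ξ
    rw [fourier_of_mul_id hη, FourierTransform.fourier_fourierInv_eq, hd, hχx, Complex.conj_ofReal]
    push_cast; ring
  simp_rw [h1]
  rw [integral_const_mul, integral_complex_ofReal, Complex.I_mul_im, Complex.ofReal_re,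
    integral_const_mul]
  ring

/-- Integration by parts turns the hypothesis into ∫ u' g² ≥ 0, which a bump at a point with u' < 0
would contradict. -/
theorem deriv_nonneg_of_integral_nonpos {u : ℝ → ℝ} (hu : ContDiff ℝ 1 u)
    (h : ∀ g : ℝ → ℝ, ContDiff ℝ ((⊤ : ℕ∞) : WithTop ℕ∞) g → HasCompactSupport g →
      ∫ x, u x * (g x * deriv g x) ≤ 0) (x₀ : ℝ) : 0 ≤ deriv u x₀ := by
  by_contra hlt
  push Not at hlt
  have hu' : Continuous (deriv u) := hu.continuous_deriv le_rfl
  obtain ⟨r, hr, hball⟩ := Metric.eventually_nhds_iff_ball.1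
    (hu'.continuousAt.eventually (gt_mem_nhds hlt))
  let b : ContDiffBump x₀ := ⟨r / 2, r, by positivity, by linarith⟩
  have hb : ContDiff ℝ ((⊤ : ℕ∞) : WithTop ℕ∞) b := b.contDiff
  have hbs : HasCompactSupport b := b.hasCompactSupport
  have hbd : ∀ x, HasDerivAt b (deriv b x) x := fun x => (hb.differentiable (by simp) x).hasDerivAt
  have hb' : Continuous (deriv b) := hb.continuous_deriv (by simp)
  have hud : ∀ x, HasDerivAt u (deriv u x) x := fun x => (hu.differentiable (by simp) x).hasDerivAt
  have e1 : ∫ x, u x * (b x * deriv b x + deriv b x * b x) = - ∫ x, deriv u x * (b x * b x) := by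
    refine integral_mul_deriv_eq_deriv_mul_of_integrable (fun x _ => hud x) (fun x _ => ?_) ?_ ?_ ?_
    · refine ((hbd x).mul (hbd x)).congr_deriv ?_
      ring
    · refine Continuous.integrable_of_hasCompactSupport (by have := hu.continuous; fun_prop) ?_
      exact (hbs.mul_right.add hbs.mul_left).mul_left
    · exact Continuous.integrable_of_hasCompactSupport (by fun_prop) hbs.mul_right.mul_left
    · exact Continuous.integrable_of_hasCompactSupport (by have := hu.continuous; fun_prop)
        hbs.mul_right.mul_left
  have e2 : ∫ x, u x * (b x * deriv b x + deriv b x * b x) = 2 * ∫ x, u x * (b x * deriv b x) := by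
    rw [← integral_const_mul]
    congr 1 with x; ring
  have e3 := h b hb hbs
  have e4 : 0 < ∫ x, -(deriv u x * (b x * b x)) := by
    refine Continuous.integral_pos_of_hasCompactSupport_nonneg_nonzero (x := x₀) (by fun_prop)
      (hbs.mul_right.mul_left (f := deriv u)).neg (fun x => ?_) ?_
    · by_cases hx : x ∈ Metric.ball x₀ r
      · have := hball x hx
        simp only [Pi.zero_apply, Left.nonneg_neg_iff]
        exact mul_nonpos_of_nonpos_of_nonneg this.le (mul_self_nonneg _)
      · have : b x = 0 := b.zero_of_le_dist (not_lt.1 hx)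
        simp [this]
    · have : b x₀ = 1 := b.one_of_mem_closedBall (Metric.mem_closedBall_self b.rIn_pos.le)
      rw [this]; simp [hlt.ne]
  rw [integral_neg] at e4
  linarith

/-- The pointwise limsup of the mollifications is monotone and bounded everywhere, and it agrees
with f wherever they converge to f. -/
theorem exists_monotone_ae_eq_of_mollify {f : ℝ → ℝ} (hf : BddMeas f)
    (hm : ∀ n, Monotone (mollify (moll n) f)) :
    ∃ f₁ : ℝ → ℝ, Monotone f₁ ∧ (∃ M, ∀ x, |f₁ x| ≤ M) ∧ f =ᵐ[volume] f₁ := by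
  obtain ⟨M, hM⟩ := hf.bounded
  have hb := fun x n => abs_le.1 (abs_mollify_moll_le hM n x)
  have hbu : ∀ x, IsBoundedUnder (· ≤ ·) atTop (fun n => mollify (moll n) f x) := fun x =>
    isBoundedUnder_of ⟨M, fun n => (hb x n).2⟩
  have hbl : ∀ x, IsBoundedUnder (· ≥ ·) atTop (fun n => mollify (moll n) f x) := fun x =>
    isBoundedUnder_of ⟨-M, fun n => (hb x n).1⟩
  refine ⟨fun x => limsup (fun n => mollify (moll n) f x) atTop, fun x y hxy => ?_,
    ⟨M, fun x => abs_le.2 ⟨?_, ?_⟩⟩, ?_⟩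
  · exact limsup_le_limsup (Eventually.of_forall fun n => hm n hxy) (hbl x).isCoboundedUnder_le
      (hbu y)
  · exact le_limsup_of_frequently_le (Frequently.of_forall fun n => (hb x n).1) (hbu x)
  · exact limsup_le_of_le (hbl x).isCoboundedUnder_le (Eventually.of_forall fun n => (hb x n).2)
  · filter_upwards [ae_tendsto_mollify hf] with x hx
    exact hx.limsup_eq.symm

theorem exists_monotone_ae_eq_of_integral_nonpos {f : ℝ → ℝ} (hf : BddMeas f)
    (h : ∀ g : ℝ → ℝ, ContDiff ℝ ((⊤ : ℕ∞) : WithTop ℕ∞) g → HasCompactSupport g →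
      ∫ x, f x * (g x * deriv g x) ≤ 0) :
    ∃ f₁ : ℝ → ℝ, Monotone f₁ ∧ (∃ M, ∀ x, |f₁ x| ≤ M) ∧ f =ᵐ[volume] f₁ := by
  have hm : ∀ n, Monotone (mollify (moll n) f) := by
    intro n
    have hc : ContDiff ℝ 1 (mollify (moll n) f) :=
      contDiff_mollify (n := 1) (contDiff_moll n) (hasCompactSupport_moll n) hf
    refine monotone_of_deriv_nonneg (hc.differentiable (by simp))
      (deriv_nonneg_of_integral_nonpos hc fun g hg hgs => ?_)
    have hi : Integrable (fun x => g x * deriv g x) :=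
      (hg.continuous.mul (hg.continuous_deriv (by simp))).integrable_of_hasCompactSupport
        hgs.mul_right
    rw [integral_mollify_mul (integrable_moll n) hf hi]
    refine integral_nonpos fun s => mul_nonpos_of_nonneg_of_nonpos (moll_nonneg n s) ?_
    have hshift := h (fun x => g (x + s)) (hg.comp (contDiff_id.add contDiff_const))
      (hgs.comp_homeomorph (Homeomorph.addRight s))
    rw [← integral_sub_right_eq_self _ s] at hshift
    simpa [deriv_comp_add_const] using hshift
  exact exists_monotone_ae_eq_of_mollify hf hm

theorem exists_monotone_or_antitone_ae_eq {f g : ℝ → ℝ} {hf : BddMeas f} {hg : BddMeas g}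
    (h : (iComm hf hg).IsPositive) (hne : iComm hf hg ≠ 0) :
    ∃ f₁ : ℝ → ℝ, (Monotone f₁ ∨ Antitone f₁) ∧ BddMeas f₁ ∧ f =ᵐ[volume] f₁ := by
  have hscale : ∀ u v : ℝ → ℝ, (fun ξ => u (2 * Real.pi * ξ)) =ᵐ[volume] v →
      u =ᵐ[volume] fun x => v ((2 * Real.pi)⁻¹ * x) := by
    intro u v huv
    have hq : Measure.QuasiMeasurePreserving (fun x : ℝ => (2 * Real.pi)⁻¹ * x) volume volume := by
      refine ⟨measurable_const_mul _, ?_⟩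
      rw [Real.map_volume_mul_left (inv_ne_zero Real.two_pi_pos.ne')]
      exact Measure.smul_absolutelyContinuous
    filter_upwards [hq.ae_eq huv] with x hx
    simp only [Function.comp_apply] at hx
    rw [← hx, ← mul_assoc, mul_inv_cancel₀ Real.two_pi_pos.ne', one_mul]
  have hinv : (0 : ℝ) ≤ (2 * Real.pi)⁻¹ := (inv_pos.2 Real.two_pi_pos).le
  have hfs := hf.comp_mul_left Real.two_pi_pos.ne'
  rcases exists_sign_integral_id_mul_commDensity h hne with hs | hs
  · obtain ⟨f₁, hm, ⟨M, hM⟩, he⟩ := exists_monotone_ae_eq_of_integral_nonpos hfs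
      fun g hg hgs => by
        obtain ⟨ψ, hψ⟩ := exists_integral_id_mul_commDensity_eq hf hg hgs
        have := hs ψ
        rw [hψ] at this
        by_contra hc
        push Not at hc
        have : 0 < (1 / Real.pi) * ∫ ξ, f (2 * Real.pi * ξ) * (g ξ * deriv g ξ) := by
          have := Real.pi_pos; positivity
        linarith
    have hm' : Monotone fun x => f₁ ((2 * Real.pi)⁻¹ * x) := fun x y hxy =>
      hm (mul_le_mul_of_nonneg_left hxy hinv)
    exact ⟨_, Or.inl hm', ⟨hm'.measurable.aemeasurable, M, fun x => hM _⟩, hscale _ _ he⟩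
  · obtain ⟨f₁, hm, ⟨M, hM⟩, he⟩ := exists_monotone_ae_eq_of_integral_nonpos hfs.neg
      fun g hg hgs => by
        obtain ⟨ψ, hψ⟩ := exists_integral_id_mul_commDensity_eq hf hg hgs
        have := hs ψ
        rw [hψ] at this
        simp_rw [neg_mul]
        rw [integral_neg]
        by_contra hc
        push Not at hc
        have : 0 < (1 / Real.pi) * -∫ ξ, f (2 * Real.pi * ξ) * (g ξ * deriv g ξ) := by
          have := Real.pi_pos
          exact mul_pos (by positivity) (by linarith)
        linarith
    have hm' : Antitone fun x => -f₁ ((2 * Real.pi)⁻¹ * x) := fun x y hxy =>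
      neg_le_neg (hm (mul_le_mul_of_nonneg_left hxy hinv))
    refine ⟨_, Or.inr hm', ⟨hm'.measurable.aemeasurable, M, fun x => by simpa using hM _⟩,
      hscale f (fun x => -f₁ x) ?_⟩
    filter_upwards [he] with x hx
    linarith

/-! ### The integral kernel of the commutator -/

theorem conj_fourier_mul_fourier (ψ χ : 𝓢(ℝ, ℂ)) (ξ : ℝ) :
    conj (𝓕 ψ ξ) * 𝓕 χ ξ =
      ∫ z : ℝ × ℝ, (conj (ψ z.1) * χ z.2) *
        Complex.exp (2 * Real.pi * ξ * (z.1 - z.2 : ℝ) * Complex.I) := by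
  rw [SchwartzMap.fourier_coe, SchwartzMap.fourier_coe, Real.fourier_real_eq_integral_exp_smul,
    Real.fourier_real_eq_integral_exp_smul, ← integral_conj, ← integral_prod_mul]
  refine integral_congr_ae (Eventually.of_forall fun z => ?_)
  simp only [smul_eq_mul, map_mul, ← Complex.exp_conj, Complex.conj_ofReal, Complex.conj_I]
  rw [mul_mul_mul_comm, ← Complex.exp_add, mul_comm]
  congr 2
  push_cast; ring

/-- The kernel of the regularized spectral projection of `P` on `[t, ∞)`. -/
noncomputable def stepKernel (ε t u : ℝ) : ℂ :=
  Complex.exp (t * u * Complex.I) / (2 * Real.pi * (ε - u * Complex.I))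

theorem ofReal_sub_mul_I_ne_zero {ε : ℝ} (hε : 0 < ε) (u : ℝ) : (ε - u * Complex.I : ℂ) ≠ 0 := by
  intro h
  have := congrArg Complex.re h
  simp at this
  linarith

theorem conj_stepKernel_neg (ε t u : ℝ) : conj (stepKernel ε t (-u)) = stepKernel ε t u := by
  simp only [stepKernel, map_div₀, ← Complex.exp_conj, map_mul, map_sub, Complex.conj_ofReal,
    Complex.conj_I, Complex.ofReal_neg, map_ofNat, map_neg]
  congr 2
  · ring
  · ring

theorem continuous_stepKernel {ε : ℝ} (hε : 0 < ε) (t : ℝ) :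
    Continuous (fun z : ℝ × ℝ => stepKernel ε t (z.1 - z.2)) := by
  unfold stepKernel
  refine Continuous.div (by fun_prop) (by fun_prop) fun z => ?_
  have hpi : (Real.pi : ℂ) ≠ 0 := by exact_mod_cast Real.pi_ne_zero
  exact mul_ne_zero (mul_ne_zero two_ne_zero hpi) (ofReal_sub_mul_I_ne_zero hε (z.1 - z.2))

/-- The factor exp(-ε(p - t)), with p = 2πξ, makes the kernel of the spectral projection an
absolutely convergent integral. -/
theorem integral_regularized_exp {ε : ℝ} (hε : 0 < ε) (t u : ℝ) :
    ∫ ξ in Set.Ioi (t / (2 * Real.pi)), (Real.exp (-(2 * Real.pi * ε * (ξ - t / (2 * Real.pi)))) : ℂ) *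
      Complex.exp (2 * Real.pi * ξ * u * Complex.I) = stepKernel ε t u := by
  have hpi : (Real.pi : ℂ) ≠ 0 := by exact_mod_cast Real.pi_ne_zero
  have hne := ofReal_sub_mul_I_ne_zero hε u
  have h1 : ∀ ξ : ℝ, (Real.exp (-(2 * Real.pi * ε * (ξ - t / (2 * Real.pi)))) : ℂ) *
      Complex.exp (2 * Real.pi * ξ * u * Complex.I) =
      Complex.exp (ε * t) * Complex.exp ((-(2 * Real.pi * (ε - u * Complex.I))) * ξ) := fun ξ => by
    rw [Complex.ofReal_exp, ← Complex.exp_add, ← Complex.exp_add]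
    congr 1
    push_cast
    field_simp
    ring
  simp_rw [h1]
  have hre : (-(2 * Real.pi * (ε - u * Complex.I)) : ℂ).re < 0 := by
    have := Real.pi_pos
    simp
    positivity
  rw [integral_const_mul, integral_exp_mul_complex_Ioi hre, stepKernel, neg_div_neg_eq,
    ← mul_div_assoc, ← Complex.exp_add]
  congr 2
  push_cast
  field_simp
  ring

theorem norm_exp_ofReal_mul_I (a b : ℝ) : ‖Complex.exp (a * b * Complex.I)‖ = 1 := by
  have := Complex.norm_exp_ofReal_mul_I (a * b)
  push_cast at this
  exact this

theorem integrable_conj_mul_prod (ψ χ : 𝓢(ℝ, ℂ)) :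
    Integrable (fun z : ℝ × ℝ => conj (ψ z.1) * χ z.2) := by
  have h1 : Integrable (fun x => conj (ψ x)) := by
    refine ψ.integrable.norm.mono' (by fun_prop) (Eventually.of_forall fun x => ?_)
    simp
  exact h1.mul_prod χ.integrable

theorem integral_mul_integral_swap {X : Type*} [MeasurableSpace X] {μ : Measure X} [SFinite μ]
    {a : ℝ → ℂ} {b : X → ℂ} {e : ℝ → X → ℂ} {ν : Measure ℝ} [SFinite ν]
    (ha : Integrable a ν) (hb : Integrable b μ)
    (he : AEStronglyMeasurable (Function.uncurry e) (ν.prod μ)) (he1 : ∀ ξ z, ‖e ξ z‖ ≤ 1) :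
    ∫ ξ, a ξ * ∫ z, b z * e ξ z ∂μ ∂ν = ∫ z, b z * ∫ ξ, a ξ * e ξ z ∂ν ∂μ := by
  have hi : Integrable (Function.uncurry fun ξ z => a ξ * b z * e ξ z) (ν.prod μ) :=
    (ha.mul_prod hb).mul_bdd (c := 1) he (Eventually.of_forall fun p => he1 p.1 p.2)
  have h := integral_integral_swap hi
  have h1 : ∀ ξ, a ξ * ∫ z, b z * e ξ z ∂μ = ∫ z, a ξ * b z * e ξ z ∂μ := fun ξ => by
    rw [← integral_const_mul]
    simp_rw [mul_assoc]
  have h2 : ∀ z, b z * ∫ ξ, a ξ * e ξ z ∂ν = ∫ ξ, a ξ * b z * e ξ z ∂ν := fun z => by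
    rw [← integral_const_mul]
    congr 1 with ξ
    ring
  simp_rw [h1, h2]
  exact h

theorem integrable_regularized_exp {ε : ℝ} (hε : 0 < ε) (c : ℝ) :
    Integrable (fun ξ : ℝ => (Real.exp (-(2 * Real.pi * ε * (ξ - c))) : ℂ))
      (volume.restrict (Set.Ioi c)) := by
  have h0 : (0 : ℝ) < 2 * Real.pi * ε := by have := Real.pi_pos; positivity
  have h1 := (exp_neg_integrableOn_Ioi c h0).const_mul (Real.exp (2 * Real.pi * ε * c))
  have h2 : Integrable (fun ξ : ℝ => Real.exp (-(2 * Real.pi * ε * (ξ - c))))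
      (volume.restrict (Set.Ioi c)) := by
    refine Integrable.congr h1 (Eventually.of_forall fun ξ => ?_)
    simp only [← Real.exp_add]
    congr 1
    ring
  exact h2.ofReal

theorem integral_regularized_step (ψ χ : 𝓢(ℝ, ℂ)) {ε : ℝ} (hε : 0 < ε) (t : ℝ) :
    ∫ ξ in Set.Ioi (t / (2 * Real.pi)),
      (Real.exp (-(2 * Real.pi * ε * (ξ - t / (2 * Real.pi)))) : ℂ) * (conj (𝓕 ψ ξ) * 𝓕 χ ξ) =
    ∫ z : ℝ × ℝ, (conj (ψ z.1) * χ z.2) * stepKernel ε t (z.1 - z.2) := by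
  simp_rw [conj_fourier_mul_fourier]
  have h := integral_mul_integral_swap (integrable_regularized_exp hε (t / (2 * Real.pi)))
    (integrable_conj_mul_prod ψ χ)
    (e := fun ξ z => Complex.exp (2 * Real.pi * ξ * (z.1 - z.2 : ℝ) * Complex.I))
    (Continuous.aestronglyMeasurable (by fun_prop)) (fun ξ z => by
      have := norm_exp_ofReal_mul_I (2 * Real.pi * ξ) (z.1 - z.2)
      push_cast at this ⊢
      exact this.le)
  refine h.trans ?_
  refine integral_congr_ae (Eventually.of_forall fun z => ?_)
  simp only [integral_regularized_exp hε t]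

/-- The singularity 1/(ε - iu) is tamed by the factor u that the commutator supplies, uniformly in
ε; this is the domination for ε → 0. -/
theorem norm_mul_stepKernel_le {ε : ℝ} (hε : 0 < ε) (t u : ℝ) :
    ‖(-Complex.I * u) * stepKernel ε t u‖ ≤ 1 / (2 * Real.pi) := by
  have hne := ofReal_sub_mul_I_ne_zero hε u
  have hle : |u| ≤ ‖(ε - u * Complex.I : ℂ)‖ := by
    have := Complex.abs_im_le_norm (ε - u * Complex.I : ℂ)
    simpa using this
  rw [stepKernel, norm_mul, norm_div, norm_exp_ofReal_mul_I, norm_mul, norm_mul, norm_mul, norm_neg,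
    Complex.norm_I, Complex.norm_real, Complex.norm_real, Complex.norm_ofNat, Real.norm_eq_abs,
    Real.norm_eq_abs, abs_of_pos Real.pi_pos, one_mul, ← mul_div_assoc, mul_one]
  rw [div_le_div_iff₀ (by have := Real.pi_pos; have := norm_pos_iff.2 hne; positivity)
    (by have := Real.pi_pos; positivity)]
  have := Real.pi_pos
  nlinarith

theorem tendsto_mul_stepKernel {u : ℝ} (hu : u ≠ 0) (t : ℝ) :
    Tendsto (fun n : ℕ => (-Complex.I * u) * stepKernel (1 / (n + 1)) t u) atTop
      (𝓝 (1 / (2 * Real.pi) * Complex.exp (t * u * Complex.I))) := by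
  have hpi : (Real.pi : ℂ) ≠ 0 := by exact_mod_cast Real.pi_ne_zero
  have hu' : (u : ℂ) ≠ 0 := by exact_mod_cast hu
  have h1 : Tendsto (fun n : ℕ => (((1 / ((n : ℝ) + 1) : ℝ)) : ℂ)) atTop (𝓝 0) := by
    have := (Complex.continuous_ofReal.tendsto 0).comp tendsto_one_div_succ
    simpa [Function.comp_def] using this
  have h2 : Tendsto (fun n : ℕ => (-Complex.I * u) * (Complex.exp (t * u * Complex.I) /
      (2 * Real.pi * ((((1 / ((n : ℝ) + 1) : ℝ)) : ℂ) - u * Complex.I)))) atTop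
      (𝓝 ((-Complex.I * u) * (Complex.exp (t * u * Complex.I) /
        (2 * Real.pi * (0 - u * Complex.I))))) := by
    refine tendsto_const_nhds.mul (tendsto_const_nhds.div
      (tendsto_const_nhds.mul (h1.sub tendsto_const_nhds)) ?_)
    simp [hpi, hu']
  have hI := Complex.I_ne_zero
  have e : 1 / (2 * Real.pi) * Complex.exp (t * u * Complex.I) =
      (-Complex.I * u) * (Complex.exp (t * u * Complex.I) /
        (2 * Real.pi * (0 - u * Complex.I))) := by
    field_simp
    ring
  rw [e]
  exact h2

theorem ae_fst_ne_snd : ∀ᵐ z : ℝ × ℝ, z.1 ≠ z.2 := by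
  have hm : MeasurableSet {z : ℝ × ℝ | z.1 = z.2} :=
    (isClosed_eq continuous_fst continuous_snd).measurableSet
  have h := (Measure.measure_prod_null (μ := (volume : Measure ℝ)) (ν := (volume : Measure ℝ)) hm).2
    (Eventually.of_forall fun x => by
      have : Prod.mk x ⁻¹' {z : ℝ × ℝ | z.1 = z.2} = {x} := by
        ext y; simp [eq_comm]
      change volume (Prod.mk x ⁻¹' {z : ℝ × ℝ | z.1 = z.2}) = 0
      rw [this, Real.volume_singleton])
  rw [ae_iff]
  simp only [ne_eq, not_not]
  exact h

theorem neg_two_im_eq (S : ℂ) : ((-2 * S.im : ℝ) : ℂ) = Complex.I * (S - conj S) := by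
  apply Complex.ext <;> simp; ring

/-- The case of one spectral projection of P on [t, ∞). Its regularized kernel is multiplied by
-i(H(x)-H(y)) = -i(x-y)D(x,y), and the product tends boundedly to e^{it(x-y)} D(x,y)/(2π) off the
diagonal. -/
theorem integral_step_eq_kernel {H : ℝ → ℝ} {D : ℝ × ℝ → ℝ} {L : ℝ} (hD : Continuous D)
    (hDb : ∀ z, |D z| ≤ L) (hDH : ∀ x y, (x - y) * D (x, y) = H x - H y)
    {ψ χ : 𝓢(ℝ, ℂ)} (hχ : ∀ x, χ x = H x * ψ x) (t : ℝ) :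
    ((-2 * (∫ ξ in Set.Ioi (t / (2 * Real.pi)), conj (𝓕 ψ ξ) * 𝓕 χ ξ).im : ℝ) : ℂ) =
      1 / (2 * Real.pi) * ∫ z : ℝ × ℝ, (conj (ψ z.1) * ψ z.2) *
        (Complex.exp (t * (z.1 - z.2 : ℝ) * Complex.I) * D z) := by
  set c := t / (2 * Real.pi)
  have hp : Integrable (fun ξ => conj (𝓕 ψ ξ) * 𝓕 χ ξ) := by
    have h1 : Integrable (fun ξ => 𝓕 χ ξ * conj (𝓕 ψ ξ)) := by
      obtain ⟨C, hC⟩ : ∃ C, ∀ x, ‖(𝓕 ψ) x‖ ≤ C := ⟨_, fun x => (𝓕 ψ).norm_le_seminorm ℝ x⟩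
      exact (𝓕 χ).integrable.mul_bdd (c := C)
        (by fun_prop) (Eventually.of_forall fun x => by simpa using hC x)
    simpa only [mul_comm] using h1
  set S : ℕ → ℂ := fun n => ∫ ξ in Set.Ioi c,
    (Real.exp (-(2 * Real.pi * (1 / (n + 1)) * (ξ - c))) : ℂ) * (conj (𝓕 ψ ξ) * 𝓕 χ ξ) with hS
  have hlim1 : Tendsto S atTop (𝓝 (∫ ξ in Set.Ioi c, conj (𝓕 ψ ξ) * 𝓕 χ ξ)) := by
    refine tendsto_integral_of_dominated_convergence (fun ξ => ‖conj (𝓕 ψ ξ) * 𝓕 χ ξ‖)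
      (fun n => ?_) hp.norm.integrableOn (fun n => ?_) (Eventually.of_forall fun ξ => ?_)
    · exact Continuous.aestronglyMeasurable (by fun_prop)
    · refine (ae_restrict_iff' measurableSet_Ioi).2 (Eventually.of_forall fun ξ hξ => ?_)
      rw [norm_mul, Complex.norm_real, Real.norm_eq_abs, Real.abs_exp]
      refine mul_le_of_le_one_left (norm_nonneg _) (Real.exp_le_one_iff.2 ?_)
      have h1 : 0 ≤ ξ - c := sub_nonneg.2 (le_of_lt hξ)
      have := Real.pi_pos
      have : 0 ≤ 2 * Real.pi * (1 / ((n : ℝ) + 1)) * (ξ - c) := by positivity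
      linarith
    · have h1 : Tendsto (fun n : ℕ => -(2 * Real.pi * (1 / ((n : ℝ) + 1)) * (ξ - c))) atTop (𝓝 0) := by
        have := ((tendsto_one_div_succ.const_mul (2 * Real.pi)).mul_const (ξ - c)).neg
        simpa using this
      have h2 := (Complex.continuous_ofReal.tendsto _).comp
        ((Real.continuous_exp.tendsto _).comp h1)
      rw [Real.exp_zero, Complex.ofReal_one] at h2
      simpa using h2.mul_const (conj (𝓕 ψ ξ) * 𝓕 χ ξ)
  -- Conjugation and swapping the variables move H from the second variable to the first, so the
  -- difference contains H(z.1) - H(z.2).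
  have hSk : ∀ n, Complex.I * (S n - conj (S n)) =
      ∫ z : ℝ × ℝ, (conj (ψ z.1) * ψ z.2) *
        ((-Complex.I * (z.1 - z.2 : ℝ)) * stepKernel (1 / (n + 1)) t (z.1 - z.2) * D z) := by
    intro n
    have hε : (0 : ℝ) < 1 / (n + 1) := by positivity
    have e1 : S n = ∫ z : ℝ × ℝ, (conj (ψ z.1) * χ z.2) * stepKernel (1 / (n + 1)) t (z.1 - z.2) :=
      integral_regularized_step ψ χ hε t
    have e2 : conj (S n) =
        ∫ z : ℝ × ℝ, (conj (χ z.1) * ψ z.2) * stepKernel (1 / (n + 1)) t (z.1 - z.2) := by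
      rw [e1, ← integral_conj]
      have := integral_prod_swap (μ := (volume : Measure ℝ)) (ν := (volume : Measure ℝ))
        (fun z : ℝ × ℝ => conj (conj (ψ z.1) * χ z.2 * stepKernel (1 / (n + 1)) t (z.1 - z.2)))
      rw [Measure.volume_eq_prod, ← this]
      congr 1 with z
      rw [← conj_stepKernel_neg _ _ (z.1 - z.2)]
      simp only [Prod.fst_swap, Prod.snd_swap, map_mul, Complex.conj_conj, neg_sub]
      ring
    have hcont := continuous_stepKernel hε t
    have hbd : ∀ z : ℝ × ℝ, ‖stepKernel (1 / (n + 1)) t (z.1 - z.2)‖ ≤ (n + 1) / (2 * Real.pi) := by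
      intro z
      have h1 : (1 / ((n : ℝ) + 1)) ≤ ‖(((1 / ((n : ℝ) + 1) : ℝ)) - (z.1 - z.2 : ℝ) * Complex.I : ℂ)‖ := by
        have := Complex.abs_re_le_norm (((1 / ((n : ℝ) + 1) : ℝ)) - (z.1 - z.2 : ℝ) * Complex.I : ℂ)
        refine le_trans (le_of_eq ?_) this
        rw [Complex.sub_re, Complex.ofReal_re, Complex.re_ofReal_mul, Complex.I_re, mul_zero,
          sub_zero, abs_of_pos hε]
      rw [stepKernel, norm_div, norm_exp_ofReal_mul_I, norm_mul, norm_mul, Complex.norm_ofNat,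
        Complex.norm_real, Real.norm_eq_abs, abs_of_pos Real.pi_pos]
      have := Real.pi_pos
      rw [div_le_div_iff₀ (mul_pos (by positivity) (hε.trans_le h1)) (by positivity)]
      have h3 : 1 ≤ ((n : ℝ) + 1) * ‖(((1 / ((n : ℝ) + 1) : ℝ)) - (z.1 - z.2 : ℝ) * Complex.I : ℂ)‖ := by
        have := mul_le_mul_of_nonneg_left h1 (show (0 : ℝ) ≤ (n : ℝ) + 1 by positivity)
        rwa [mul_one_div_cancel (by positivity)] at this
      nlinarith
    have hint : ∀ α β : 𝓢(ℝ, ℂ), Integrable (fun z : ℝ × ℝ =>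
        (conj (α z.1) * β z.2) * stepKernel (1 / (n + 1)) t (z.1 - z.2)) := fun α β =>
      (integrable_conj_mul_prod α β).mul_bdd hcont.aestronglyMeasurable
        (Eventually.of_forall hbd)
    rw [e2, e1, ← integral_sub (hint ψ χ) (hint χ ψ), ← integral_const_mul]
    congr 1 with z
    have h4 : ((z.1 - z.2 : ℝ) : ℂ) * D z = H z.1 - H z.2 := by
      exact_mod_cast hDH z.1 z.2
    rw [hχ, hχ, map_mul, Complex.conj_ofReal]
    linear_combination (-Complex.I * (conj (ψ z.1) * ψ z.2) *
      stepKernel (1 / (n + 1)) t (z.1 - z.2)) * (-h4)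
  have hlim2 : Tendsto (fun n => Complex.I * (S n - conj (S n))) atTop
      (𝓝 (∫ z : ℝ × ℝ, (conj (ψ z.1) * ψ z.2) *
        ((1 / (2 * Real.pi) * Complex.exp (t * (z.1 - z.2 : ℝ) * Complex.I)) * D z))) := by
    simp_rw [hSk]
    refine tendsto_integral_of_dominated_convergence
      (fun z => ‖conj (ψ z.1) * ψ z.2‖ * (1 / (2 * Real.pi) * L)) (fun n => ?_)
      ((integrable_conj_mul_prod ψ ψ).norm.mul_const _) (fun n => Eventually.of_forall fun z => ?_) ?_
    · have hε : (0 : ℝ) < 1 / (n + 1) := by positivity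
      have hcont := continuous_stepKernel hε t
      exact Continuous.aestronglyMeasurable (by fun_prop)
    · rw [norm_mul, norm_mul (_ * _) ((D z : ℝ) : ℂ), Complex.norm_real]
      have hε : (0 : ℝ) < 1 / (n + 1) := by positivity
      have := Real.pi_pos
      exact mul_le_mul_of_nonneg_left (mul_le_mul (norm_mul_stepKernel_le hε t _) (hDb z)
        (norm_nonneg _) (by positivity)) (norm_nonneg _)
    -- On the diagonal the regularized product is zero for every n and does not converge to the
    -- claimed limit; the diagonal is a null set.
    · filter_upwards [ae_fst_ne_snd] with z hz
      exact tendsto_const_nhds.mul ((tendsto_mul_stepKernel (sub_ne_zero.2 hz) t).mul_const _)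
  have hlim3 := (hlim1.sub ((Complex.continuous_conj.tendsto _).comp hlim1)).const_mul Complex.I
  rw [neg_two_im_eq, tendsto_nhds_unique hlim3 hlim2, ← integral_const_mul]
  congr 1 with z
  ring

theorem abs_stieltjesFunction_le {f : ℝ → ℝ} (hm : Monotone f) {M : ℝ} (hM : ∀ x, |f x| ≤ M)
    (x : ℝ) : |hm.stieltjesFunction x| ≤ M := by
  rw [hm.stieltjesFunction_eq]
  exact abs_le.2 ⟨(abs_le.1 (hM x)).1.trans (hm.le_rightLim le_rfl),
    (hm.rightLim_le (lt_add_one x)).trans (abs_le.1 (hM _)).2⟩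

theorem isFiniteMeasure_dMeasure {f : ℝ → ℝ} (hf : BddMeas f) (hm : Monotone f) :
    IsFiniteMeasure (dMeasure hm) := by
  obtain ⟨M, hM⟩ := hf.bounded
  exact hm.stieltjesFunction.isFiniteMeasure_of_forall_abs_le (abs_stieltjesFunction_le hm hM)

theorem exists_ae_eq_add_dMeasure_Iic {f : ℝ → ℝ} (hf : BddMeas f) (hm : Monotone f) :
    ∃ c : ℝ, ∀ᵐ x, f x = c + (dMeasure hm).real (Set.Iic x) := by
  obtain ⟨M, hM⟩ := hf.bounded
  have hb := abs_stieltjesFunction_le hm hM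
  have hbb : BddBelow (Set.range hm.stieltjesFunction) :=
    ⟨-M, by rintro _ ⟨x, rfl⟩; exact (abs_le.1 (hb x)).1⟩
  have hlim := tendsto_atBot_ciInf hm.stieltjesFunction.mono hbb
  refine ⟨⨅ x, hm.stieltjesFunction x, ?_⟩
  have hc : ∀ᵐ x, ContinuousAt f x := by
    rw [ae_iff]
    exact hm.countable_not_continuousAt.measure_zero volume
  filter_upwards [hc] with x hx
  rw [measureReal_def, dMeasure, StieltjesFunction.measure_Iic _ hlim,
    ENNReal.toReal_ofReal (sub_nonneg.2 (ciInf_le hbb x)), hm.stieltjesFunction_eq,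
    hx.continuousWithinAt.rightLim_eq]
  ring

theorem integrable_conj_fourier_mul (ψ χ : 𝓢(ℝ, ℂ)) :
    Integrable (fun ξ => conj (𝓕 ψ ξ) * 𝓕 χ ξ) := by
  have h1 : Integrable (fun ξ => 𝓕 χ ξ * conj (𝓕 ψ ξ)) :=
    (𝓕 χ).integrable.mul_bdd (c := SchwartzMap.seminorm ℝ 0 0 (𝓕 ψ)) (by fun_prop)
      (Eventually.of_forall fun x => by simpa using (𝓕 ψ).norm_le_seminorm ℝ x)
  simpa only [mul_comm] using h1

theorem im_integral_conj_fourier_mul {H : ℝ → ℝ} {ψ χ : 𝓢(ℝ, ℂ)} (hχ : ∀ x, χ x = H x * ψ x) :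
    (∫ ξ, conj (𝓕 ψ ξ) * 𝓕 χ ξ).im = 0 := by
  have h := SchwartzMap.integral_inner_fourier_fourier ψ χ
  simp only [RCLike.inner_apply] at h
  have h1 : ∀ x, χ x * conj (ψ x) = ((H x * ‖ψ x‖ ^ 2 : ℝ) : ℂ) := fun x => by
    rw [hχ, mul_assoc, Complex.mul_conj, Complex.normSq_eq_norm_sq]; push_cast; rfl
  simp_rw [h1, mul_comm (𝓕 χ _)] at h
  rw [h, integral_complex_ofReal, Complex.ofReal_im]

/-- Almost everywhere f is a constant plus the superposition of the steps 1_{[t,∞)} with weight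
df(t); Fubini exchanges the two integrations. -/
theorem integral_monotone_mul_eq {f : ℝ → ℝ} (hf : BddMeas f) (hm : Monotone f) {p : ℝ → ℂ}
    (hp : Integrable p) :
    ∃ c : ℝ, ∫ ξ, (f (2 * Real.pi * ξ) : ℂ) * p ξ =
      c * (∫ ξ, p ξ) + ∫ t, (∫ ξ in Set.Ioi (t / (2 * Real.pi)), p ξ) ∂(dMeasure hm) := by
  have := isFiniteMeasure_dMeasure hf hm
  obtain ⟨c, hc⟩ := exists_ae_eq_add_dMeasure_Iic hf hm
  refine ⟨c, ?_⟩
  have hq : Measure.QuasiMeasurePreserving (fun x : ℝ => (2 * Real.pi) * x) volume volume := by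
    refine ⟨measurable_const_mul _, ?_⟩
    rw [Real.map_volume_mul_left Real.two_pi_pos.ne']
    exact Measure.smul_absolutelyContinuous
  have hc' := hq.ae hc
  set e : ℝ → ℝ → ℂ := fun ξ t => (Set.Iic (2 * Real.pi * ξ)).indicator (fun _ => 1) t with he
  have hem : Measurable (Function.uncurry e) := by
    have : Function.uncurry e =
        {p : ℝ × ℝ | p.2 ≤ 2 * Real.pi * p.1}.indicator (fun _ => (1 : ℂ)) := by
      ext ⟨a, b⟩
      simp [e, Set.indicator]
    rw [this]
    exact measurable_const.indicator
      (isClosed_le continuous_snd (continuous_const.mul continuous_fst)).measurableSet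
  have he1 : ∀ ξ t, ‖e ξ t‖ ≤ 1 := fun ξ t => by
    simp only [e, Set.indicator]
    split_ifs <;> simp
  have h := integral_mul_integral_swap (μ := dMeasure hm) (b := fun _ => (1 : ℂ)) hp
    (integrable_const 1) hem.aestronglyMeasurable he1
  have h1 : ∀ ξ, ∫ t, (1 : ℂ) * e ξ t ∂(dMeasure hm) =
      ((dMeasure hm).real (Set.Iic (2 * Real.pi * ξ)) : ℂ) := fun ξ => by
    simp only [e, one_mul]
    rw [integral_indicator_const _ measurableSet_Iic]
    simp
  -- The indicator yields the closed half-line; its endpoint is Lebesgue null.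
  have h2 : ∀ t, (1 : ℂ) * ∫ ξ, p ξ * e ξ t = ∫ ξ in Set.Ioi (t / (2 * Real.pi)), p ξ := fun t => by
    rw [one_mul, ← integral_Ici_eq_integral_Ioi, ← integral_indicator measurableSet_Ici]
    congr 1 with ξ
    simp only [e, Set.indicator, Set.mem_Iic, Set.mem_Ici, div_le_iff₀ Real.two_pi_pos,
      mul_comm ξ]
    split_ifs <;> simp
  simp_rw [h1, h2] at h
  have h3 : Integrable (fun ξ => p ξ * ((dMeasure hm).real (Set.Iic (2 * Real.pi * ξ)) : ℂ)) := by
    refine hp.mul_bdd (c := (dMeasure hm).real Set.univ) ?_ (Eventually.of_forall fun ξ => ?_)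
    · have hmono : Monotone fun ξ => (dMeasure hm).real (Set.Iic (2 * Real.pi * ξ)) :=
        fun x y hxy => measureReal_mono (Set.Iic_subset_Iic.2
          (mul_le_mul_of_nonneg_left hxy Real.two_pi_pos.le))
      exact (Complex.measurable_ofReal.comp hmono.measurable).aestronglyMeasurable
    · rw [Complex.norm_real, Real.norm_eq_abs, abs_of_nonneg measureReal_nonneg]
      exact measureReal_mono (Set.subset_univ _)
  rw [← h, ← integral_const_mul, ← integral_add (hp.const_mul _) h3]
  refine integral_congr_ae ?_
  filter_upwards [hc'] with ξ hξ
  rw [hξ]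
  push_cast
  ring

/-- Integrating the formula for one step against df turns the exponentials into the characteristic
function. The additive constant of f drops out because it multiplies a real integral. -/
theorem integral_mul_commDensity_eq_kernel {f : ℝ → ℝ} (hf : BddMeas f) (hm : Monotone f)
    {H : ℝ → ℝ} {D : ℝ × ℝ → ℝ} {L : ℝ} (hD : Continuous D)
    (hDb : ∀ z, |D z| ≤ L) (hDH : ∀ x y, (x - y) * D (x, y) = H x - H y)
    {ψ χ : 𝓢(ℝ, ℂ)} (hχ : ∀ x, χ x = H x * ψ x) :
    ((∫ x, H x * commDensity hf ψ x : ℝ) : ℂ) =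
      1 / (2 * Real.pi) * ∫ z : ℝ × ℝ, (conj (ψ z.1) * ψ z.2) *
        (charFun (dMeasure hm) (z.1 - z.2) * D z) := by
  have := isFiniteMeasure_dMeasure hf hm
  have hp := integrable_conj_fourier_mul ψ χ
  obtain ⟨c, hc⟩ := integral_monotone_mul_eq hf hm hp
  set S : ℝ → ℂ := fun t => ∫ ξ in Set.Ioi (t / (2 * Real.pi)), conj (𝓕 ψ ξ) * 𝓕 χ ξ with hS
  have hΨ : Integrable (fun z : ℝ × ℝ => (conj (ψ z.1) * ψ z.2) * D z) := by
    exact (integrable_conj_mul_prod ψ ψ).mul_bdd (c := L) (by fun_prop)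
      (Eventually.of_forall fun z => by simpa using hDb z)
  have hswap := integral_mul_integral_swap (ν := dMeasure hm) (a := fun _ => (1 : ℂ))
    (integrable_const 1) hΨ
    (e := fun t z => Complex.exp (t * (z.1 - z.2 : ℝ) * Complex.I))
    (Continuous.aestronglyMeasurable (by fun_prop))
    (fun t z => (norm_exp_ofReal_mul_I t (z.1 - z.2)).le)
  have hstep : ∀ t, ((-2 * (S t).im : ℝ) : ℂ) = 1 / (2 * Real.pi) * ((1 : ℂ) * ∫ z : ℝ × ℝ,
      ((conj (ψ z.1) * ψ z.2) * D z) * Complex.exp (t * (z.1 - z.2 : ℝ) * Complex.I)) := fun t => by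
    rw [integral_step_eq_kernel hD hDb hDH hχ t, one_mul]
    congr 2 with z
    ring
  have hSint : Integrable S (dMeasure hm) := by
    have hSc : Continuous S := by
      have h1 : ∀ t, S t = (∫ ξ, conj (𝓕 ψ ξ) * 𝓕 χ ξ) -
          ∫ ξ in Set.Iic (t / (2 * Real.pi)), conj (𝓕 ψ ξ) * 𝓕 χ ξ := fun t => by
        rw [eq_sub_iff_add_eq, add_comm]
        exact intervalIntegral.integral_Iic_add_Ioi hp.integrableOn hp.integrableOn
      have h2 : Continuous fun b => ∫ ξ in Set.Iic b, conj (𝓕 ψ ξ) * 𝓕 χ ξ :=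
        continuous_iff_continuousAt.2 fun b => by
          have h3 : (fun b => ∫ ξ in Set.Iic b, conj (𝓕 ψ ξ) * 𝓕 χ ξ) = fun b =>
              (∫ ξ in Set.Iic 0, conj (𝓕 ψ ξ) * 𝓕 χ ξ) + ∫ ξ in (0 : ℝ)..b, conj (𝓕 ψ ξ) * 𝓕 χ ξ := by
            ext b
            rw [← intervalIntegral.integral_Iic_sub_Iic hp.integrableOn hp.integrableOn]
            ring
          rw [h3]
          exact (continuous_const.add
            (intervalIntegral.continuous_primitive (fun _ _ => hp.intervalIntegrable) 0)).continuousAt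
      rw [show S = _ from funext h1]
      exact continuous_const.sub (h2.comp (by fun_prop))
    refine Integrable.of_bound (hSc.aestronglyMeasurable)
      (∫ ξ, ‖conj (𝓕 ψ ξ) * 𝓕 χ ξ‖) (Eventually.of_forall fun t => ?_)
    exact (norm_integral_le_integral_norm _).trans
      (setIntegral_le_integral hp.norm (Eventually.of_forall fun _ => norm_nonneg _))
  rw [integral_mul_commDensity hf hχ, hc, Complex.add_im, Complex.im_ofReal_mul,
    im_integral_conj_fourier_mul hχ, mul_zero, zero_add]
  have him : (∫ t, S t ∂(dMeasure hm)).im = ∫ t, (S t).im ∂(dMeasure hm) :=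
    (integral_im (𝕜 := ℂ) hSint).symm
  rw [him, ← integral_const_mul, ← integral_complex_ofReal]
  simp_rw [hstep]
  rw [integral_const_mul, hswap]
  congr 2 with z
  rw [charFun_apply_real]
  have e1 : ∀ t : ℝ, (1 : ℂ) * Complex.exp (t * (z.1 - z.2 : ℝ) * Complex.I) =
      Complex.exp ((z.1 - z.2 : ℝ) * t * Complex.I) := fun t => by
    rw [one_mul, mul_comm (t : ℂ)]
  simp_rw [e1]
  ring

/-! ### Positivity of the kernel and the two-point inequality -/

theorem tendsto_integral_moll_prod {K : ℝ × ℝ → ℂ} (hK : Continuous K) (a b : ℝ) :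
    (∀ n, Integrable fun z : ℝ × ℝ => ((moll n (z.1 - a) * moll n (z.2 - b) : ℝ) : ℂ) * K z) ∧
    Tendsto (fun n => ∫ z : ℝ × ℝ, ((moll n (z.1 - a) * moll n (z.2 - b) : ℝ) : ℂ) * K z) atTop
      (𝓝 (K (a, b))) := by
  have hmc : ∀ n, Continuous (moll n) := fun n => (contDiff_moll n (m := 0)).continuous
  have hzero : ∀ n : ℕ, ∀ z : ℝ × ℝ, 1 / ((n : ℝ) + 1) ≤ dist z (a, b) →
      moll n (z.1 - a) * moll n (z.2 - b) = 0 := by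
    intro n z hz
    rw [Prod.dist_eq, Real.dist_eq, Real.dist_eq, le_max_iff] at hz
    rcases hz with hz | hz
    · rw [moll_eq_zero n hz, zero_mul]
    · rw [moll_eq_zero n hz, mul_zero]
  have hint : ∀ n, ∀ K' : ℝ × ℝ → ℂ, Continuous K' → Integrable fun z : ℝ × ℝ =>
      ((moll n (z.1 - a) * moll n (z.2 - b) : ℝ) : ℂ) * K' z := by
    intro n K' hK'
    have hc := hmc n
    refine Continuous.integrable_of_hasCompactSupport (by fun_prop) ?_
    refine HasCompactSupport.intro (isCompact_closedBall (a, b) (1 / ((n : ℝ) + 1))) fun z hz => ?_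
    rw [Metric.mem_closedBall, not_le] at hz
    rw [hzero n z hz.le]; simp
  refine ⟨fun n => hint n K hK, ?_⟩
  have hone : ∀ n, ∫ z : ℝ × ℝ, moll n (z.1 - a) * moll n (z.2 - b) = 1 := fun n => by
    rw [Measure.volume_eq_prod, integral_prod_mul (fun x => moll n (x - a)) (fun y => moll n (y - b)),
      integral_sub_right_eq_self (moll n), integral_sub_right_eq_self (moll n), integral_moll, one_mul]
  rw [Metric.tendsto_atTop]
  intro ε hε
  obtain ⟨δ, hδ, hball⟩ := Metric.continuousAt_iff.1 (hK.continuousAt (x := (a, b))) (ε / 2)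
    (by positivity)
  obtain ⟨N, hN⟩ := (Metric.tendsto_atTop.1 tendsto_one_div_succ) δ hδ
  refine ⟨N, fun n hn => ?_⟩
  have hnδ : 1 / ((n : ℝ) + 1) < δ := by
    have := hN n hn
    rwa [Real.dist_eq, sub_zero, abs_of_pos (by positivity)] at this
  have h1 : (∫ z : ℝ × ℝ, ((moll n (z.1 - a) * moll n (z.2 - b) : ℝ) : ℂ) * K z) - K (a, b) =
      ∫ z : ℝ × ℝ, ((moll n (z.1 - a) * moll n (z.2 - b) : ℝ) : ℂ) * (K z - K (a, b)) := by
    simp_rw [mul_sub]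
    rw [integral_sub (hint n K hK) (hint n _ continuous_const), integral_mul_const,
      integral_complex_ofReal, hone]
    simp
  rw [dist_eq_norm, h1]
  have hρ : Integrable fun z : ℝ × ℝ => moll n (z.1 - a) * moll n (z.2 - b) := by
    have := (hint n (fun _ => 1) continuous_const).re
    simpa using this
  have h2 : ‖∫ z : ℝ × ℝ, ((moll n (z.1 - a) * moll n (z.2 - b) : ℝ) : ℂ) * (K z - K (a, b))‖ ≤
      ∫ z : ℝ × ℝ, (moll n (z.1 - a) * moll n (z.2 - b)) * (ε / 2) := by
    refine norm_integral_le_of_norm_le (hρ.mul_const _) (Eventually.of_forall fun z => ?_)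
    have h0 : 0 ≤ moll n (z.1 - a) * moll n (z.2 - b) :=
      mul_nonneg (moll_nonneg _ _) (moll_nonneg _ _)
    rw [norm_mul, Complex.norm_real, Real.norm_eq_abs, abs_of_nonneg h0]
    by_cases hz : 1 / ((n : ℝ) + 1) ≤ dist z (a, b)
    · rw [hzero n z hz]; simp
    · have := hball ((not_le.1 hz).trans hnδ)
      rw [dist_eq_norm] at this
      exact mul_le_mul_of_nonneg_left this.le h0
  rw [integral_mul_const, hone] at h2
  linarith

/-- A continuous divided difference of `H`, extended by `H'` on the diagonal. -/
noncomputable def dividedDiff (H : ℝ → ℝ) (z : ℝ × ℝ) : ℝ :=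
  ∫ θ in (0 : ℝ)..1, deriv H (z.2 + θ * (z.1 - z.2))

theorem continuous_dividedDiff {H : ℝ → ℝ} (hH : ContDiff ℝ 1 H) : Continuous (dividedDiff H) := by
  have : Continuous (deriv H) := hH.continuous_deriv le_rfl
  exact intervalIntegral.continuous_parametric_intervalIntegral_of_continuous' (by fun_prop) 0 1

theorem sub_mul_dividedDiff {H : ℝ → ℝ} (hH : ContDiff ℝ 1 H) (x y : ℝ) :
    (x - y) * dividedDiff H (x, y) = H x - H y := by
  have hc : Continuous (deriv H) := hH.continuous_deriv le_rfl
  rw [dividedDiff, ← intervalIntegral.integral_const_mul]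
  have h := intervalIntegral.integral_eq_sub_of_hasDerivAt (a := 0) (b := 1)
    (f := fun θ : ℝ => H (y + θ * (x - y))) (f' := fun θ => (x - y) * deriv H (y + θ * (x - y)))
    (fun θ _ => ?_) (Continuous.intervalIntegrable (by fun_prop) _ _)
  · rw [h]; simp
  · have h1 : HasDerivAt (fun θ : ℝ => y + θ * (x - y)) (x - y) θ := by
      simpa using ((hasDerivAt_id θ).mul_const (x - y)).const_add y
    have h2 := (hH.differentiable (by simp) (y + θ * (x - y))).hasDerivAt
    rw [mul_comm]
    exact h2.comp θ h1

theorem dividedDiff_self (H : ℝ → ℝ) (x : ℝ) : dividedDiff H (x, x) = deriv H x := by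
  simp [dividedDiff]

theorem abs_dividedDiff_le {H : ℝ → ℝ} {L : ℝ} (hL : ∀ x, |deriv H x| ≤ L) (z : ℝ × ℝ) :
    |dividedDiff H z| ≤ L := by
  have := intervalIntegral.norm_integral_le_of_norm_le_const (a := 0) (b := 1)
    (f := fun θ : ℝ => deriv H (z.2 + θ * (z.1 - z.2))) (C := L) (fun θ _ => hL _)
  simpa [dividedDiff] using this

theorem dividedDiff_swap {H : ℝ → ℝ} (hH : ContDiff ℝ 1 H) (x y : ℝ) :
    dividedDiff H (y, x) = dividedDiff H (x, y) := by
  by_cases h : x = y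
  · rw [h]
  · have h1 := sub_mul_dividedDiff hH x y
    have h2 := sub_mul_dividedDiff hH y x
    have : x - y ≠ 0 := sub_ne_zero.2 h
    apply mul_left_cancel₀ this
    linarith

theorem integral_add_four {X : Type*} [MeasurableSpace X] {μ : Measure X} {f₁ f₂ f₃ f₄ : X → ℂ}
    (h₁ : Integrable f₁ μ) (h₂ : Integrable f₂ μ) (h₃ : Integrable f₃ μ) (h₄ : Integrable f₄ μ) :
    ∫ x, (f₁ x + f₂ x + f₃ x + f₄ x) ∂μ =
      ∫ x, f₁ x ∂μ + ∫ x, f₂ x ∂μ + ∫ x, f₃ x ∂μ + ∫ x, f₄ x ∂μ := by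
  rw [integral_add (f := fun x => f₁ x + f₂ x + f₃ x) ((h₁.add h₂).add h₃) h₄,
    integral_add (f := fun x => f₁ x + f₂ x) (h₁.add h₂) h₃, integral_add h₁ h₂]

/-- The form is nonnegative on Schwartz functions concentrating at a and b with amplitudes α and β,
and the kernel is continuous, so its 2×2 matrix at a and b is positive semidefinite. -/
theorem kernel_form_nonneg {f g : ℝ → ℝ} {hf : BddMeas f} {hg : BddMeas g}
    (h : (iComm hf hg).IsPositive) (hm : Monotone f) (n : ℕ) (a b : ℝ) (α β : ℂ) :
    0 ≤ (conj α * α * (charFun (dMeasure hm) (a - a) * dividedDiff (mollify (moll n) g) (a, a)) +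
      conj α * β * (charFun (dMeasure hm) (a - b) * dividedDiff (mollify (moll n) g) (a, b)) +
      conj β * α * (charFun (dMeasure hm) (b - a) * dividedDiff (mollify (moll n) g) (b, a)) +
      conj β * β *
        (charFun (dMeasure hm) (b - b) * dividedDiff (mollify (moll n) g) (b, b))).re := by
  have := isFiniteMeasure_dMeasure hf hm
  set H := mollify (moll n) g with hH
  have hHc : ContDiff ℝ ((⊤ : ℕ∞) : WithTop ℕ∞) H :=
    contDiff_mollify (contDiff_moll n) (hasCompactSupport_moll n) hg
  have hH1 : ContDiff ℝ 1 H := hHc.of_le (by simp)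
  obtain ⟨M, hM⟩ := hg.bounded
  have hder : ∀ x, deriv H x = mollify (deriv (moll n)) g x := fun x =>
    (hasDerivAt_mollify (contDiff_moll n (m := 1)) (hasCompactSupport_moll n) hg x).deriv
  have hwi : Integrable (deriv (moll n)) :=
    ((contDiff_moll n (m := 1)).continuous_deriv le_rfl).integrable_of_hasCompactSupport
      (hasCompactSupport_moll n).deriv
  have hL : ∀ x, |deriv H x| ≤ M * ∫ s, |deriv (moll n) s| := fun x => by
    rw [hder]; exact abs_mollify_le hwi hM x
  set D := dividedDiff H
  have hDc : Continuous D := continuous_dividedDiff hH1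
  set K : ℝ × ℝ → ℂ := fun z => charFun (dMeasure hm) (z.1 - z.2) * D z with hK
  have hKc : Continuous K := by
    have h1 : Continuous (charFun (dMeasure hm)) := continuous_charFun
    fun_prop
  set I : ℝ → ℝ → ℕ → ℂ := fun x y j =>
    ∫ z : ℝ × ℝ, ((moll j (z.1 - x) * moll j (z.2 - y) : ℝ) : ℂ) * K z with hI
  have hIlim : ∀ x y, Tendsto (I x y) atTop (𝓝 (K (x, y))) := fun x y =>
    (tendsto_integral_moll_prod hKc x y).2
  have hIint := fun x y => (tendsto_integral_moll_prod hKc x y).1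
  have hlim := ((((hIlim a a).const_mul (conj α * α)).add
    ((hIlim a b).const_mul (conj α * β))).add ((hIlim b a).const_mul (conj β * α))).add
    ((hIlim b b).const_mul (conj β * β))
  refine ge_of_tendsto' ((Complex.continuous_re.tendsto _).comp hlim) fun j => ?_
  -- A smooth approximation of α δ_a + β δ_b; its index j is independent of the index n of the
  -- mollified function.
  set u : ℝ → ℂ := fun x => α * moll j (x - a) + β * moll j (x - b) with hu
  have hshift : ∀ c, ContDiff ℝ ((⊤ : ℕ∞) : WithTop ℕ∞) (fun x => (moll j (x - c) : ℂ)) := fun c =>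
    Complex.ofRealCLM.contDiff.comp ((contDiff_moll j).comp (contDiff_id.sub contDiff_const))
  have hshifts : ∀ c, HasCompactSupport (fun x => (moll j (x - c) : ℂ)) := fun c =>
    ((hasCompactSupport_moll j).comp_homeomorph (Homeomorph.subRight c)).comp_left
      (g := fun x : ℝ => (x : ℂ)) (by simp)
  have huc : ContDiff ℝ ((⊤ : ℕ∞) : WithTop ℕ∞) u :=
    (contDiff_const.mul (hshift a)).add (contDiff_const.mul (hshift b))
  have hus : HasCompactSupport u := (hshifts a).mul_left.add (hshifts b).mul_left
  have hvc : ContDiff ℝ ((⊤ : ℕ∞) : WithTop ℕ∞) (fun x => (H x : ℂ) * u x) :=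
    (Complex.ofRealCLM.contDiff.comp hHc).mul huc
  have hvs : HasCompactSupport (fun x => (H x : ℂ) * u x) := hus.mul_left
  have hker := integral_mul_commDensity_eq_kernel hf hm hDc (abs_dividedDiff_le hL)
    (sub_mul_dividedDiff hH1) (ψ := hus.toSchwartzMap huc) (χ := hvs.toSchwartzMap hvc)
    (fun x => rfl)
  have hnn := integral_mollify_mul_commDensity_nonneg h (integrable_moll n) (moll_nonneg n)
    (hus.toSchwartzMap huc)
  simp only [HasCompactSupport.toSchwartzMap_toFun] at hker
  have hexp : ∫ z : ℝ × ℝ, (conj (u z.1) * u z.2) * K z =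
      conj α * α * I a a j + conj α * β * I a b j + conj β * α * I b a j + conj β * β * I b b j := by
    simp only [hI]
    have i1 := (hIint a a j).const_mul (conj α * α)
    have i2 := (hIint a b j).const_mul (conj α * β)
    have i3 := (hIint b a j).const_mul (conj β * α)
    have i4 := (hIint b b j).const_mul (conj β * β)
    rw [← integral_const_mul, ← integral_const_mul, ← integral_const_mul, ← integral_const_mul,
      ← integral_add_four i1 i2 i3 i4]
    refine integral_congr_ae (Eventually.of_forall fun z => ?_)
    simp only [hu, map_add, map_mul, Complex.conj_ofReal]
    push_cast
    ring
  rw [← hH] at hnn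
  simp only [Function.comp_apply]
  rw [← hexp]
  have h5 : (∫ z : ℝ × ℝ, (conj (u z.1) * u z.2) * K z) =
      ((2 * Real.pi * ∫ x, H x * commDensity hf (hus.toSchwartzMap huc) x : ℝ) : ℂ) := by
    push_cast
    rw [hker, ← mul_assoc, mul_one_div_cancel, one_mul]
    simp [Real.pi_ne_zero]
  rw [h5, Complex.ofReal_re]
  have := Real.pi_pos
  positivity

theorem mul_deriv_mollify_nonneg {f g : ℝ → ℝ} {hf : BddMeas f} {hg : BddMeas g}
    (h : (iComm hf hg).IsPositive) (hm : Monotone f) (n : ℕ) (x : ℝ) :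
    0 ≤ (dMeasure hm).real Set.univ * deriv (mollify (moll n) g) x := by
  have h1 := kernel_form_nonneg h hm n x x 1 0
  simpa [charFun_zero, dividedDiff_self] using h1

/-- This is the determinant of the positive semidefinite 2×2 matrix: the squared off-diagonal entry
is at most the product of the diagonal entries. -/
theorem two_point_inequality {f g : ℝ → ℝ} {hf : BddMeas f} {hg : BddMeas g}
    (h : (iComm hf hg).IsPositive) (hm : Monotone f) (n : ℕ) (x y : ℝ) :
    ‖charFun (dMeasure hm) (x - y)‖ ^ 2 * (mollify (moll n) g x - mollify (moll n) g y) ^ 2 ≤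
      ((dMeasure hm).real Set.univ * (x - y)) ^ 2 *
        (deriv (mollify (moll n) g) x * deriv (mollify (moll n) g) y) := by
  set H := mollify (moll n) g with hH
  have hH1 : ContDiff ℝ 1 H :=
    contDiff_mollify (n := 1) (contDiff_moll n) (hasCompactSupport_moll n) hg
  set z : ℂ := charFun (dMeasure hm) (x - y) * dividedDiff H (x, y) with hz
  set A := (dMeasure hm).real Set.univ * deriv H x with hA
  set B := (dMeasure hm).real Set.univ * deriv H y with hB
  have hA0 : 0 ≤ A := mul_deriv_mollify_nonneg h hm n x
  have hB0 : 0 ≤ B := mul_deriv_mollify_nonneg h hm n y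
  have hzz : charFun (dMeasure hm) (y - x) * dividedDiff H (y, x) = conj z := by
    rw [hz, dividedDiff_swap hH1, map_mul, Complex.conj_ofReal, ← charFun_neg, neg_sub]
  -- The vector (s, -conj z) aligns the phase of the off-diagonal entry, leaving a real quadratic in
  -- s whose discriminant gives ‖z‖⁴ ≤ A B ‖z‖².
  have hq : ∀ s : ℝ, 0 ≤ A * (s * s) + (-2 * ‖z‖ ^ 2) * s + ‖z‖ ^ 2 * B := by
    intro s
    have h1 := kernel_form_nonneg h hm n x y s (-conj z)
    rw [← hH, ← hz, hzz, sub_self, sub_self, charFun_zero, dividedDiff_self, dividedDiff_self] at h1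
    have e : conj (s : ℂ) * s * (((dMeasure hm).real Set.univ : ℂ) * ((deriv H x : ℝ) : ℂ)) +
        conj (s : ℂ) * -conj z * z + conj (-conj z) * s * conj z +
        conj (-conj z) * -conj z * (((dMeasure hm).real Set.univ : ℂ) * ((deriv H y : ℝ) : ℂ)) =
        ((A * (s * s) + (-2 * ‖z‖ ^ 2) * s + ‖z‖ ^ 2 * B : ℝ) : ℂ) := by
      have hn : z * conj z = (‖z‖ ^ 2 : ℝ) := by
        rw [Complex.mul_conj, Complex.normSq_eq_norm_sq]
      rw [Complex.conj_ofReal, map_neg, Complex.conj_conj, hA, hB]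
      push_cast at hn ⊢
      linear_combination (-2 * (s : ℂ) +
        ((dMeasure hm).real Set.univ : ℂ) * ((deriv H y : ℝ) : ℂ)) * hn
    rw [e, Complex.ofReal_re] at h1
    exact h1
  have hd := discrim_le_zero hq
  rw [discrim] at hd
  have hle : ‖z‖ ^ 2 ≤ A * B := by
    by_cases hz0 : ‖z‖ ^ 2 = 0
    · rw [hz0]; positivity
    · have : 0 < ‖z‖ ^ 2 := lt_of_le_of_ne (by positivity) (Ne.symm hz0)
      nlinarith
  have h3 : ‖z‖ ^ 2 = ‖charFun (dMeasure hm) (x - y)‖ ^ 2 * dividedDiff H (x, y) ^ 2 := by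
    rw [hz, norm_mul, Complex.norm_real, mul_pow, Real.norm_eq_abs, sq_abs]
  rw [← sub_mul_dividedDiff hH1 x y]
  rw [h3] at hle
  have := mul_le_mul_of_nonneg_left hle (sq_nonneg (x - y))
  simp only [hA, hB] at this
  linarith

/-! ### Null sets, signs and constants -/

theorem opQ_congr {f g : ℝ → ℝ} (hf : BddMeas f) (hg : BddMeas g) (h : f =ᵐ[volume] g) :
    opQ hf = opQ hg := by
  ext1 ψ
  refine Lp.ext ?_
  filter_upwards [opQ_apply_ae hf ψ, opQ_apply_ae hg ψ, h] with x h1 h2 h3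
  rw [h1, h2, h3]

theorem ae_comp_mul_left {p : ℝ → Prop} (h : ∀ᵐ x, p x) {c : ℝ} (hc : c ≠ 0) :
    ∀ᵐ x, p (c * x) := by
  have hq : Measure.QuasiMeasurePreserving (fun x : ℝ => c * x) volume volume := by
    refine ⟨measurable_const_mul _, ?_⟩
    rw [Real.map_volume_mul_left hc]
    exact Measure.smul_absolutelyContinuous
  exact hq.ae h

theorem opP_congr {f g : ℝ → ℝ} (hf : BddMeas f) (hg : BddMeas g) (h : f =ᵐ[volume] g) :
    opP hf = opP hg := by
  rw [opP, opP, opQ_congr (hf.comp_mul_left Real.two_pi_pos.ne')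
    (hg.comp_mul_left Real.two_pi_pos.ne') (ae_comp_mul_left h Real.two_pi_pos.ne')]

theorem iComm_congr {f f' g g' : ℝ → ℝ} (hf : BddMeas f) (hf' : BddMeas f') (hg : BddMeas g)
    (hg' : BddMeas g') (h : f =ᵐ[volume] f') (h' : g =ᵐ[volume] g') :
    iComm hf hg = iComm hf' hg' := by
  rw [iComm, iComm, opP_congr hf hf' h, opQ_congr hg hg' h']

theorem opQ_neg {f : ℝ → ℝ} (hf : BddMeas f) : opQ hf.neg = -opQ hf := by
  ext1 ψ
  refine Lp.ext ?_
  filter_upwards [opQ_apply_ae hf.neg ψ, opQ_apply_ae hf ψ, Lp.coeFn_neg (opQ hf ψ)] with x h1 h2 h3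
  rw [h1, neg_apply, h3, Pi.neg_apply, h2]
  push_cast; ring

theorem opP_neg {f : ℝ → ℝ} (hf : BddMeas f) : opP hf.neg = -opP hf := by
  have : opQ (hf.neg.comp_mul_left Real.two_pi_pos.ne') =
      -opQ (hf.comp_mul_left Real.two_pi_pos.ne') := opQ_neg _
  rw [opP, opP, this]
  ext1 ψ
  simp

theorem iComm_neg_neg {f g : ℝ → ℝ} (hf : BddMeas f) (hg : BddMeas g) :
    iComm hf.neg hg.neg = iComm hf hg := by
  rw [iComm, iComm, opP_neg hf, opQ_neg hg]
  ext1 ψ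
  simp

theorem opQ_eq_smul {f : ℝ → ℝ} (hf : BddMeas f) {c : ℝ} (h : ∀ᵐ x, f x = c) (ψ : L2R) :
    opQ hf ψ = (c : ℂ) • ψ := by
  refine Lp.ext ?_
  filter_upwards [opQ_apply_ae hf ψ, Lp.coeFn_smul (c : ℂ) ψ, h] with x h1 h2 h3
  rw [h1, h2, h3, Pi.smul_apply, smul_eq_mul]

theorem opP_eq_smul {f : ℝ → ℝ} (hf : BddMeas f) {c : ℝ} (h : ∀ᵐ x, f x = c) (ψ : L2R) :
    opP hf ψ = (c : ℂ) • ψ := by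
  change fourierL2.symm (opQ (hf.comp_mul_left Real.two_pi_pos.ne') (fourierL2 ψ)) = _
  rw [opQ_eq_smul _ (ae_comp_mul_left h Real.two_pi_pos.ne'), map_smul,
    LinearIsometryEquiv.symm_apply_apply]

theorem iComm_eq_zero_of_left_const {f g : ℝ → ℝ} (hf : BddMeas f) (hg : BddMeas g) {c : ℝ}
    (h : ∀ᵐ x, f x = c) : iComm hf hg = 0 := by
  ext1 ψ
  change Complex.I • (opP hf (opQ hg ψ) - opQ hg (opP hf ψ)) = 0
  rw [opP_eq_smul hf h, opP_eq_smul hf h, map_smul, sub_self, smul_zero]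

theorem iComm_eq_zero_of_right_const {f g : ℝ → ℝ} (hf : BddMeas f) (hg : BddMeas g) {c : ℝ}
    (h : ∀ᵐ x, g x = c) : iComm hf hg = 0 := by
  ext1 ψ
  change Complex.I • (opP hf (opQ hg ψ) - opQ hg (opP hf ψ)) = 0
  rw [opQ_eq_smul hg h, opQ_eq_smul hg h, map_smul, sub_self, smul_zero]

theorem dMeasure_univ_pos {f g : ℝ → ℝ} {hf : BddMeas f} {hg : BddMeas g} (hm : Monotone f)
    (hne : iComm hf hg ≠ 0) : 0 < (dMeasure hm).real Set.univ := by
  have := isFiniteMeasure_dMeasure hf hm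
  refine lt_of_le_of_ne measureReal_nonneg fun h0 => hne ?_
  obtain ⟨c, hc⟩ := exists_ae_eq_add_dMeasure_Iic hf hm
  refine iComm_eq_zero_of_left_const hf hg (c := c) ?_
  filter_upwards [hc] with x hx
  have : (dMeasure hm).real (Set.Iic x) ≤ 0 := h0 ▸ measureReal_mono (Set.subset_univ _)
  rw [hx, le_antisymm this measureReal_nonneg, add_zero]

theorem deriv_mollify_nonneg {f g : ℝ → ℝ} {hf : BddMeas f} {hg : BddMeas g}
    (h : (iComm hf hg).IsPositive) (hm : Monotone f) (hμ : 0 < (dMeasure hm).real Set.univ)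
    (n : ℕ) (x : ℝ) : 0 ≤ deriv (mollify (moll n) g) x :=
  nonneg_of_mul_nonneg_right (mul_deriv_mollify_nonneg h hm n x) hμ

theorem differentiable_mollify_moll {g : ℝ → ℝ} (hg : BddMeas g) (n : ℕ) :
    Differentiable ℝ (mollify (moll n) g) :=
  (contDiff_mollify (n := 1) (contDiff_moll n) (hasCompactSupport_moll n) hg).differentiable
    (by simp)

theorem monotone_mollify {f g : ℝ → ℝ} {hf : BddMeas f} {hg : BddMeas g}
    (h : (iComm hf hg).IsPositive) (hm : Monotone f) (hμ : 0 < (dMeasure hm).real Set.univ)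
    (n : ℕ) : Monotone (mollify (moll n) g) :=
  monotone_of_deriv_nonneg (differentiable_mollify_moll hg n) (deriv_mollify_nonneg h hm hμ n)

/-! ### Continuity of both functions -/

/-- The square root of the two-point inequality for the pair (y+u, y), with the geometric mean of
the derivatives replaced by the arithmetic mean, is integrated over y in [a, a+r]. No derivative
remains, so the estimate is usable at every scale. -/
theorem integrated_two_point {f g : ℝ → ℝ} {hf : BddMeas f} {hg : BddMeas g}
    (h : (iComm hf hg).IsPositive) (hm : Monotone f) (hμ : 0 < (dMeasure hm).real Set.univ)
    (n : ℕ) (a : ℝ) {r u : ℝ} (hr : 0 < r) (hru : r < u) :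
    ‖charFun (dMeasure hm) u‖ * (mollify (moll n) g (a + u) - mollify (moll n) g (a + r)) * r ≤
      (dMeasure hm).real Set.univ * u / 2 *
        ((mollify (moll n) g (a + r + u) - mollify (moll n) g (a + u)) +
          (mollify (moll n) g (a + r) - mollify (moll n) g a)) := by
  set H := mollify (moll n) g with hH
  set m := (dMeasure hm).real Set.univ
  have hd : Differentiable ℝ H := differentiable_mollify_moll hg n
  have hmono : Monotone H := monotone_mollify h hm hμ n
  have hu : 0 < u := hr.trans hru
  have hder : ∀ y, HasDerivAt (fun y => m * u / 2 * (H (y + u) + H y))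
      (m * u / 2 * (deriv H (y + u) + deriv H y)) y := fun y =>
    (((hd (y + u)).hasDerivAt.comp_add_const y u).add (hd y).hasDerivAt).const_mul _
  have key := (convex_Icc a (a + r)).mul_sub_le_image_sub_of_le_deriv
    (f := fun y => m * u / 2 * (H (y + u) + H y))
    (C := ‖charFun (dMeasure hm) u‖ * (H (a + u) - H (a + r)))
    (fun y _ => (hder y).continuousAt.continuousWithinAt)
    (fun y _ => (hder y).differentiableAt.differentiableWithinAt) (fun y hy => by
      rw [interior_Icc] at hy
      rw [(hder y).deriv]
      have h2 := two_point_inequality h hm n (y + u) y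
      rw [add_sub_cancel_left, ← hH] at h2
      have p1 : 0 ≤ deriv H (y + u) := deriv_mollify_nonneg h hm hμ n _
      have p2 : 0 ≤ deriv H y := deriv_mollify_nonneg h hm hμ n _
      -- By monotonicity the increment over [y, y+u] contains the one over [a+r, a+u], which does
      -- not depend on y.
      have p3 : H (a + u) - H (a + r) ≤ H (y + u) - H y :=
        sub_le_sub (hmono (by linarith [hy.1])) (hmono hy.2.le)
      refine (mul_le_mul_of_nonneg_left p3 (norm_nonneg _)).trans ?_
      refine le_of_sq_le_sq ?_ (by positivity)
      have p4 : deriv H (y + u) * deriv H y ≤ ((deriv H (y + u) + deriv H y) / 2) ^ 2 := by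
        nlinarith [sq_nonneg (deriv H (y + u) - deriv H y)]
      have p5 := mul_le_mul_of_nonneg_left p4 (sq_nonneg (m * u))
      rw [mul_pow]
      refine h2.trans (p5.trans (le_of_eq ?_))
      ring)
    a (by simp [hr.le]) (a + r) (by simp [hr.le]) (by linarith)
  have e : a + r - a = r := by ring
  rw [e] at key
  linarith

theorem le_mollify_of_monotone {g : ℝ → ℝ} (hg : BddMeas g) (hm : Monotone g) (n : ℕ) (x : ℝ) :
    g (x - 1 / (n + 1)) ≤ mollify (moll n) g x ∧ mollify (moll n) g x ≤ g (x + 1 / (n + 1)) := by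
  have hi := integrable_mollify (integrable_moll n) hg x
  have e : ∀ c : ℝ, ∫ s, moll n s * c = c := fun c => by
    rw [integral_mul_const, integral_moll, one_mul]
  have hs : ∀ s, moll n s ≠ 0 → |s| ≤ 1 / (n + 1) := fun s hs => by
    by_contra hc
    exact hs (moll_eq_zero n (not_le.1 hc).le)
  constructor
  · rw [← e (g (x - 1 / (n + 1)))]
    refine integral_mono ((integrable_moll n).mul_const _) hi fun s => ?_
    by_cases h0 : moll n s = 0
    · simp [h0]
    · exact mul_le_mul_of_nonneg_left (hm (by linarith [(abs_le.1 (hs s h0)).2])) (moll_nonneg n s)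
  · rw [← e (g (x + 1 / (n + 1)))]
    refine integral_mono hi ((integrable_moll n).mul_const _) fun s => ?_
    by_cases h0 : moll n s = 0
    · simp [h0]
    · exact mul_le_mul_of_nonneg_left (hm (by linarith [(abs_le.1 (hs s h0)).1])) (moll_nonneg n s)

/-- At scale r the increment across x is controlled by increments on either side of x. As r → 0 the
latter vanish and the former tends to the jump, with φ(3r) → m > 0. -/
theorem continuous_of_monotone_right {f g : ℝ → ℝ} {hf : BddMeas f} {hg : BddMeas g}
    (h : (iComm hf hg).IsPositive) (hm : Monotone f) (hμ : 0 < (dMeasure hm).real Set.univ)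
    (hgm : Monotone g) : Continuous g := by
  have := isFiniteMeasure_dMeasure hf hm
  set m := (dMeasure hm).real Set.univ
  refine continuous_iff_continuousAt.2 fun x => hgm.continuousAt_iff_leftLim_eq_rightLim.2 ?_
  have hineq : ∀ r : ℝ, 0 < r → ‖charFun (dMeasure hm) (3 * r)‖ * (g (x + r / 2) - g (x - r / 2)) ≤
      3 * m / 2 * ((g (x + 5 * r / 2) - g (x + r / 2)) + (g (x - r / 2) - g (x - 5 * r / 2))) := by
    intro r hr
    -- The estimate is used at x ± r and x ± 2r. A mollifier of radius below r/2 lets g at x ± r/2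
    -- and x ± 5r/2 bracket the mollified values.
    obtain ⟨n, hn⟩ := exists_nat_one_div_lt (show 0 < r / 2 by positivity)
    have h1 := integrated_two_point h hm hμ n (x - 2 * r) (r := r) (u := 3 * r) hr (by linarith)
    rw [show x - 2 * r + 3 * r = x + r by ring, show x - 2 * r + r = x - r by ring,
      show x - r + 3 * r = x + 2 * r by ring] at h1
    have b1 := le_mollify_of_monotone hg hgm n (x + r)
    have b2 := le_mollify_of_monotone hg hgm n (x - r)
    have b3 := le_mollify_of_monotone hg hgm n (x + 2 * r)
    have b4 := le_mollify_of_monotone hg hgm n (x - 2 * r)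
    have c1 : g (x + r / 2) ≤ g (x + r - 1 / (n + 1)) := hgm (by linarith)
    have c2 : g (x - r + 1 / (n + 1)) ≤ g (x - r / 2) := hgm (by linarith)
    have c3 : g (x + 2 * r + 1 / (n + 1)) ≤ g (x + 5 * r / 2) := hgm (by linarith)
    have c4 : g (x - 5 * r / 2) ≤ g (x - 2 * r - 1 / (n + 1)) := hgm (by linarith)
    have d1 : ‖charFun (dMeasure hm) (3 * r)‖ * (g (x + r / 2) - g (x - r / 2)) ≤
        ‖charFun (dMeasure hm) (3 * r)‖ *
          (mollify (moll n) g (x + r) - mollify (moll n) g (x - r)) :=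
      mul_le_mul_of_nonneg_left (by linarith) (norm_nonneg _)
    have d2 : 3 * m / 2 * ((mollify (moll n) g (x + 2 * r) - mollify (moll n) g (x + r)) +
        (mollify (moll n) g (x - r) - mollify (moll n) g (x - 2 * r))) ≤
        3 * m / 2 * ((g (x + 5 * r / 2) - g (x + r / 2)) + (g (x - r / 2) - g (x - 5 * r / 2))) :=
      mul_le_mul_of_nonneg_left (by linarith) (by positivity)
    refine d1.trans (le_trans ?_ d2)
    refine le_of_mul_le_mul_right ?_ hr
    refine h1.trans (le_of_eq ?_)
    ring
  have hR : ∀ c : ℝ, 0 < c → Tendsto (fun r : ℝ => g (x + c * r)) (𝓝[>] 0)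
      (𝓝 (Function.rightLim g x)) := fun c hc => by
    refine (hgm.tendsto_rightLim x).comp (tendsto_nhdsWithin_iff.2 ⟨?_, ?_⟩)
    · have : Continuous fun r : ℝ => x + c * r := by fun_prop
      have h2 := this.tendsto 0
      simp only [mul_zero, add_zero] at h2
      exact h2.mono_left nhdsWithin_le_nhds
    · filter_upwards [self_mem_nhdsWithin] with r hr
      have := mul_pos hc hr
      simp only [Set.mem_Ioi]; linarith
  have hL : ∀ c : ℝ, 0 < c → Tendsto (fun r : ℝ => g (x - c * r)) (𝓝[>] 0)
      (𝓝 (Function.leftLim g x)) := fun c hc => by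
    refine (hgm.tendsto_leftLim x).comp (tendsto_nhdsWithin_iff.2 ⟨?_, ?_⟩)
    · have : Continuous fun r : ℝ => x - c * r := by fun_prop
      have h2 := this.tendsto 0
      simp only [mul_zero, sub_zero] at h2
      exact h2.mono_left nhdsWithin_le_nhds
    · filter_upwards [self_mem_nhdsWithin] with r hr
      have := mul_pos hc hr
      simp only [Set.mem_Iio]; linarith
  have hφ : Tendsto (fun r : ℝ => ‖charFun (dMeasure hm) (3 * r)‖) (𝓝[>] 0) (𝓝 m) := by
    have hc : Continuous fun r : ℝ => ‖charFun (dMeasure hm) (3 * r)‖ :=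
      (continuous_charFun.comp (continuous_const.mul continuous_id)).norm
    have h2 := hc.tendsto 0
    rw [mul_zero, charFun_zero, Complex.norm_real, Real.norm_eq_abs, abs_of_pos hμ] at h2
    exact h2.mono_left nhdsWithin_le_nhds
  have hlim1 := hφ.mul ((hR (1 / 2) (by norm_num)).sub (hL (1 / 2) (by norm_num)))
  have hlim2 := (((hR (5 / 2) (by norm_num)).sub (hR (1 / 2) (by norm_num))).add
    ((hL (1 / 2) (by norm_num)).sub (hL (5 / 2) (by norm_num)))).const_mul (3 * m / 2)
  have hle := le_of_tendsto_of_tendsto hlim1 hlim2 (by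
    filter_upwards [self_mem_nhdsWithin] with r hr
    have := hineq r hr
    rw [show 1 / 2 * r = r / 2 by ring, show 5 / 2 * r = 5 * r / 2 by ring]
    exact this)
  simp only [sub_self, add_zero, mul_zero] at hle
  have h5 : Function.leftLim g x ≤ Function.rightLim g x := hgm.leftLim_le_rightLim le_rfl
  have h6 : Function.rightLim g x - Function.leftLim g x ≤ 0 := by
    by_contra hc
    push Not at hc
    have := mul_pos hμ hc
    linarith
  linarith

/-- The same estimate at large scale: the inner increment tends to the total variation of H, which
is positive, while the outer increments tend to zero. -/
theorem tendsto_charFun_zero {f g : ℝ → ℝ} {hf : BddMeas f} {hg : BddMeas g}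
    (h : (iComm hf hg).IsPositive) (hm : Monotone f) (hμ : 0 < (dMeasure hm).real Set.univ)
    (hgm : Monotone g) {p q : ℝ} (hpq : g p < g q) :
    Tendsto (charFun (dMeasure hm)) atTop (𝓝 0) := by
  set m := (dMeasure hm).real Set.univ
  set H := mollify (moll 0) g with hH
  have hmono : Monotone H := monotone_mollify h hm hμ 0
  obtain ⟨M, hM⟩ := hg.bounded
  have hb := fun x => abs_le.1 (abs_mollify_moll_le hM 0 x)
  have hup : BddAbove (Set.range H) := ⟨M, by rintro _ ⟨x, rfl⟩; exact (hb x).2⟩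
  have hdn : BddBelow (Set.range H) := ⟨-M, by rintro _ ⟨x, rfl⟩; exact (hb x).1⟩
  have ht := tendsto_atTop_ciSup hmono hup
  have hbt := tendsto_atBot_ciInf hmono hdn
  set U := ⨆ x, H x
  set V := ⨅ x, H x
  -- `moll 0` lives on [-1, 1], hence the shifts by 1.
  have hUV : V < U := by
    have h1 := (le_mollify_of_monotone hg hgm 0 (p - 1)).2
    have h2 := (le_mollify_of_monotone hg hgm 0 (q + 1)).1
    have h3 : V ≤ H (p - 1) := ciInf_le hdn _
    have h4 : H (q + 1) ≤ U := le_ciSup hup _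
    simp only [Nat.cast_zero, zero_add, div_one, sub_add_cancel, add_sub_cancel_right] at h1 h2
    linarith
  have hineq : ∀ u : ℝ, 0 < u → ‖charFun (dMeasure hm) u‖ * (H (1 / 4 * u) - H (-(1 / 4) * u)) ≤
      m * ((H (3 / 4 * u) - H (1 / 4 * u)) + (H (-(1 / 4) * u) - H (-(3 / 4) * u))) := by
    intro u hu
    have h1 := integrated_two_point h hm hμ 0 (-(3 / 4) * u) (r := u / 2) (u := u)
      (by positivity) (by linarith)
    rw [show -(3 / 4) * u + u = 1 / 4 * u by ring, show -(3 / 4) * u + u / 2 = -(1 / 4) * u by ring,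
      show -(1 / 4) * u + u = 3 / 4 * u by ring] at h1
    refine le_of_mul_le_mul_right ?_ (show 0 < u / 2 by positivity)
    refine h1.trans (le_of_eq ?_)
    ring
  have hT : ∀ c : ℝ, 0 < c → Tendsto (fun u : ℝ => H (c * u)) atTop (𝓝 U) := fun c hc =>
    ht.comp (tendsto_id.const_mul_atTop hc)
  have hB : ∀ c : ℝ, 0 < c → Tendsto (fun u : ℝ => H (-c * u)) atTop (𝓝 V) := fun c hc =>
    hbt.comp (tendsto_id.const_mul_atTop_of_neg (neg_lt_zero.2 hc))
  have hden := (hT (1 / 4) (by norm_num)).sub (hB (1 / 4) (by norm_num))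
  have hnum := (((hT (3 / 4) (by norm_num)).sub (hT (1 / 4) (by norm_num))).add
    ((hB (1 / 4) (by norm_num)).sub (hB (3 / 4) (by norm_num)))).const_mul m
  have hquot := hnum.div hden (sub_pos.2 hUV).ne'
  simp only [sub_self, add_zero, mul_zero, zero_div] at hquot
  rw [tendsto_zero_iff_norm_tendsto_zero]
  refine tendsto_of_tendsto_of_tendsto_of_le_of_le' tendsto_const_nhds hquot
    (Eventually.of_forall fun u => norm_nonneg _) ?_
  filter_upwards [eventually_gt_atTop 0, hden.eventually (lt_mem_nhds (sub_pos.2 hUV))] with u hu hu'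
  exact (le_div_iff₀ hu').2 (hineq u hu)

theorem tendsto_cesaro_pow {z : ℂ} (hz : ‖z‖ = 1) :
    Tendsto (fun N : ℕ => ((N : ℝ)⁻¹ : ℝ) • ∑ k ∈ Finset.range N, z ^ k) atTop
      (𝓝 (if z = 1 then 1 else 0)) := by
  split_ifs with h
  · subst h
    refine tendsto_const_nhds.congr' ?_
    filter_upwards [eventually_gt_atTop 0] with N hN
    have : (N : ℂ) ≠ 0 := by exact_mod_cast hN.ne'
    simp [this]
  · have hz1 : 0 < ‖z - 1‖ := norm_pos_iff.2 (sub_ne_zero.2 h)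
    refine squeeze_zero_norm (a := fun N : ℕ => (N : ℝ)⁻¹ * (2 / ‖z - 1‖)) (fun N => ?_) ?_
    · rw [norm_smul, geom_sum_eq h, norm_div, Real.norm_of_nonneg (by positivity)]
      gcongr
      refine (norm_sub_le _ _).trans (le_of_eq ?_)
      rw [norm_pow, hz]; norm_num
    · simpa using (tendsto_inv_atTop_nhds_zero_nat (𝕜 := ℝ)).mul_const (2 / ‖z - 1‖)

/-- Wiener's averaging. Cesàro means of exp(ik(x-a)) converge boundedly to the indicator of a + 2πℤ,
while their integrals are means of values of the characteristic function at integers, up to phases,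
and tend to zero. -/
theorem measure_singleton_eq_zero_of_tendsto_charFun {μ : Measure ℝ} [IsFiniteMeasure μ]
    (h : Tendsto (charFun μ) atTop (𝓝 0)) (a : ℝ) : μ {a} = 0 := by
  set z : ℝ → ℂ := fun x => Complex.exp (((x - a : ℝ) : ℂ) * Complex.I) with hz
  have hzc : Continuous z := by fun_prop
  have hz1 : ∀ x, ‖z x‖ = 1 := fun x => Complex.norm_exp_ofReal_mul_I _
  have hint : ∀ k : ℕ, Integrable (fun x => z x ^ k) μ := fun k => by
    refine Integrable.of_bound (hzc.pow k).aestronglyMeasurable 1 (Eventually.of_forall fun x => ?_)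
    rw [norm_pow, hz1, one_pow]
  have hk : ∀ k : ℕ, ∫ x, z x ^ k ∂μ =
      Complex.exp (-((k * a : ℝ) : ℂ) * Complex.I) * charFun μ (k : ℝ) := fun k => by
    rw [charFun_apply_real, ← integral_const_mul]
    refine integral_congr_ae (Eventually.of_forall fun x => ?_)
    simp only [hz]
    rw [← Complex.exp_nat_mul, ← Complex.exp_add]
    congr 1
    push_cast; ring
  have hk0 : Tendsto (fun k : ℕ => ∫ x, z x ^ k ∂μ) atTop (𝓝 0) := by
    rw [tendsto_zero_iff_norm_tendsto_zero]
    have : Tendsto (fun k : ℕ => ‖charFun μ (k : ℝ)‖) atTop (𝓝 0) := by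
      simpa using (h.comp tendsto_natCast_atTop_atTop).norm
    refine this.congr fun k => ?_
    rw [hk, norm_mul, ← Complex.ofReal_neg, Complex.norm_exp_ofReal_mul_I, one_mul]
  have hces := hk0.cesaro_smul
  have hlim : Tendsto
      (fun N : ℕ => ∫ x, ((N : ℝ)⁻¹ : ℝ) • ∑ k ∈ Finset.range N, z x ^ k ∂μ) atTop
      (𝓝 (∫ x, (if z x = 1 then 1 else 0 : ℂ) ∂μ)) := by
    refine tendsto_integral_of_dominated_convergence (fun _ => (1 : ℝ))
      (fun N => ?_) (integrable_const _) (fun N => Eventually.of_forall fun x => ?_)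
      (Eventually.of_forall fun x => tendsto_cesaro_pow (hz1 x))
    · exact Continuous.aestronglyMeasurable (by fun_prop)
    · rw [norm_smul, Real.norm_of_nonneg (by positivity)]
      have : ‖∑ k ∈ Finset.range N, z x ^ k‖ ≤ N := by
        refine (norm_sum_le _ _).trans (le_of_eq ?_)
        simp [hz1]
      refine (mul_le_mul_of_nonneg_left this (by positivity)).trans ?_
      rcases Nat.eq_zero_or_pos N with rfl | hN
      · simp
      · rw [inv_mul_cancel₀ (by exact_mod_cast hN.ne')]
  have heq : ∀ N : ℕ, ∫ x, ((N : ℝ)⁻¹ : ℝ) • ∑ k ∈ Finset.range N, z x ^ k ∂μ =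
      ((N : ℝ)⁻¹ : ℝ) • ∑ k ∈ Finset.range N, ∫ x, z x ^ k ∂μ := fun N => by
    rw [integral_smul, integral_finsetSum _ fun k _ => hint k]
  have h0 := tendsto_nhds_unique hlim (hces.congr fun N => (heq N).symm)
  have hS : MeasurableSet {x | z x = 1} := (isClosed_eq hzc continuous_const).measurableSet
  have hind : ∫ x, (if z x = 1 then 1 else 0 : ℂ) ∂μ = (μ.real {x | z x = 1} : ℂ) := by
    have := integral_indicator_const (μ := μ) (1 : ℂ) hS
    simpa [Set.indicator_apply] using this
  rw [hind] at h0
  have h1 : μ.real {x | z x = 1} = 0 := by exact_mod_cast h0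
  rw [measureReal_eq_zero_iff] at h1
  exact measure_mono_null (by simp [hz]) h1

/-- Atoms measure the jumps of the right-continuous version, and its left limits do not exceed those
of f, so without atoms f itself has no jump. -/
theorem continuous_of_dMeasure_singleton {f : ℝ → ℝ} (hm : Monotone f)
    (h : ∀ a, dMeasure hm {a} = 0) : Continuous f := by
  refine continuous_iff_continuousAt.2 fun a => ?_
  rw [hm.continuousAt_iff_leftLim_eq_rightLim]
  have h1 := h a
  rw [dMeasure, StieltjesFunction.measure_singleton, ENNReal.ofReal_eq_zero, sub_nonpos] at h1
  refine le_antisymm ((hm.leftLim_le le_rfl).trans (hm.le_rightLim le_rfl)) ?_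
  rw [← hm.stieltjesFunction_eq]
  refine h1.trans ?_
  have hS := hm.stieltjesFunction.mono
  refine le_of_tendsto (hS.tendsto_leftLim a) ?_
  filter_upwards [self_mem_nhdsWithin] with y hy
  rw [hm.stieltjesFunction_eq]
  exact hm.rightLim_le_leftLim hy

theorem continuous_and_exists_monotone {f g : ℝ → ℝ} {hf : BddMeas f} {hg : BddMeas g}
    (h : (iComm hf hg).IsPositive) (hne : iComm hf hg ≠ 0) (hm : Monotone f) :
    Continuous f ∧ ∃ g₁, g =ᵐ[volume] g₁ ∧ Monotone g₁ ∧ BddMeas g₁ ∧ Continuous g₁ := by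
  have hμ := dMeasure_univ_pos (hf := hf) hm hne
  obtain ⟨g₁, hg₁, ⟨M, hM⟩, hgg⟩ :=
    exists_monotone_ae_eq_of_mollify hg (monotone_mollify h hm hμ)
  have hgb : BddMeas g₁ := ⟨hg₁.measurable.aemeasurable, M, hM⟩
  have hc : iComm hf hgb = iComm hf hg := iComm_congr hf hf hgb hg .rfl hgg.symm
  have h' : (iComm hf hgb).IsPositive := hc ▸ h
  refine ⟨?_, g₁, hgg, hg₁, hgb, continuous_of_monotone_right h' hm hμ hg₁⟩
  have : ∃ p q, g₁ p < g₁ q := by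
    by_contra hcon
    push Not at hcon
    refine hne (hc ▸ iComm_eq_zero_of_right_const hf hgb (c := g₁ 0)
      (Eventually.of_forall fun x => le_antisymm (hcon _ _) (hcon _ _)))
  obtain ⟨p, q, hpq⟩ := this
  have := isFiniteMeasure_dMeasure hf hm
  exact continuous_of_dMeasure_singleton hm fun a =>
    measure_singleton_eq_zero_of_tendsto_charFun (tendsto_charFun_zero h' hm hμ hg₁ hpq) a

theorem exists_continuous_monotone_or_antitone {f g : ℝ → ℝ} {hf : BddMeas f} {hg : BddMeas g}
    (h : (iComm hf hg).IsPositive) (hne : iComm hf hg ≠ 0) :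
    ∃ f₁ g₁, f =ᵐ[volume] f₁ ∧ g =ᵐ[volume] g₁ ∧ Continuous f₁ ∧ Continuous g₁ ∧ BddMeas g₁ ∧
      ((Monotone f₁ ∧ Monotone g₁) ∨ (Antitone f₁ ∧ Antitone g₁)) := by
  obtain ⟨f₁, hf₁, hfb, hff⟩ := exists_monotone_or_antitone_ae_eq h hne
  rcases hf₁ with hf₁ | hf₁
  · have hc : iComm hfb hg = iComm hf hg := iComm_congr hfb hf hg hg hff.symm .rfl
    obtain ⟨hfc, g₁, hgg, hg₁, hgb, hgc⟩ :=
      continuous_and_exists_monotone (hf := hfb) (hg := hg) (hc ▸ h) (hc ▸ hne) hf₁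
    exact ⟨f₁, g₁, hff, hgg, hfc, hgc, hgb, .inl ⟨hf₁, hg₁⟩⟩
  · have hc : iComm hfb.neg hg.neg = iComm hf hg :=
      (iComm_neg_neg hfb hg).trans (iComm_congr hfb hf hg hg hff.symm .rfl)
    obtain ⟨hfc, g₁, hgg, hg₁, hgb, hgc⟩ :=
      continuous_and_exists_monotone (hf := hfb.neg) (hg := hg.neg) (hc ▸ h) (hc ▸ hne) hf₁.neg
    refine ⟨f₁, fun x => -g₁ x, hff, ?_, (continuous_congr fun x => neg_neg (f₁ x)).1 hfc.neg, hgc.neg, hgb.neg,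
      .inr ⟨hf₁, hg₁.neg⟩⟩
    filter_upwards [hgg] with x hx
    rw [← hx, neg_neg]

/-! ### The infinitesimal two-point inequality -/

theorem isLittleO_pow_succ_of_hasDerivAt {r r' : ℝ → ℝ} {n : ℕ}
    (hr : ∀ t, HasDerivAt r (r' t) t) (h0 : r 0 = 0) (h : r' =o[𝓝 0] fun t : ℝ => t ^ n) :
    r =o[𝓝 0] fun t : ℝ => t ^ (n + 1) := by
  rw [Asymptotics.isLittleO_iff] at h ⊢
  intro c hc
  obtain ⟨R, hR, hball⟩ := Metric.eventually_nhds_iff.1 (h hc)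
  refine Metric.eventually_nhds_iff.2 ⟨R / 2, by positivity, fun t ht => ?_⟩
  have ht' : |t| ≤ R / 2 := by simpa using ht.le
  have := abs_le_of_abs_deriv_le_pow (K := c) (R := R / 2) (n := n) hr h0 (fun s hs => ?_) ht'
  · simpa [abs_pow] using this
  · have := hball (y := s) (by rw [dist_zero_right, Real.norm_eq_abs]; linarith)
    simpa [abs_pow] using this

theorem hasDerivAt_comp_add {w : ℝ → ℝ} {w' x t : ℝ} (h : HasDerivAt w w' (x + t)) :
    HasDerivAt (fun t => w (x + t)) w' t := h.comp_const_add x t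

theorem hasDerivAt_comp_sub {w : ℝ → ℝ} {w' x t : ℝ} (h : HasDerivAt w w' (x - t)) :
    HasDerivAt (fun t => w (x - t)) (-w') t := h.comp_const_sub x t

theorem hasDerivAt_comp_neg {w : ℝ → ℝ} {w' x : ℝ} (h : HasDerivAt w w' (-x)) :
    HasDerivAt (fun x => w (-x)) (-w') x := by
  simpa using hasDerivAt_comp_sub (x := 0) (t := x) (by simpa using h)

theorem tendsto_div_of_isLittleO {p : ℝ → ℝ} {n : ℕ} {l : ℝ}
    (h : (fun t => p t - t ^ n * l) =o[𝓝 0] fun t : ℝ => t ^ n) :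
    Tendsto (fun t => p t / t ^ n) (𝓝[≠] 0) (𝓝 l) := by
  have h1 := (h.tendsto_div_nhds_zero.mono_left (nhdsWithin_le_nhds (s := {0}ᶜ))).add_const l
  rw [zero_add] at h1
  refine h1.congr' ?_
  filter_upwards [self_mem_nhdsWithin] with t ht
  have : t ^ n ≠ 0 := pow_ne_zero _ ht
  field_simp
  ring

/-- The infinitesimal form of the two-point inequality. -/
theorem three_mul_sq_deriv_le {H u u' u'' : ℝ → ℝ} {s : ℝ}
    (hH : ∀ x, HasDerivAt H (u x) x) (hu : ∀ x, HasDerivAt u (u' x) x)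
    (hu' : ∀ x, HasDerivAt u' (u'' x) x)
    (h2 : ∀ x y, (1 - s * (x - y) ^ 2) * (H x - H y) ^ 2 ≤ (x - y) ^ 2 * (u x * u y)) (x : ℝ) :
    3 * u' x ^ 2 ≤ 2 * u x * u'' x + 12 * s * u x ^ 2 := by
  have hd : (fun t => (u (x + t) - u (x - t)) - t ^ 1 * (2 * u' x)) =o[𝓝 0]
      fun t : ℝ => t ^ 1 := by
    have h1 : HasDerivAt (fun t => u (x + t) - u (x - t)) (u' x - -u' x) 0 :=
      (hasDerivAt_comp_add (by simpa using hu x)).sub (hasDerivAt_comp_sub (by simpa using hu x))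
    have h3 := hasDerivAt_iff_isLittleO.1 h1
    refine (h3.congr_left fun t => ?_).congr_right fun t => ?_
    · simp only [add_zero, sub_zero, sub_self, smul_eq_mul, pow_one]; ring
    · simp
  have hd1 : (fun t => (u' (x + t) - u' (x - t)) - t ^ 1 * (2 * u'' x)) =o[𝓝 0]
      fun t : ℝ => t ^ 1 := by
    have h1 : HasDerivAt (fun t => u' (x + t) - u' (x - t)) (u'' x - -u'' x) 0 :=
      (hasDerivAt_comp_add (by simpa using hu' x)).sub (hasDerivAt_comp_sub (by simpa using hu' x))
    have h3 := hasDerivAt_iff_isLittleO.1 h1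
    refine (h3.congr_left fun t => ?_).congr_right fun t => ?_
    · simp only [add_zero, sub_zero, sub_self, smul_eq_mul, pow_one]; ring
    · simp
  have he : (fun t => (u (x + t) + u (x - t) - 2 * u x) - t ^ 2 * u'' x) =o[𝓝 0]
      fun t : ℝ => t ^ 2 := by
    refine isLittleO_pow_succ_of_hasDerivAt (n := 1) (fun t => ?_) (by simp; ring) hd1
    have h1 := (((hasDerivAt_comp_add (x := x) (t := t) (hu _)).add
      (hasDerivAt_comp_sub (x := x) (t := t) (hu _))).sub_const (2 * u x)).sub
      ((hasDerivAt_pow 2 t).mul_const (u'' x))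
    refine h1.congr_deriv ?_
    simp; ring
  have hw : (fun t => (H (x + t) - H (x - t) - 2 * t * u x) - t ^ 3 * (u'' x / 3)) =o[𝓝 0]
      fun t : ℝ => t ^ 3 := by
    refine isLittleO_pow_succ_of_hasDerivAt (n := 2) (fun t => ?_) (by simp) he
    have h1 := (((hasDerivAt_comp_add (x := x) (t := t) (hH _)).sub
      (hasDerivAt_comp_sub (x := x) (t := t) (hH _))).sub
      (((hasDerivAt_id t).const_mul 2).mul_const (u x))).sub
      ((hasDerivAt_pow 3 t).mul_const (u'' x / 3))
    refine h1.congr_deriv ?_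
    simp; ring
  have Td := (tendsto_div_of_isLittleO hd).div_const 2
  have Te := tendsto_div_of_isLittleO he
  have Tw := (tendsto_div_of_isLittleO hw).div_const 2
  have Tt : Tendsto (fun t : ℝ => t ^ 2) (𝓝[≠] 0) (𝓝 0) := by
    have : Tendsto (fun t : ℝ => t ^ 2) (𝓝 0) (𝓝 (0 ^ 2)) := (continuous_pow 2).tendsto 0
    exact (by simpa using this : Tendsto (fun t : ℝ => t ^ 2) (𝓝 0) (𝓝 0)).mono_left
      nhdsWithin_le_nhds
  have L := ((Tw.const_mul (2 * u x)).add (Tt.mul (Tw.pow 2))).sub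
    ((((Tt.mul Tw).const_add (u x)).pow 2).const_mul (4 * s))
  have R := ((Te.const_mul (u x)).add ((Tt.mul (Te.pow 2)).div_const 4)).sub (Td.pow 2)
  -- The pair (x+t, x-t) is expanded with d → u', e → u'' and w → u''/6. The terms of order t²
  -- cancel, so the inequality can be divided by 4t⁴; its limit is uu''/3 - 4su² ≤ uu'' - u'².
  have key := le_of_tendsto_of_tendsto L R ?_
  · linarith
  · filter_upwards [self_mem_nhdsWithin] with t ht
    have ht : t ≠ 0 := ht
    have h := h2 (x + t) (x - t)
    obtain ⟨d, hd⟩ : ∃ d, (u (x + t) - u (x - t)) / t ^ 1 / 2 = d := ⟨_, rfl⟩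
    obtain ⟨e, he⟩ : ∃ e, (u (x + t) + u (x - t) - 2 * u x) / t ^ 2 = e := ⟨_, rfl⟩
    obtain ⟨w, hw⟩ : ∃ w, (H (x + t) - H (x - t) - 2 * t * u x) / t ^ 3 / 2 = w := ⟨_, rfl⟩
    simp only [hd, he, hw]
    have hd' : u (x + t) - u (x - t) = 2 * t * d := by rw [← hd]; field_simp
    have he' : u (x + t) + u (x - t) - 2 * u x = t ^ 2 * e := by rw [← he]; field_simp
    have hw' : H (x + t) - H (x - t) = 2 * t * (u x + t ^ 2 * w) := by
      rw [← hw]; field_simp; ring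
    have hp : u (x + t) = u x + t ^ 2 * e / 2 + t * d := by linarith
    have hq : u (x - t) = u x + t ^ 2 * e / 2 - t * d := by linarith
    rw [hw', hp, hq] at h
    have ht4 : 0 < t ^ 4 := by positivity
    refine le_of_mul_le_mul_left ?_ (show 0 < 4 * t ^ 4 by positivity)
    linear_combination h

/-! ### Comparison for the differential inequality -/

/-- The substitution v = u^(-1/2) linearizes the inequality: y = u'/(2u) satisfies y' ≥ y² - a² and
v' = -yv. -/
theorem exists_subsolution {u u' u'' : ℝ → ℝ} {a : ℝ}
    (hpos : ∀ x, 0 < u x) (hu : ∀ x, HasDerivAt u (u' x) x)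
    (hu' : ∀ x, HasDerivAt u' (u'' x) x)
    (h : ∀ x, 3 * u' x ^ 2 ≤ 2 * u x * u'' x + 4 * a ^ 2 * u x ^ 2) :
    ∃ v v' v'' : ℝ → ℝ, (∀ x, 0 < v x) ∧ (∀ x, HasDerivAt v (v' x) x) ∧
      (∀ x, HasDerivAt v' (v'' x) x) ∧ (∀ x, v'' x ≤ a ^ 2 * v x) ∧
      (∀ x, u x * v x ^ 2 = 1) ∧ ∀ x, u' x * v x = -2 * v' x * u x := by
  set y : ℝ → ℝ := fun x => u' x / (2 * u x) with hy
  set v : ℝ → ℝ := fun x => Real.exp (-(Real.log (u x)) / 2) with hv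
  have hvpos : ∀ x, 0 < v x := fun x => Real.exp_pos _
  have hvd : ∀ x, HasDerivAt v (-y x * v x) x := fun x => by
    refine ((hu x).log (hpos x).ne').neg.div_const 2 |>.exp.congr_deriv ?_
    simp only [hy, hv, Pi.neg_apply]; field_simp
  have hyd : ∀ x, HasDerivAt y (u'' x / (2 * u x) - 2 * y x ^ 2) x := fun x => by
    have hne := (hpos x).ne'
    refine ((hu' x).div ((hu x).const_mul 2) (by positivity)).congr_deriv ?_
    simp only [hy]; field_simp
  have hric : ∀ x, y x ^ 2 - a ^ 2 ≤ u'' x / (2 * u x) - 2 * y x ^ 2 := fun x => by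
    have hp := hpos x
    have e1 : 3 * y x ^ 2 = 3 * u' x ^ 2 / (4 * u x ^ 2) := by simp only [hy]; field_simp; ring
    have e2 : u'' x / (2 * u x) = (2 * u x * u'' x) / (4 * u x ^ 2) := by field_simp; ring
    have e3 : a ^ 2 = (4 * a ^ 2 * u x ^ 2) / (4 * u x ^ 2) := by field_simp
    have h3 := div_le_div_of_nonneg_right (h x) (show 0 ≤ 4 * u x ^ 2 by positivity)
    rw [add_div, ← e2, ← e3, ← e1] at h3
    linarith
  refine ⟨v, fun x => -y x * v x,
    fun x => (y x ^ 2 - (u'' x / (2 * u x) - 2 * y x ^ 2)) * v x, hvpos, hvd, fun x => ?_,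
    fun x => mul_le_mul_of_nonneg_right (by linarith [hric x]) (hvpos x).le, fun x => ?_,
    fun x => ?_⟩
  · refine ((hyd x).neg.mul (hvd x)).congr_deriv ?_
    simp only [Pi.neg_apply]; ring
  · simp only [hv]
    nth_rw 1 [← Real.exp_log (hpos x)]
    rw [← Real.exp_nat_mul, ← Real.exp_add, Real.exp_eq_one_iff]
    push_cast; ring
  · have := (hpos x).ne'
    simp only [hy]; field_simp

/-- If the bound fails at x₀, then v' < -av there. Factoring v'' - a²v as (d/dx - a)(d/dx + a)
applied to v propagates this to the right, and e^{ax} v decreases at least linearly until it must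
become negative. -/
theorem deriv_le_of_three_mul_sq_deriv_le {u u' u'' : ℝ → ℝ} {a : ℝ} (ha : 0 ≤ a)
    (hpos : ∀ x, 0 < u x) (hu : ∀ x, HasDerivAt u (u' x) x)
    (hu' : ∀ x, HasDerivAt u' (u'' x) x)
    (h : ∀ x, 3 * u' x ^ 2 ≤ 2 * u x * u'' x + 4 * a ^ 2 * u x ^ 2) (x₀ : ℝ) :
    u' x₀ ≤ 2 * a * u x₀ := by
  obtain ⟨v, v', v'', hv, hvd, hvd', hsub, -, huv⟩ := exists_subsolution hpos hu hu' h
  by_contra hcon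
  push Not at hcon
  set w : ℝ → ℝ := fun x => -(v' x + a * v x) with hw
  have hw0 : 0 < w x₀ := by
    have h1 := mul_lt_mul_of_pos_right hcon (hv x₀)
    rw [huv] at h1
    have h2 : 0 < w x₀ * u x₀ := by simp only [hw]; linarith
    exact pos_of_mul_pos_left h2 (hpos x₀).le
  have hmono : Monotone fun x => Real.exp (-a * x) * w x := by
    refine monotone_of_hasDerivAt_nonneg (f' := fun x => Real.exp (-a * x) *
      (a ^ 2 * v x - v'' x)) (fun x => ?_) fun x => ?_
    · refine ((((hasDerivAt_id x).const_mul (-a)).exp).mul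
        ((hvd' x).add ((hvd x).const_mul a)).neg).congr_deriv ?_
      simp; ring
    · exact mul_nonneg (Real.exp_pos _).le (sub_nonneg.2 (hsub x))
  set c := Real.exp (a * x₀) * w x₀ with hc
  have hc0 : 0 < c := mul_pos (Real.exp_pos _) hw0
  have hlow : ∀ x, x₀ ≤ x → c ≤ Real.exp (a * x) * w x := fun x hx => by
    have h1 := hmono hx
    have h2 : Real.exp (2 * a * x₀) ≤ Real.exp (2 * a * x) := by gcongr
    have h3 : Real.exp (2 * a * x₀) * (Real.exp (-a * x₀) * w x₀) ≤
        Real.exp (2 * a * x) * (Real.exp (-a * x) * w x) :=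
      mul_le_mul h2 h1 (mul_pos (Real.exp_pos _) hw0).le (Real.exp_pos _).le
    rw [← mul_assoc, ← mul_assoc, ← Real.exp_add, ← Real.exp_add] at h3
    convert h3 using 3 <;> ring
  have hev : ∀ x, HasDerivAt (fun x => Real.exp (a * x) * v x + c * x)
      (c - Real.exp (a * x) * w x) x := fun x => by
    refine (((((hasDerivAt_id x).const_mul a).exp).mul (hvd x)).add
      ((hasDerivAt_id x).const_mul c)).congr_deriv ?_
    simp [hw]; ring
  have hanti : AntitoneOn (fun x => Real.exp (a * x) * v x + c * x) (Set.Ici x₀) := by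
    refine antitoneOn_of_deriv_nonpos (convex_Ici _)
      (fun x _ => (hev x).continuousAt.continuousWithinAt)
      (fun x _ => (hev x).differentiableAt.differentiableWithinAt) fun x hx => ?_
    rw [interior_Ici] at hx
    rw [(hev x).deriv]
    exact sub_nonpos.2 (hlow x (le_of_lt hx))
  have hE : 0 < Real.exp (a * x₀) * v x₀ := mul_pos (Real.exp_pos _) (hv _)
  -- The point where the linear upper bound for e^{ax} v reaches zero.
  set X := x₀ + Real.exp (a * x₀) * v x₀ / c with hX
  have hXx : x₀ ≤ X := by rw [hX]; linarith [div_pos hE hc0]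
  have h1 := hanti (Set.mem_Ici.2 le_rfl) (Set.mem_Ici.2 hXx) hXx
  have h2 : 0 < Real.exp (a * X) * v X := mul_pos (Real.exp_pos _) (hv _)
  have h3 : c * X = c * x₀ + Real.exp (a * x₀) * v x₀ := by rw [hX]; field_simp
  simp only at h1
  linarith

theorem abs_deriv_le_of_three_mul_sq_deriv_le {u u' u'' : ℝ → ℝ} {a : ℝ} (ha : 0 ≤ a)
    (hpos : ∀ x, 0 < u x) (hu : ∀ x, HasDerivAt u (u' x) x)
    (hu' : ∀ x, HasDerivAt u' (u'' x) x)
    (h : ∀ x, 3 * u' x ^ 2 ≤ 2 * u x * u'' x + 4 * a ^ 2 * u x ^ 2) (x : ℝ) :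
    |u' x| ≤ 2 * a * u x := by
  refine abs_le.2 ⟨?_, deriv_le_of_three_mul_sq_deriv_le ha hpos hu hu' h x⟩
  have h1 := deriv_le_of_three_mul_sq_deriv_le (u := fun x => u (-x)) (u' := fun x => -u' (-x))
    (u'' := fun x => u'' (-x)) ha (fun x => hpos _)
    (fun x => hasDerivAt_comp_neg (hu (-x)))
    (fun x => (hasDerivAt_comp_neg (hu' (-x))).neg.congr_deriv (neg_neg _))
    (fun x => by simpa using h (-x)) (-x)
  simp only [neg_neg] at h1
  linarith

theorem le_mul_exp_of_three_mul_sq_deriv_le {u u' u'' : ℝ → ℝ} {a : ℝ} (ha : 0 ≤ a)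
    (hpos : ∀ x, 0 < u x) (hu : ∀ x, HasDerivAt u (u' x) x)
    (hu' : ∀ x, HasDerivAt u' (u'' x) x)
    (h : ∀ x, 3 * u' x ^ 2 ≤ 2 * u x * u'' x + 4 * a ^ 2 * u x ^ 2) (x y : ℝ) :
    u x ≤ u y * Real.exp (2 * a * |x - y|) := by
  have h1 := convex_univ.norm_image_sub_le_of_norm_hasDerivWithin_le (C := 2 * a)
    (f := fun x => Real.log (u x)) (f' := fun x => u' x / u x) (x := y) (y := x)
    (fun z _ => ((hu z).log (hpos z).ne').hasDerivWithinAt)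
    (fun z _ => ?_) (Set.mem_univ _) (Set.mem_univ _)
  · rw [Real.norm_eq_abs, Real.norm_eq_abs] at h1
    have h2 := (le_abs_self _).trans h1
    rw [← Real.exp_log (hpos x)]
    nth_rw 1 [← Real.exp_log (hpos y)]
    rw [← Real.exp_add]
    exact Real.exp_le_exp.2 (by linarith)
  · rw [norm_div, Real.norm_of_nonneg (hpos z).le, div_le_iff₀ (hpos z)]
    exact abs_deriv_le_of_three_mul_sq_deriv_le ha hpos hu hu' h z

/-- Evenness gives v'(0) = 0. The Wronskian of v and cosh(ax) starts at zero and decreases, so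
v/cosh(ax) decreases on the half-line. -/
theorem div_cosh_sq_le_of_three_mul_sq_deriv_le {u u' u'' : ℝ → ℝ} {a : ℝ}
    (hpos : ∀ x, 0 < u x) (hu : ∀ x, HasDerivAt u (u' x) x)
    (hu' : ∀ x, HasDerivAt u' (u'' x) x)
    (h : ∀ x, 3 * u' x ^ 2 ≤ 2 * u x * u'' x + 4 * a ^ 2 * u x ^ 2)
    (heven : ∀ x, u (-x) = u x) (x : ℝ) :
    u 0 / Real.cosh (a * x) ^ 2 ≤ u x := by
  wlog hx : 0 ≤ x generalizing x
  · have := this (-x) (by linarith)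
    rwa [heven, mul_neg, Real.cosh_neg] at this
  have h0 : u' 0 = 0 := by
    have h1 : HasDerivAt (fun x => u (-x)) (-u' 0) 0 :=
      hasDerivAt_comp_neg (by simpa using hu 0)
    simp only [heven] at h1
    linarith [h1.unique (hu 0)]
  obtain ⟨v, v', v'', hv, hvd, hvd', hsub, huv2, huv⟩ := exists_subsolution hpos hu hu' h
  have hv0 : v' 0 = 0 := by
    have h1 := huv 0
    rw [h0, zero_mul] at h1
    have := (hpos 0).ne'
    simpa [this] using h1.symm
  have hk : ∀ x, HasDerivAt (fun x => Real.cosh (a * x)) (a * Real.sinh (a * x)) x := fun x => by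
    simpa [mul_comm] using ((hasDerivAt_id x).const_mul a).cosh
  have hs : ∀ x, HasDerivAt (fun x => Real.sinh (a * x)) (a * Real.cosh (a * x)) x := fun x => by
    simpa [mul_comm] using ((hasDerivAt_id x).const_mul a).sinh
  have hP : Antitone fun x => v' x * Real.cosh (a * x) - v x * (a * Real.sinh (a * x)) := by
    refine antitone_of_hasDerivAt_nonpos
      (f' := fun x => (v'' x - a ^ 2 * v x) * Real.cosh (a * x)) (fun x => ?_) fun x => ?_
    · refine (((hvd' x).mul (hk x)).sub ((hvd x).mul ((hs x).const_mul a))).congr_deriv ?_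
      ring
    · exact mul_nonpos_of_nonpos_of_nonneg (sub_nonpos.2 (hsub x)) (Real.cosh_pos _).le
  have hQ : ∀ x, HasDerivAt (fun x => v x / Real.cosh (a * x))
      ((v' x * Real.cosh (a * x) - v x * (a * Real.sinh (a * x))) / Real.cosh (a * x) ^ 2) x :=
    fun x => (hvd x).div (hk x) (Real.cosh_pos _).ne'
  have hanti : AntitoneOn (fun x => v x / Real.cosh (a * x)) (Set.Ici 0) := by
    refine antitoneOn_of_deriv_nonpos (convex_Ici _)
      (fun x _ => (hQ x).continuousAt.continuousWithinAt)
      (fun x _ => (hQ x).differentiableAt.differentiableWithinAt) fun x hx => ?_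
    rw [interior_Ici] at hx
    rw [(hQ x).deriv]
    refine div_nonpos_of_nonpos_of_nonneg ?_ (by positivity)
    simpa [hv0] using hP (le_of_lt hx)
  have h1 := hanti (Set.mem_Ici.2 le_rfl) (Set.mem_Ici.2 hx) hx
  simp only [mul_zero, Real.cosh_zero, div_one] at h1
  have hc := Real.cosh_pos (a * x)
  rw [div_le_iff₀ hc] at h1
  have e : ∀ x, u x = 1 / v x ^ 2 := fun x => by
    rw [eq_div_iff (pow_pos (hv x) 2).ne', huv2]
  rw [e, e, div_div, ← mul_pow]
  exact one_div_le_one_div_of_le (pow_pos (hv x) 2) (pow_le_pow_left₀ (hv x).le h1 2)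

/-- Near a zero of the derivative the two-point inequality makes H constant, so the zero set is open
as well as closed. This secures the strict positivity that u^(-1/2) needs. -/
theorem deriv_eq_zero_or_pos_of_two_point {H : ℝ → ℝ} {s : ℝ} (hH : ContDiff ℝ 1 H)
    (hn : ∀ x, 0 ≤ deriv H x)
    (h2 : ∀ x y, (1 - s * (x - y) ^ 2) * (H x - H y) ^ 2 ≤
      (x - y) ^ 2 * (deriv H x * deriv H y)) :
    (∀ x, deriv H x = 0) ∨ ∀ x, 0 < deriv H x := by
  have hcl : IsClopen {x | deriv H x = 0} := by
    refine ⟨isClosed_eq (hH.continuous_deriv le_rfl) continuous_const, ?_⟩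
    rw [isOpen_iff_eventually]
    intro y hy
    have hev : ∀ᶠ x in 𝓝 y, 0 < 1 - s * (x - y) ^ 2 := by
      have : ContinuousAt (fun x => 1 - s * (x - y) ^ 2) y := by fun_prop
      exact this.eventually (lt_mem_nhds (by simp))
    have hconst : ∀ᶠ x in 𝓝 y, H x = H y := by
      filter_upwards [hev] with x hx
      have h := h2 x y
      rw [show deriv H y = 0 from hy, mul_zero, mul_zero] at h
      have h3 : (H x - H y) ^ 2 ≤ 0 := nonpos_of_mul_nonpos_right h hx
      exact sub_eq_zero.1 (pow_eq_zero_iff two_ne_zero |>.1 (le_antisymm h3 (sq_nonneg _)))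
    filter_upwards [hconst.eventually_nhds] with x hx
    have : H =ᶠ[𝓝 x] fun _ => H y := hx
    change deriv H x = 0
    rw [this.deriv_eq, deriv_const]
  rcases isClopen_iff.1 hcl with h | h
  · exact .inr fun x => lt_of_le_of_ne (hn x) fun h0 =>
      (h ▸ (h0.symm : x ∈ {x | deriv H x = 0}) : x ∈ (∅ : Set ℝ)).elim
  · exact .inl fun x => (h ▸ Set.mem_univ x : x ∈ {x | deriv H x = 0})

theorem deriv_growth_of_two_point {H : ℝ → ℝ} {a : ℝ} (ha : 0 ≤ a) (hH : ContDiff ℝ 3 H)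
    (hn : ∀ x, 0 ≤ deriv H x)
    (h2 : ∀ x y, (1 - a ^ 2 / 3 * (x - y) ^ 2) * (H x - H y) ^ 2 ≤
      (x - y) ^ 2 * (deriv H x * deriv H y)) :
    (∀ x y, deriv H x ≤ deriv H y * Real.exp (2 * a * |x - y|)) ∧
      ((∀ x, deriv H (-x) = deriv H x) →
        ∀ x, deriv H 0 / Real.cosh (a * x) ^ 2 ≤ deriv H x) := by
  rcases deriv_eq_zero_or_pos_of_two_point (hH.of_le (by norm_num)) hn h2 with h | h
  · exact ⟨fun x y => by simp [h], fun _ x => by simp [h]⟩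
  have hH' : ContDiff ℝ 2 (deriv H) :=
    ((contDiff_succ_iff_deriv (n := 2)).1 (hH.of_le (by norm_num))).2.2
  have hH'' : ContDiff ℝ 1 (deriv (deriv H)) :=
    ((contDiff_succ_iff_deriv (n := 1)).1 (hH'.of_le (by norm_num))).2.2
  have hd : ∀ x, HasDerivAt H (deriv H x) x := fun x =>
    (hH.differentiable (by norm_num) x).hasDerivAt
  have hd' : ∀ x, HasDerivAt (deriv H) (deriv (deriv H) x) x := fun x =>
    (hH'.differentiable (by norm_num) x).hasDerivAt
  have hd'' : ∀ x, HasDerivAt (deriv (deriv H)) (deriv (deriv (deriv H)) x) x := fun x =>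
    (hH''.differentiable (by norm_num) x).hasDerivAt
  have hineq : ∀ x, 3 * deriv (deriv H) x ^ 2 ≤
      2 * deriv H x * deriv (deriv (deriv H)) x + 4 * a ^ 2 * deriv H x ^ 2 := fun x => by
    have := three_mul_sq_deriv_le hd hd' hd'' h2 x
    linarith
  exact ⟨le_mul_exp_of_three_mul_sq_deriv_le ha h hd' hd'' hineq,
    fun he => div_cosh_sq_le_of_three_mul_sq_deriv_le h hd' hd'' hineq he⟩

/-! ### Variance and the characteristic function -/

theorem integrable_id_of_sq {μ : Measure ℝ} [IsFiniteMeasure μ]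
    (h : Integrable (fun ξ : ℝ => ξ ^ 2) μ) : Integrable (fun ξ : ℝ => ξ) μ := by
  have h1 : Integrable (fun ξ : ℝ => 1 + ξ ^ 2) μ := (integrable_const 1).add h
  refine h1.mono' measurable_id.aestronglyMeasurable (Eventually.of_forall fun ξ => ?_)
  rw [Real.norm_eq_abs]
  nlinarith [sq_nonneg (|ξ| - 1), sq_abs ξ, abs_nonneg ξ]

theorem integral_sub_mean_sq {μ : Measure ℝ} [IsProbabilityMeasure μ]
    (h : Integrable (fun ξ : ℝ => ξ ^ 2) μ) :
    Integrable (fun ξ => (ξ - ∫ η, η ∂μ) ^ 2) μ ∧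
    ∫ ξ, (ξ - ∫ η, η ∂μ) ^ 2 ∂μ = (∫ ξ, ξ ^ 2 ∂μ) - (∫ ξ, ξ ∂μ) ^ 2 := by
  set m := ∫ η, η ∂μ with hm
  have h1 := integrable_id_of_sq h
  have h2 : Integrable (fun ξ : ℝ => ξ ^ 2 - 2 * m * ξ) μ := h.sub (h1.const_mul (2 * m))
  have e : (fun ξ : ℝ => (ξ - m) ^ 2) = fun ξ => (ξ ^ 2 - 2 * m * ξ) + m ^ 2 := by
    ext ξ; ring
  rw [e]
  refine ⟨h2.add (integrable_const _), ?_⟩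
  rw [integral_add (f := fun ξ : ℝ => ξ ^ 2 - 2 * m * ξ) h2 (integrable_const _),
    integral_sub (f := fun ξ : ℝ => ξ ^ 2) h (h1.const_mul (2 * m)), integral_const_mul, ← hm]
  simp; ring

/-- After centring at the mean, the real part is the integral of cos(t(ξ-m)) ≥ 1 - t²(ξ-m)²/2.
Squaring is legitimate when the lower bound is nonnegative; otherwise the left side is already
negative. -/
theorem one_sub_variance_mul_sq_le_norm_charFun_sq {μ : Measure ℝ} [IsProbabilityMeasure μ]
    (h : Integrable (fun ξ : ℝ => ξ ^ 2) μ) (t : ℝ) :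
    1 - ((∫ ξ, ξ ^ 2 ∂μ) - (∫ ξ, ξ ∂μ) ^ 2) * t ^ 2 ≤ ‖charFun μ t‖ ^ 2 := by
  obtain ⟨hi, hv⟩ := integral_sub_mean_sq h
  rw [← hv]
  set m := ∫ η, η ∂μ with hm
  set V := ∫ ξ, (ξ - m) ^ 2 ∂μ with hV
  have h1 : 1 - t ^ 2 / 2 * V ≤ ‖charFun μ t‖ := by
    have hint : Integrable (fun ξ : ℝ => Complex.exp (((t * (ξ - m) : ℝ) : ℂ) * Complex.I)) μ :=
      Integrable.of_bound (Continuous.aestronglyMeasurable (by fun_prop)) 1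
        (Eventually.of_forall fun x => (Complex.norm_exp_ofReal_mul_I _).le)
    have e : ∫ ξ, Complex.exp (((t * (ξ - m) : ℝ) : ℂ) * Complex.I) ∂μ =
        Complex.exp (((-(t * m) : ℝ) : ℂ) * Complex.I) * charFun μ t := by
      rw [charFun_apply_real, ← integral_const_mul]
      refine integral_congr_ae (Eventually.of_forall fun x => ?_)
      simp only
      rw [← Complex.exp_add]
      congr 1
      push_cast; ring
    have hn : ‖charFun μ t‖ = ‖∫ ξ, Complex.exp (((t * (ξ - m) : ℝ) : ℂ) * Complex.I) ∂μ‖ := by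
      rw [e, norm_mul, Complex.norm_exp_ofReal_mul_I, one_mul]
    have hre : (∫ ξ, Complex.exp (((t * (ξ - m) : ℝ) : ℂ) * Complex.I) ∂μ).re =
        ∫ ξ, Real.cos (t * (ξ - m)) ∂μ := by
      have := integral_re hint
      simp only [RCLike.re_to_complex, Complex.exp_ofReal_mul_I_re] at this
      exact this.symm
    rw [hn]
    refine le_trans ?_ (Complex.re_le_norm _)
    rw [hre]
    have hlow : Integrable (fun ξ => 1 - t ^ 2 / 2 * (ξ - m) ^ 2) μ :=
      (integrable_const 1).sub (hi.const_mul _)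
    have e2 : ∫ ξ, (1 - t ^ 2 / 2 * (ξ - m) ^ 2) ∂μ = 1 - t ^ 2 / 2 * V := by
      rw [integral_sub (integrable_const 1) (hi.const_mul _), integral_const_mul, ← hV]
      simp
    rw [← e2]
    refine integral_mono hlow ?_ fun ξ => ?_
    · refine hint.re.congr (Eventually.of_forall fun ξ => ?_)
      simp only [RCLike.re_to_complex, Complex.exp_ofReal_mul_I_re]
    · have := Real.one_sub_sq_div_two_le_cos (x := t * (ξ - m))
      simp only
      linarith [mul_pow t (ξ - m) 2]
  rcases le_total 0 (1 - t ^ 2 / 2 * V) with h0 | h0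
  · have := pow_le_pow_left₀ h0 h1 2
    nlinarith [sq_nonneg (t ^ 2 / 2 * V)]
  · nlinarith [sq_nonneg ‖charFun μ t‖]

theorem two_point_of_variance {f g : ℝ → ℝ} {hf : BddMeas f} {hg : BddMeas g}
    (h : (iComm hf hg).IsPositive) (hm : Monotone f) (h1 : dMeasure hm Set.univ = 1)
    (hi : Integrable (fun ξ : ℝ => ξ ^ 2) (dMeasure hm)) (n : ℕ) (x y : ℝ) :
    (1 - ((∫ ξ, ξ ^ 2 ∂(dMeasure hm)) - (∫ ξ, ξ ∂(dMeasure hm)) ^ 2) * (x - y) ^ 2) *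
      (mollify (moll n) g x - mollify (moll n) g y) ^ 2 ≤
      (x - y) ^ 2 * (deriv (mollify (moll n) g) x * deriv (mollify (moll n) g) y) := by
  have : IsProbabilityMeasure (dMeasure hm) := ⟨h1⟩
  have h2 := two_point_inequality h hm n x y
  rw [probReal_univ, one_mul] at h2
  refine le_trans ?_ h2
  exact mul_le_mul_of_nonneg_right (one_sub_variance_mul_sq_le_norm_charFun_sq hi _) (sq_nonneg _)

theorem deriv_mollify_growth {f g : ℝ → ℝ} {hf : BddMeas f} {hg : BddMeas g}
    (h : (iComm hf hg).IsPositive) (hm : Monotone f) (h1 : dMeasure hm Set.univ = 1)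
    (hi : Integrable (fun ξ : ℝ => ξ ^ 2) (dMeasure hm)) {a : ℝ} (ha : 0 ≤ a)
    (hav : a ^ 2 = 3 * ((∫ ξ, ξ ^ 2 ∂(dMeasure hm)) - (∫ ξ, ξ ∂(dMeasure hm)) ^ 2)) (n : ℕ) :
    (∀ x y, deriv (mollify (moll n) g) x ≤
      deriv (mollify (moll n) g) y * Real.exp (2 * a * |x - y|)) ∧
      ((∀ x, deriv (mollify (moll n) g) (-x) = deriv (mollify (moll n) g) x) →
        ∀ x, deriv (mollify (moll n) g) 0 / Real.cosh (a * x) ^ 2 ≤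
          deriv (mollify (moll n) g) x) := by
  refine deriv_growth_of_two_point ha
    (contDiff_mollify (n := 3) (contDiff_moll n) (hasCompactSupport_moll n) hg)
    (deriv_mollify_nonneg h hm (by simp [measureReal_def, h1]) n) fun x y => ?_
  rw [hav, mul_div_cancel_left₀ _ (by norm_num : (3 : ℝ) ≠ 0)]
  exact two_point_of_variance h hm h1 hi n x y

/-! ### Consequences of exponential growth bounds and passage to the limit -/

theorem exp_sub_one_le_mul_exp (s : ℝ) : Real.exp s - 1 ≤ s * Real.exp s := by
  have h1 := Real.add_one_le_exp (-s)
  have h2 := mul_le_mul_of_nonneg_right h1 (Real.exp_pos s).le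
  rw [← Real.exp_add, neg_add_cancel, Real.exp_zero] at h2
  linarith

theorem exists_slope_eq {H U : ℝ → ℝ} (hd : ∀ x, HasDerivAt H (U x) x) (x h : ℝ) :
    ∃ c, |c - x| ≤ |h| ∧ H (x + h) - H x = h * U c := by
  rcases lt_trichotomy h 0 with h0 | h0 | h0
  · obtain ⟨c, hc, hc'⟩ := exists_hasDerivAt_eq_slope H U (a := x + h) (b := x) (by linarith)
      (fun y _ => (hd y).continuousAt.continuousWithinAt) fun y _ => hd y
    refine ⟨c, ?_, ?_⟩
    · rw [abs_of_neg h0, abs_of_neg (by linarith [hc.2])]; linarith [hc.1]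
    · have := h0.ne
      rw [hc', show x - (x + h) = -h by ring]; field_simp; ring
  · exact ⟨x, by simp, by simp [h0]⟩
  · obtain ⟨c, hc, hc'⟩ := exists_hasDerivAt_eq_slope H U (a := x) (b := x + h) (by linarith)
      (fun y _ => (hd y).continuousAt.continuousWithinAt) fun y _ => hd y
    refine ⟨c, ?_, ?_⟩
    · rw [abs_of_pos h0, abs_of_pos (by linarith [hc.1])]; linarith [hc.2]
    · rw [hc', add_sub_cancel_left]; field_simp

/-- On an interval of length 1 the mean of U is at most 2M, and the growth bound compares U(x) with
the value at the mean value point. -/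
theorem le_of_growth {H U : ℝ → ℝ} {a M : ℝ} (ha : 0 ≤ a) (hd : ∀ x, HasDerivAt H (U x) x)
    (hU : ∀ x, 0 ≤ U x) (hM : ∀ x, |H x| ≤ M)
    (hg : ∀ x y, U x ≤ U y * Real.exp (2 * a * |x - y|)) (x : ℝ) :
    U x ≤ 2 * M * Real.exp (2 * a) := by
  obtain ⟨c, hc, hc'⟩ := exists_slope_eq hd x 1
  rw [one_mul] at hc'
  refine (hg x c).trans (mul_le_mul ?_ ?_ (Real.exp_pos _).le ((hU c).trans ?_))
  · rw [← hc']; linarith [(abs_le.1 (hM (x + 1))).2, (abs_le.1 (hM x)).1]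
  · rw [abs_one, abs_sub_comm] at hc
    refine Real.exp_le_exp.2 ?_
    nlinarith
  · rw [← hc']; linarith [(abs_le.1 (hM (x + 1))).2, (abs_le.1 (hM x)).1]

theorem abs_sub_le_of_growth {U : ℝ → ℝ} {a B : ℝ} (ha : 0 ≤ a) (hB : ∀ x, U x ≤ B)
    (hg : ∀ x y, U x ≤ U y * Real.exp (2 * a * |x - y|)) (x y : ℝ) :
    |U x - U y| ≤ B * (Real.exp (2 * a * |x - y|) - 1) := by
  have h1 : 0 ≤ Real.exp (2 * a * |x - y|) - 1 :=
    sub_nonneg.2 (Real.one_le_exp (by positivity))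
  have h2 := hg x y
  have h3 := hg y x
  rw [abs_sub_comm y x] at h3
  have h4 := mul_le_mul_of_nonneg_right (hB x) h1
  have h5 := mul_le_mul_of_nonneg_right (hB y) h1
  exact abs_le.2 ⟨by linarith, by linarith⟩

/-- The derivatives are bounded and equicontinuous uniformly in n, so a limit of them is the
derivative of the limit. Multiplicative inequalities between values of U n survive with the same
constant. -/
theorem exists_hasDerivAt_of_tendsto {H U : ℕ → ℝ → ℝ} {G : ℝ → ℝ} {a M : ℝ} (ha : 0 ≤ a)
    (hlim : ∀ x, Tendsto (fun n => H n x) atTop (𝓝 (G x)))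
    (hd : ∀ n x, HasDerivAt (H n) (U n x) x) (hU : ∀ n x, 0 ≤ U n x)
    (hM : ∀ n x, |H n x| ≤ M)
    (hg : ∀ n x y, U n x ≤ U n y * Real.exp (2 * a * |x - y|)) :
    ∃ u : ℝ → ℝ, (∀ x, HasDerivAt G (u x) x) ∧
      ∀ x y c, (∀ n, U n x ≤ U n y * c) → u x ≤ u y * c := by
  have hM0 : 0 ≤ M := (abs_nonneg _).trans (hM 0 0)
  set B := 2 * M * Real.exp (2 * a) with hB
  have hB0 : 0 ≤ B := by positivity
  have hUB : ∀ n x, U n x ≤ B := fun n => le_of_growth ha (hd n) (hU n) (hM n) (hg n)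
  -- An ultrafilter finer than `atTop` gives a limit at all points simultaneously, without
  -- extracting subsequences.
  set 𝒰 : Ultrafilter ℕ := Ultrafilter.of atTop
  have h𝒰 : (𝒰 : Filter ℕ) ≤ atTop := Ultrafilter.of_le atTop
  have hex : ∀ x, ∃ l, Tendsto (fun n => U n x) 𝒰 (𝓝 l) := fun x => by
    obtain ⟨l, -, hl⟩ := (isCompact_Icc (a := 0) (b := B)).ultrafilter_le_nhds
      (𝒰.map fun n => U n x)
      (le_principal_iff.2 (Filter.mem_map.2 (univ_mem' fun n => ⟨hU n x, hUB n x⟩)))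
    exact ⟨l, hl⟩
  choose u hu using hex
  refine ⟨u, fun x => ?_, fun x y c h => le_of_tendsto_of_tendsto' (hu x) ((hu y).mul_const c) h⟩
  have hq : ∀ h, |(G (x + h) - G x) - h * u x| ≤ |h| * (B * (Real.exp (2 * a * |h|) - 1)) :=
    fun h => by
    refine le_of_tendsto ((((hlim (x + h)).mono_left h𝒰).sub ((hlim x).mono_left h𝒰)).sub
      ((hu x).const_mul h)).abs (Eventually.of_forall fun n => ?_)
    obtain ⟨c, hc, hc'⟩ := exists_slope_eq (hd n) x h
    rw [hc', ← mul_sub, abs_mul]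
    refine mul_le_mul_of_nonneg_left ((abs_sub_le_of_growth ha (hUB n) (hg n) c x).trans ?_)
      (abs_nonneg _)
    gcongr
  rw [hasDerivAt_iff_tendsto_slope_zero, tendsto_iff_norm_sub_tendsto_zero]
  have hz : Tendsto (fun h : ℝ => B * (Real.exp (2 * a * |h|) - 1)) (𝓝[≠] 0) (𝓝 0) := by
    have : Continuous fun h : ℝ => B * (Real.exp (2 * a * |h|) - 1) := by fun_prop
    have h1 := this.tendsto 0
    simp only [abs_zero, mul_zero, Real.exp_zero, sub_self] at h1
    exact h1.mono_left nhdsWithin_le_nhds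
  refine squeeze_zero' (Eventually.of_forall fun _ => norm_nonneg _) ?_ hz
  filter_upwards [self_mem_nhdsWithin] with h hh
  have hh : h ≠ 0 := hh
  have e : h⁻¹ • (G (x + h) - G x) - u x = h⁻¹ * ((G (x + h) - G x) - h * u x) := by
    rw [smul_eq_mul]; field_simp
  rw [e, Real.norm_eq_abs, abs_mul, abs_inv, inv_mul_le_iff₀ (abs_pos.2 hh)]
  exact hq h

theorem lipschitzWith_of_growth {u : ℝ → ℝ} {a B : ℝ} (ha : 0 ≤ a) (h0 : ∀ x, 0 ≤ u x)
    (hB : ∀ x, u x ≤ B) (hg : ∀ x y, u x ≤ u y * Real.exp (2 * a * |x - y|)) :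
    ∃ K, LipschitzWith K u := by
  have hB0 : 0 ≤ B := (h0 0).trans (hB 0)
  have hK : 0 ≤ B * (2 * a * Real.exp (2 * a) + 1) := by positivity
  refine ⟨⟨_, hK⟩, LipschitzWith.of_dist_le_mul fun x y => ?_⟩
  rw [Real.dist_eq, Real.dist_eq]
  change |u x - u y| ≤ B * (2 * a * Real.exp (2 * a) + 1) * |x - y|
  have hp : 0 ≤ B * (2 * a * Real.exp (2 * a)) * |x - y| := by positivity
  have hp' : 0 ≤ B * |x - y| := by positivity
  rcases le_total |x - y| 1 with h | h
  · have h1 := abs_sub_le_of_growth ha hB hg x y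
    have h2 := exp_sub_one_le_mul_exp (2 * a * |x - y|)
    have h3 : 2 * a * |x - y| * Real.exp (2 * a * |x - y|) ≤
        2 * a * |x - y| * Real.exp (2 * a) := by
      have : 2 * a * |x - y| ≤ 2 * a := mul_le_of_le_one_right (by positivity) h
      gcongr
    have h4 := mul_le_mul_of_nonneg_left (h2.trans h3) hB0
    linarith
  · have h1 : |u x - u y| ≤ B :=
      abs_le.2 ⟨by linarith [h0 x, hB y], by linarith [h0 y, hB x]⟩
    have h2 : B ≤ B * |x - y| := le_mul_of_one_le_right hB0 h
    linarith

/-- The growth bound says that u e^{2ax} increases and u e^{-2ax} decreases; both derivatives have a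
sign. -/
theorem abs_deriv_le_of_growth {u : ℝ → ℝ} {a : ℝ}
    (hg : ∀ x y, u x ≤ u y * Real.exp (2 * a * |x - y|)) {x : ℝ} (hd : DifferentiableAt ℝ u x) :
    |deriv u x| ≤ 2 * a * u x := by
  have hm1 : Monotone fun y => u y * Real.exp (2 * a * y) := fun y z hyz => by
    have h := mul_le_mul_of_nonneg_right (hg y z) (Real.exp_pos (2 * a * y)).le
    rw [abs_of_nonpos (by linarith), mul_assoc (u z), ← Real.exp_add] at h
    convert h using 3
    ring
  have hm2 : Monotone fun y => -(u y * Real.exp (-(2 * a) * y)) := fun y z hyz => by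
    have h := mul_le_mul_of_nonneg_right (hg z y) (Real.exp_pos (-(2 * a) * z)).le
    rw [abs_of_nonneg (by linarith), mul_assoc (u y), ← Real.exp_add] at h
    refine neg_le_neg (h.trans (le_of_eq ?_))
    congr 2
    ring
  have d1 := (hd.hasDerivAt.mul (((hasDerivAt_id x).const_mul (2 * a)).exp)).nonneg_of_monotone hm1
  have d2 := (hd.hasDerivAt.mul
    (((hasDerivAt_id x).const_mul (-(2 * a))).exp)).neg.nonneg_of_monotone hm2
  simp only [id, mul_one] at d1 d2
  have e1 : 0 ≤ (deriv u x + 2 * a * u x) * Real.exp (2 * a * x) := by linarith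
  have e2 : 0 ≤ (2 * a * u x - deriv u x) * Real.exp (-(2 * a) * x) := by linarith
  have f1 := nonneg_of_mul_nonneg_left e1 (Real.exp_pos _)
  have f2 := nonneg_of_mul_nonneg_left e2 (Real.exp_pos _)
  exact abs_le.2 ⟨by linarith, by linarith⟩

/-- Integrate u(y) ≥ u(x) e^{-2a(y-x)} over y from x to infinity. -/
theorem deriv_le_mul_sub_of_growth {G u : ℝ → ℝ} {a L : ℝ} (ha : 0 ≤ a) (h0 : ∀ x, 0 ≤ u x)
    (hd : ∀ x, HasDerivAt G (u x) x) (hL : Tendsto G atTop (𝓝 L))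
    (hg : ∀ x y, u x ≤ u y * Real.exp (2 * a * |x - y|)) (x : ℝ) :
    u x ≤ 2 * a * (L - G x) := by
  -- A strictly larger rate b makes the exponential decay even when a = 0; b tends to a at the end.
  have key : ∀ b, a < b → u x ≤ 2 * b * (L - G x) := fun b hb => by
    have hb0 : 0 < b := ha.trans_lt hb
    have hF : ∀ y, HasDerivAt (fun y => 2 * b * G y + u x * Real.exp (-(2 * b) * (y - x)))
        (2 * b * (u y - u x * Real.exp (-(2 * b) * (y - x)))) y := fun y => by
      refine (((hd y).const_mul (2 * b)).add
        (((((hasDerivAt_id y).sub_const x).const_mul (-(2 * b))).exp).const_mul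
          (u x))).congr_deriv ?_
      simp only [id]
      ring
    have hmono : MonotoneOn (fun y => 2 * b * G y + u x * Real.exp (-(2 * b) * (y - x)))
        (Set.Ici x) := by
      refine monotoneOn_of_deriv_nonneg (convex_Ici _)
        (fun y _ => (hF y).continuousAt.continuousWithinAt)
        (fun y _ => (hF y).differentiableAt.differentiableWithinAt) fun y hy => ?_
      rw [interior_Ici] at hy
      have hy : x < y := hy
      rw [(hF y).deriv]
      refine mul_nonneg (by positivity) (sub_nonneg.2 ?_)
      rw [neg_mul, Real.exp_neg, ← div_eq_mul_inv, div_le_iff₀ (Real.exp_pos _)]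
      refine (hg x y).trans (mul_le_mul_of_nonneg_left (Real.exp_le_exp.2 ?_) (h0 y))
      rw [abs_of_neg (by linarith), neg_sub]
      exact mul_le_mul_of_nonneg_right (by linarith) (by linarith)
    have hT : Tendsto (fun y => 2 * b * G y + u x * Real.exp (-(2 * b) * (y - x))) atTop
        (𝓝 (2 * b * L + u x * 0)) := by
      refine (hL.const_mul _).add (Tendsto.const_mul _ ?_)
      refine Real.tendsto_exp_atBot.comp ?_
      exact (tendsto_atTop_add_const_right _ (-x) tendsto_id).const_mul_atTop_of_neg
        (by linarith)
    have h1 : 2 * b * G x + u x * Real.exp (-(2 * b) * (x - x)) ≤ 2 * b * L + u x * 0 := by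
      refine ge_of_tendsto hT ?_
      filter_upwards [eventually_ge_atTop x] with y hy
      exact hmono (Set.mem_Ici.2 le_rfl) (Set.mem_Ici.2 hy) hy
    simp only [sub_self, mul_zero, Real.exp_zero, mul_one, add_zero] at h1
    linarith
  have hT : Tendsto (fun b : ℝ => 2 * b * (L - G x)) (𝓝[>] a) (𝓝 (2 * a * (L - G x))) := by
    have : Continuous fun b : ℝ => 2 * b * (L - G x) := by fun_prop
    exact (this.tendsto a).mono_left nhdsWithin_le_nhds
  exact ge_of_tendsto hT (by filter_upwards [self_mem_nhdsWithin] with b hb using key b hb)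

theorem deriv_le_mul_sub_of_growth_atBot {G u : ℝ → ℝ} {a L : ℝ} (ha : 0 ≤ a)
    (h0 : ∀ x, 0 ≤ u x) (hd : ∀ x, HasDerivAt G (u x) x) (hL : Tendsto G atBot (𝓝 L))
    (hg : ∀ x y, u x ≤ u y * Real.exp (2 * a * |x - y|)) (x : ℝ) :
    u x ≤ 2 * a * (G x - L) := by
  have h := deriv_le_mul_sub_of_growth (G := fun x => -G (-x)) (u := fun x => u (-x)) (L := -L) ha
    (fun x => h0 _) (fun x => (hasDerivAt_comp_neg (hd (-x))).neg.congr_deriv (neg_neg _))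
    (hL.comp tendsto_neg_atTop_atBot).neg (fun x y => ?_) (-x)
  · simp only [neg_neg] at h
    linarith
  · have := hg (-x) (-y)
    rwa [neg_sub_neg, abs_sub_comm] at this

/-! ### The infimum over partners and the main theorem -/

theorem iComm_neg_right {f g : ℝ → ℝ} (hf : BddMeas f) (hg : BddMeas g) :
    iComm hf hg.neg = -iComm hf hg := by
  rw [iComm, iComm, opQ_neg hg]
  ext1 ψ
  change Complex.I • (opP hf (-(opQ hg ψ)) - -(opQ hg (opP hf ψ))) =
    -(Complex.I • (opP hf (opQ hg ψ) - opQ hg (opP hf ψ)))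
  rw [map_neg, ← smul_neg, neg_sub_neg, neg_sub]

theorem monotone_of_isPositive {f g : ℝ → ℝ} {hf : BddMeas f} {hg : BddMeas g}
    (h : (iComm hf hg).IsPositive) (hm : Monotone f) (hμ : 0 < (dMeasure hm).real Set.univ)
    (hgc : Continuous g) : Monotone g := by
  obtain ⟨g₁, hg₁, ⟨M, hM⟩, hgg⟩ :=
    exists_monotone_ae_eq_of_mollify hg (monotone_mollify h hm hμ)
  have hgb : BddMeas g₁ := ⟨hg₁.measurable.aemeasurable, M, hM⟩
  have hc : iComm hf hgb = iComm hf hg := iComm_congr hf hf hgb hg .rfl hgg.symm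
  have hg₁c : Continuous g₁ := continuous_of_monotone_right (hg := hgb) (hc ▸ h) hm hμ hg₁
  rwa [(hgc.ae_eq_iff_eq volume hg₁c).1 hgg]

/-- A vanishing commutator is nonnegative for g and for -g, so both are increasing. -/
theorem eq_const_of_iComm_eq_zero {f g : ℝ → ℝ} {hf : BddMeas f} {hg : BddMeas g}
    (h : iComm hf hg = 0) (hm : Monotone f) (hμ : 0 < (dMeasure hm).real Set.univ)
    (hgc : Continuous g) (x y : ℝ) : g x = g y := by
  have h1 : Monotone g := monotone_of_isPositive (hf := hf) (hg := hg)
    (h ▸ ContinuousLinearMap.isPositive_zero) hm hμ hgc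
  have h2 : Monotone fun x => -g x := monotone_of_isPositive (hf := hf) (hg := hg.neg)
    (by rw [iComm_neg_right hf hg, h, neg_zero]; exact ContinuousLinearMap.isPositive_zero) hm hμ hgc.neg
  rcases le_total x y with hxy | hxy
  · exact le_antisymm (h1 hxy) (neg_le_neg_iff.1 (h2 hxy))
  · exact le_antisymm (neg_le_neg_iff.1 (h2 hxy)) (h1 hxy)

theorem tendsto_mollify_moll {g : ℝ → ℝ} (hg : BddMeas g) (hm : Monotone g) (hc : Continuous g)
    (x : ℝ) : Tendsto (fun n => mollify (moll n) g x) atTop (𝓝 (g x)) := by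
  have h1 : Tendsto (fun n : ℕ => g (x - 1 / ((n : ℝ) + 1))) atTop (𝓝 (g x)) := by
    have := (hc.tendsto (x - 0)).comp (tendsto_one_div_succ.const_sub x)
    rwa [sub_zero] at this
  have h2 : Tendsto (fun n : ℕ => g (x + 1 / ((n : ℝ) + 1))) atTop (𝓝 (g x)) := by
    have := (hc.tendsto (x + 0)).comp (tendsto_one_div_succ.const_add x)
    rwa [add_zero] at this
  exact tendsto_of_tendsto_of_tendsto_of_le_of_le h1 h2
    (fun n => (le_mollify_of_monotone hg hm n x).1) fun n => (le_mollify_of_monotone hg hm n x).2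

theorem mollify_moll_neg {g : ℝ → ℝ} (hodd : ∀ x, g (-x) = -g x) (n : ℕ) (x : ℝ) :
    mollify (moll n) g (-x) = -mollify (moll n) g x := by
  rw [mollify, mollify, ← integral_neg, ← integral_neg_eq_self]
  refine integral_congr_ae (Eventually.of_forall fun s => ?_)
  simp only
  rw [moll_neg, show -x - -s = -(x - s) by ring, hodd, mul_neg]

theorem deriv_mollify_moll_neg {g : ℝ → ℝ} (hodd : ∀ x, g (-x) = -g x) (n : ℕ) (x : ℝ) :
    deriv (mollify (moll n) g) (-x) = deriv (mollify (moll n) g) x := by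
  have h1 := deriv_comp_neg (mollify (moll n) g) x
  simp only [mollify_moll_neg hodd n, deriv.fun_neg] at h1
  linarith

theorem exists_deriv_of_variance {f g : ℝ → ℝ} {hf : BddMeas f} {hg : BddMeas g}
    (h : (iComm hf hg).IsPositive) (hm : Monotone f) (h1 : dMeasure hm Set.univ = 1)
    (hi : Integrable (fun ξ : ℝ => ξ ^ 2) (dMeasure hm)) (hgc : Continuous g) {a : ℝ} (ha : 0 ≤ a)
    (hav : a ^ 2 = 3 * ((∫ ξ, ξ ^ 2 ∂(dMeasure hm)) - (∫ ξ, ξ ∂(dMeasure hm)) ^ 2)) :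
    (∀ x, HasDerivAt g (deriv g x) x) ∧
      (∀ x y, deriv g x ≤ deriv g y * Real.exp (2 * a * |x - y|)) ∧
      ((∀ x, g (-x) = -g x) → ∀ x, deriv g 0 / Real.cosh (a * x) ^ 2 ≤ deriv g x) := by
  have hμ : 0 < (dMeasure hm).real Set.univ := by simp [measureReal_def, h1]
  have hgm := monotone_of_isPositive h hm hμ hgc
  obtain ⟨M, hM⟩ := hg.bounded
  obtain ⟨u, hu, huc⟩ := exists_hasDerivAt_of_tendsto ha (tendsto_mollify_moll hg hgm hgc)
    (fun n x => (differentiable_mollify_moll hg n x).hasDerivAt)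
    (deriv_mollify_nonneg h hm hμ) (abs_mollify_moll_le hM)
    (fun n => (deriv_mollify_growth h hm h1 hi ha hav n).1)
  obtain rfl : deriv g = u := funext fun x => (hu x).deriv
  refine ⟨hu, fun x y => huc x y _ fun n => (deriv_mollify_growth h hm h1 hi ha hav n).1 x y,
    fun hodd x => ?_⟩
  have hc : 0 < Real.cosh (a * x) ^ 2 := by positivity
  rw [div_le_iff₀ hc]
  refine huc 0 x _ fun n => ?_
  rw [← div_le_iff₀ hc]
  exact (deriv_mollify_growth h hm h1 hi ha hav n).2 (deriv_mollify_moll_neg hodd n) x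

theorem variance_nonneg_of_mem {G : ℝ → ℝ} {hG : BddMeas G} {v : ℝ}
    (hv : v ∈ partnerVariances hG) : 0 ≤ v := by
  obtain ⟨f, hf, hm, -, -, h1, hi, rfl⟩ := hv
  have : IsProbabilityMeasure (dMeasure hm) := ⟨h1⟩
  rw [← (integral_sub_mean_sq hi).2]
  exact integral_nonneg fun _ => sq_nonneg _

theorem aHat_nonneg {G : ℝ → ℝ} (hG : BddMeas G) : 0 ≤ aHat hG :=
  mul_nonneg (Real.sqrt_nonneg _) (Real.sqrt_nonneg _)

/-- The infimum need not be attained: the estimates hold for each admissible variance and are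
continuous in the rate, so a minimizing sequence suffices. -/
theorem deriv_growth_aHat {G g : ℝ → ℝ} {hG : BddMeas G} (hg : BddMeas g) (hGg : G =ᵐ[volume] g)
    (hgc : Continuous g) (hne : (partnerVariances hG).Nonempty) :
    (∀ x, HasDerivAt g (deriv g x) x) ∧
      (∀ x y, deriv g x ≤ deriv g y * Real.exp (2 * aHat hG * |x - y|)) ∧
      ((∀ x, g (-x) = -g x) → ∀ x, deriv g 0 / Real.cosh (aHat hG * x) ^ 2 ≤ deriv g x) := by
  have key : ∀ v ∈ partnerVariances hG, (∀ x, HasDerivAt g (deriv g x) x) ∧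
      (∀ x y, deriv g x ≤ deriv g y * Real.exp (2 * (√3 * √v) * |x - y|)) ∧
      ((∀ x, g (-x) = -g x) →
        ∀ x, deriv g 0 / Real.cosh ((√3 * √v) * x) ^ 2 ≤ deriv g x) := fun v hv => by
    have hv0 := variance_nonneg_of_mem hv
    obtain ⟨f, hf, hm, hp, -, h1, hi, hv'⟩ := hv
    rw [iComm_congr hf hf hG hg .rfl hGg] at hp
    refine exists_deriv_of_variance hp hm h1 hi hgc (by positivity) ?_
    rw [mul_pow, Real.sq_sqrt (by norm_num), Real.sq_sqrt hv0, hv']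
  obtain ⟨v, -, hv, hvm⟩ := exists_seq_tendsto_sInf hne ⟨0, fun v hv => variance_nonneg_of_mem hv⟩
  have ha : Tendsto (fun k => √3 * √(v k)) atTop (𝓝 (aHat hG)) := (hv.sqrt).const_mul _
  refine ⟨(key _ (hvm 0)).1, fun x y => ?_, fun hodd x => ?_⟩
  · have hc : Continuous fun a : ℝ => deriv g y * Real.exp (2 * a * |x - y|) := by fun_prop
    exact ge_of_tendsto' ((hc.tendsto _).comp ha) fun k => (key _ (hvm k)).2.1 x y
  · have hc : Continuous fun a : ℝ => deriv g 0 / Real.cosh (a * x) ^ 2 :=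
      continuous_const.div (by fun_prop) fun a => (pow_pos (Real.cosh_pos _) 2).ne'
    exact le_of_tendsto' ((hc.tendsto _).comp ha) fun k => (key _ (hvm k)).2.2 hodd x

theorem mainTheorem8 (F G : ℝ → ℝ) (hF : BddMeas F) (hG : BddMeas G)
    (hpos : (iComm hF hG).IsPositive) (hne : iComm hF hG ≠ 0) :
    ∃ F₁ G₁ : ℝ → ℝ, F =ᵐ[volume] F₁ ∧ G =ᵐ[volume] G₁ ∧
      Continuous F₁ ∧ Continuous G₁ ∧
      ((Monotone F₁ ∧ Monotone G₁) ∨ (Antitone F₁ ∧ Antitone G₁)) ∧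
      ((∃ f : ℝ → ℝ, IsPartner hG f) →
        ContDiff ℝ 1 G₁ ∧
        (∃ K, LipschitzWith K (deriv G₁)) ∧
        (∀ a b : ℝ, AbsolutelyContinuousOnInterval (deriv G₁) a b) ∧
        (∀ x₀ x : ℝ,
          deriv G₁ x₀ * Real.exp (-2 * aHat hG * |x - x₀|) ≤ deriv G₁ x ∧
          deriv G₁ x ≤ deriv G₁ x₀ * Real.exp (2 * aHat hG * |x - x₀|)) ∧
        (∀ᵐ x ∂(volume : Measure ℝ), DifferentiableAt ℝ (deriv G₁) x ∧
          |deriv (deriv G₁) x| ≤ 2 * aHat hG * deriv G₁ x) ∧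
        (∃ Gneg Gpos : ℝ, Tendsto G₁ atBot (𝓝 Gneg) ∧ Tendsto G₁ atTop (𝓝 Gpos) ∧
          ∀ x : ℝ, deriv G₁ x ≤ 2 * aHat hG * |Gpos - G₁ x| ∧
            deriv G₁ x ≤ 2 * aHat hG * |Gneg - G₁ x|) ∧
        ((∀ᵐ x ∂(volume : Measure ℝ), G (-x) = -G x) →
          ∀ x : ℝ, deriv G₁ 0 / Real.cosh (aHat hG * x) ^ 2 ≤ deriv G₁ x)) := by
  obtain ⟨F₁, G₁, hFF, hGG, hFc, hGc, hGb, hmono⟩ := exists_continuous_monotone_or_antitone hpos hne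
  refine ⟨F₁, G₁, hFF, hGG, hFc, hGc, hmono, ?_⟩
  rintro ⟨f, hf, hm, hp, h1, hi⟩
  have hμ : 0 < (dMeasure hm).real Set.univ := by simp [measureReal_def, h1]
  have hcongr : iComm hf hG = iComm hf hGb := iComm_congr hf hf hG hGb .rfl hGG
  -- The partner is increasing with mass 1, which orients G₁ whichever alternative holds in `hmono`.
  have hGm : Monotone G₁ := monotone_of_isPositive (hg := hGb) (hcongr ▸ hp) hm hμ hGc
  -- If the partner commuted with G(Q), G would be constant almost everywhere and would commute with
  -- F(P) too. This makes the set of variances nonempty.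
  have hfne : iComm hf hG ≠ 0 := fun h0 => by
    refine hne (iComm_eq_zero_of_right_const hF hG (c := G₁ 0) ?_)
    filter_upwards [hGG] with x hx
    rw [hx]
    exact eq_const_of_iComm_eq_zero (hg := hGb) (hcongr ▸ h0) hm hμ hGc x 0
  have ha := aHat_nonneg hG
  obtain ⟨hd, hg, hcosh⟩ := deriv_growth_aHat (hG := hG) hGb hGG hGc
    ⟨_, f, hf, hm, hp, hfne, h1, hi, rfl⟩
  have h0 : ∀ x, 0 ≤ deriv G₁ x := fun x => hGm.deriv_nonneg
  obtain ⟨M, hM⟩ := hGb.bounded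
  obtain ⟨K, hK⟩ := lipschitzWith_of_growth ha h0 (le_of_growth ha hd h0 hM hg) hg
  refine ⟨contDiff_one_iff_deriv.2 ⟨fun x => (hd x).differentiableAt, hK.continuous⟩, ⟨K, hK⟩,
    fun a b => hK.lipschitzOnWith.absolutelyContinuousOnInterval, fun x₀ x => ⟨?_, hg x x₀⟩,
    ?_, ?_, fun hodd => hcosh ?_⟩
  · rw [neg_mul, neg_mul, Real.exp_neg, ← div_eq_mul_inv, div_le_iff₀ (Real.exp_pos _),
      abs_sub_comm]
    exact hg x₀ x
  · filter_upwards [hK.ae_differentiableAt_real] with x hx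
    exact ⟨hx, abs_deriv_le_of_growth hg hx⟩
  · have hup : BddAbove (Set.range G₁) :=
      ⟨M, by rintro _ ⟨x, rfl⟩; exact (abs_le.1 (hM x)).2⟩
    have hdn : BddBelow (Set.range G₁) :=
      ⟨-M, by rintro _ ⟨x, rfl⟩; exact (abs_le.1 (hM x)).1⟩
    have hT := tendsto_atTop_ciSup hGm hup
    have hB := tendsto_atBot_ciInf hGm hdn
    refine ⟨_, _, hB, hT, fun x => ⟨?_, ?_⟩⟩
    · rw [abs_of_nonneg (sub_nonneg.2 (le_ciSup hup x))]
      exact deriv_le_mul_sub_of_growth ha h0 hd hT hg x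
    · rw [abs_sub_comm, abs_of_nonneg (sub_nonneg.2 (ciInf_le hdn x))]
      exact deriv_le_mul_sub_of_growth_atBot ha h0 hd hB hg x
  · have hae : (fun x => G₁ (-x)) =ᵐ[volume] fun x => -G₁ x := by
      have hneg := (Measure.measurePreserving_neg (volume : Measure ℝ)).quasiMeasurePreserving.ae hGG
      filter_upwards [hodd, hGG, hneg] with x h2 h3 h4
      rw [← h3, ← h4, h2]
    exact fun x => congrFun
      (((hGc.comp continuous_neg).ae_eq_iff_eq volume hGc.neg).1 hae) x
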